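/- **Theorem (Positivity, type C).** Let $n\geqslant 0$ be an integer and $X=(x_1,\dots,x_n)$, $Y=(y_1,\dots,y_n)$ independent variables. *Groups.* Let $W_n$ be the hyperoctahedral group of signed permutations, that is, of permutations $w$ of $\{\pm1,\dots,\pm n\}$ with $w(-k)=-w(k)$, written $w=(w(1),\dots,w(n))$ with a bar for a negative sign, multiplied as maps, and generated by $s_0=(\overline 1,2,\dots,n)$ and the transpositions $s_i=(i\;\,i{+}1)$, $1\leqslant i\leqslant n-1$. The symmetric group $S_n$ is the subgroup of elements without bars. Put $w_0=(\overline 1,\dots,\overline n)$ and $\varpi_0=(n,n-1,\dots,1)$. *Divided differences.* On $\mathbb Z[X,Y]$ let $s_i$ ($i\geqslant 1$) interchange $x_i$ and $x_{i+1}$ and let $s_0$ replace $x_1$ by $-x_1$, all other variables being fixed. Put $$\partial_0 f=\frac{f-s_0f}{2x_1},\qquad \partial_i f=\frac{f-s_if}{x_i-x_{i+1}}\quad(1\leqslant i\leqslant n-1),\qquad \partial'_0=\partial_0,\quad \partial'_i=-\partial_i\quad(1\leqslant i\leqslant n-1).$$ For $w\in W_n$ let $\partial_w=\partial_{a_1}\circ\cdots\circ\partial_{a_r}$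 and $\partial'_w=\partial'_{a_1}\circ\cdots\circ\partial'_{a_r}$, where $w=s_{a_1}\cdots s_{a_r}$ is any chosen reduced decomposition (one with $r$ minimal). *Type A.* For $\varpi\in S_n$ the Lascoux–Schützenberger double Schubert polynomial is $$\mathfrak S_\varpi(X,Y)=\partial_{\varpi^{-1}\varpi_0}\Delta(X,Y),\qquad \Delta(X,Y)=\prod_{i+j\leqslant n}(x_i-y_j).$$ *Type C.* Let $\widetilde Q_i(X)=e_i(X)$ be the elementary symmetric polynomials, $\widetilde Q_{i,j}=\widetilde Q_i\widetilde Q_j+2\sum_{k=1}^j(-1)^k\widetilde Q_{i+k}\widetilde Q_{j-k}$, and, for a partition $\lambda=(\lambda_1\geqslant\cdots\geqslant\lambda_r\geqslant0)$ with $r$ even (add a zero part if necessary), $\widetilde Q_\lambda(X)=\mathrm{Pfaffian}[\widetilde Q_{\lambda_i,\lambda_j}(X)]_{1\leqslant i<j\leqslant r}$. Let $\widetilde Q(X,Y)=\sum_\lambda\widetilde Q_\lambda(X)\widetilde Q_{\lambda'}(Y)$, summed over the strict partitions $\lambda$ with all parts in $\{1,\dots,n\}$, where $\lambda'$ is the strict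 partition whose parts are the elements of $\{1,\dots,n\}$ that are not parts of $\lambda$. For $w\in W_n$ the type C double Schubert polynomial is $$\mathfrak C_w(X,Y)=(-1)^{n(n-1)/2}\,\partial'_{w^{-1}w_0}\bigl(\Delta(X,Y)\,\widetilde Q(X,Y)\bigr).$$ *Claim.* For every permutation $\varpi\in S_n$, $$\mathfrak C_\varpi(X,Y)=\mathfrak S_{\varpi_0\varpi\varpi_0}(\varpi_0X,-Y),$$ where the right-hand side is $\mathfrak S_{\varpi_0\varpi\varpi_0}$ with $x_i$ replaced by $x_{n+1-i}$ and $y_j$ by $-y_j$. In particular, $\mathfrak C_\varpi(X,Y)$ has nonnegative integer coefficients. -/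

import Mathlib

namespace TypeC

/-! ### The hyperoctahedral group -/

/-- The permutation `k ↦ -k` of the set `{±1, …, ±n}`; the pair `(i, ε)` stands for `ε (i + 1)`. -/
def neg (n : ℕ) : Equiv.Perm (Fin n × ℤˣ) :=
  (Equiv.refl (Fin n)).prodCongr (Equiv.neg ℤˣ)

/-- The hyperoctahedral group `W_n` of signed permutations: the permutations `w` of
`{±1, …, ±n}` with `w (-k) = - w k`. The one-line notation of `w` is `(w 1, …, w n)`, a bar
marking a negative value; the product is composition of maps. -/
abbrev W (n : ℕ) : Type := Subgroup.centralizer ({neg n} : Set (Equiv.Perm (Fin n × ℤˣ)))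

/-- The inclusion `S_n ⊆ W_n` as the signed permutations without bars. -/
def ofPerm (n : ℕ) : Equiv.Perm (Fin n) →* W n where
  toFun σ := ⟨σ.prodCongr (Equiv.refl ℤˣ), by
    rw [Subgroup.mem_centralizer_singleton_iff]
    ext x <;> simp [neg]⟩
  map_one' := by ext x <;> simp
  map_mul' σ τ := by ext x <;> simp

/-- The longest element `w₀ = (-1, …, -n)` of `W_n`. -/
def w₀ (n : ℕ) : W n :=
  ⟨neg n, by rw [Subgroup.mem_centralizer_singleton_iff]⟩

/-- The longest element `ϖ₀ = (n, n - 1, …, 1)` of `S_n`. -/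
abbrev ϖ₀ (n : ℕ) : Equiv.Perm (Fin n) := Fin.revPerm

/-- The signed permutation that changes the sign of `i` and fixes the other absolute values. -/
def signChange {n : ℕ} (i : Fin n) : W n :=
  ⟨Equiv.swap (i, 1) (i, -1), by
    rw [Subgroup.mem_centralizer_singleton_iff]
    ext ⟨j, ε⟩ : 1
    obtain rfl | rfl := Int.units_eq_one_or ε <;> by_cases h : j = i <;>
      simp [neg, Equiv.swap_apply_def, h]⟩

/-- The predecessor of a positive index. -/
def pred {n : ℕ} (k : Fin n) : Fin n := ⟨k.val - 1, by omega⟩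

/-- The generators `s_0, s_1, …, s_{n-1}` of `W_n`: `s_0 = (-1, 2, …, n)`, and for `1 ≤ k ≤ n - 1`
the transposition `s_k` of `k` and `k + 1` (which have the indices `k - 1` and `k` in `Fin n`). -/
def s {n : ℕ} (k : Fin n) : W n :=
  if k.val = 0 then signChange k else ofPerm n (Equiv.swap (pred k) k)

/-- The list `a` is a reduced decomposition `s_{a₁} ⋯ s_{aᵣ}` of `w`: no shorter list has
the product `w`. -/
def IsReducedWord {n : ℕ} (a : List (Fin n)) (w : W n) : Prop :=
  (a.map s).prod = w ∧ ∀ b : List (Fin n), (b.map s).prod = w → a.length ≤ b.length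

theorem ofPerm_mem_closure {n : ℕ} (σ : Equiv.Perm (Fin n)) :
    ofPerm n σ ∈ Submonoid.closure (Set.range (s (n := n))) := by
  rcases n with _ | n
  · rw [Subsingleton.elim σ 1, map_one]
    exact one_mem _
  · have h : σ ∈ Submonoid.closure
        (Set.range fun i : Fin n => Equiv.swap i.castSucc i.succ) := by
      rw [Equiv.Perm.mclosure_swap_castSucc_succ]; trivial
    induction h using Submonoid.closure_induction with
    | mem x hx =>
      obtain ⟨i, rfl⟩ := hx
      refine Submonoid.subset_closure ⟨i.succ, ?_⟩
      have : pred i.succ = i.castSucc := by ext; simp [pred]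
      simp [s, this]
    | one => rw [map_one]; exact one_mem _
    | mul x y _ _ hx hy => rw [map_mul]; exact mul_mem hx hy

theorem signChange_mem_closure {n : ℕ} (i : Fin n) :
    signChange i ∈ Submonoid.closure (Set.range (s (n := n))) := by
  rcases n with _ | n
  · exact i.elim0
  · have h0 : signChange (0 : Fin (n + 1)) ∈ Submonoid.closure (Set.range (s (n := n + 1))) :=
      Submonoid.subset_closure ⟨0, by simp [s]⟩
    have h : signChange i = ofPerm _ (Equiv.swap 0 i) * signChange 0 *
        ofPerm _ (Equiv.swap 0 i) := by
      have e : ((ofPerm _ (Equiv.swap 0 i))⁻¹ : W (n + 1)) = ofPerm _ (Equiv.swap 0 i) := by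
        rw [← map_inv, Equiv.swap_inv]
      nth_rewrite 2 [← e]
      apply Subtype.ext
      have := Equiv.swap_apply_apply (ofPerm _ (Equiv.swap 0 i)).1
        ((0 : Fin (n + 1)), (1 : ℤˣ)) (0, -1)
      simpa [ofPerm, signChange] using this
    rw [h]
    exact mul_mem (mul_mem (ofPerm_mem_closure _) h0) (ofPerm_mem_closure _)

theorem W.map_neg {n : ℕ} (w : W n) (i : Fin n) (ε : ℤˣ) :
    w.1 (i, -ε) = ((w.1 (i, ε)).1, -(w.1 (i, ε)).2) := by
  have h := Subgroup.mem_centralizer_singleton_iff.1 w.2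
  have h' := Equiv.Perm.congr_fun h (i, ε)
  simp only [neg, Equiv.Perm.mul_apply, Equiv.prodCongr_apply] at h'
  exact h'

theorem mem_closure {n : ℕ} (w : W n) : w ∈ Submonoid.closure (Set.range (s (n := n))) := by
  classical
  induction hN : (Finset.univ.filter fun i => (w.1 (i, 1)).2 ≠ 1).card
    using Nat.strong_induction_on generalizing w with
  | _ N ih =>
    by_cases h : ∀ i, (w.1 (i, 1)).2 = 1
    · have key : ∀ i ε, w.1 (i, ε) = ((w.1 (i, 1)).1, ε) := by
        intro i ε
        obtain rfl | rfl := Int.units_eq_one_or ε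
        · exact Prod.ext rfl (h i)
        · rw [W.map_neg, h i]
      have inj : Function.Injective fun i => (w.1 (i, 1)).1 := by
        intro i j hij
        have : w.1 (i, 1) = w.1 (j, 1) := Prod.ext hij ((h i).trans (h j).symm)
        exact congrArg Prod.fst (w.1.injective this)
      have : w = ofPerm n (Equiv.ofBijective _ (Finite.injective_iff_bijective.1 inj)) := by
        apply Subtype.ext
        ext ⟨i, ε⟩ : 1
        rw [key]
        simp [ofPerm]
      rw [this]
      exact ofPerm_mem_closure _
    · push Not at h
      obtain ⟨i, hi⟩ := h
      have hs : signChange i * signChange i = 1 := by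
        apply Subtype.ext
        simp [signChange]
      have hw : w = w * signChange i * signChange i := by rw [mul_assoc, hs, mul_one]
      rw [hw]
      refine mul_mem (ih _ ?_ (w * signChange i) rfl) (signChange_mem_closure i)
      rw [← hN]
      apply Finset.card_lt_card
      rw [Finset.ssubset_iff_of_subset]
      · refine ⟨i, by simpa using hi, ?_⟩
        have : (w.1 (i, 1)).2 = -1 := (Int.units_eq_one_or _).resolve_left hi
        have e : (w * signChange i).1 (i, 1) = w.1 (i, -1) := by simp [signChange]
        simp only [Finset.mem_filter, Finset.mem_univ, true_and, not_not]
        rw [e, W.map_neg, this, neg_neg]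
      · intro j
        simp only [Finset.mem_filter, Finset.mem_univ, true_and]
        by_cases hj : j = i
        · exact fun _ => hj ▸ hi
        · have e : (w * signChange i).1 (j, 1) = w.1 (j, 1) := by
            simp [signChange, Equiv.swap_apply_def, hj]
          rw [e]
          exact id

theorem exists_isReducedWord {n : ℕ} (w : W n) : ∃ a, IsReducedWord a w := by
  classical
  have hw : ∃ r, ∃ a : List (Fin n), a.length = r ∧ (a.map s).prod = w := by
    obtain ⟨l, hl, hw⟩ := Submonoid.exists_list_of_mem_closure (mem_closure w)
    obtain ⟨a, rfl⟩ : l ∈ Set.range (List.map (s (n := n))) := by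
      rw [Set.range_list_map]
      exact hl
    exact ⟨_, a, rfl, hw⟩
  obtain ⟨a, ha, haw⟩ := Nat.find_spec hw
  exact ⟨a, haw, fun b hb => ha ▸ Nat.find_min' hw ⟨b, rfl, hb⟩⟩

/-- A reduced decomposition of `w`. -/
noncomputable def reducedWord {n : ℕ} (w : W n) : List (Fin n) :=
  Classical.choose (exists_isReducedWord w)

/-! ### Divided differences on `ℤ[X, Y] = ℤ[Y][X]` -/

open MvPolynomial

/-- The ring `ℤ[X, Y]` with `X = (x_1, …, x_n)` and `Y = (y_1, …, y_n)`. -/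
abbrev R (n : ℕ) : Type := MvPolynomial (Fin n ⊕ Fin n) ℤ

/-- The variable `x_{i+1}`. -/
noncomputable abbrev x {n : ℕ} (i : Fin n) : R n := X (Sum.inl i)

/-- The variable `y_{j+1}`. -/
noncomputable abbrev y {n : ℕ} (j : Fin n) : R n := X (Sum.inr j)

/-- The action of the generators on `ℤ[X, Y]`: `s_0` replaces `x_1` by `-x_1`, and for `k ≥ 1`
`s_k` interchanges `x_k` and `x_{k+1}`; all other variables are fixed. -/
noncomputable def act {n : ℕ} (k : Fin n) : R n →ₐ[ℤ] R n :=
  aeval (Sum.elim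
    (fun i => if k.val = 0 then (if i = k then -x i else x i) else x (Equiv.swap (pred k) k i))
    y)

/-- The denominators of the divided differences: `2 x_1` for `k = 0` and `x_k - x_{k+1}` for
`k ≥ 1`. -/
noncomputable def root {n : ℕ} (k : Fin n) : R n :=
  if k.val = 0 then 2 * x k else x (pred k) - x k

theorem root_dvd {n : ℕ} (k : Fin n) (f : R n) : root k ∣ f - act k f := by
  induction f using MvPolynomial.induction_on with
  | C c => simp [act]
  | add p q hp hq =>
    rw [map_add, add_sub_add_comm]
    exact dvd_add hp hq
  | mul_X p v hp =>
    have hv : root k ∣ X v - act k (X v) := by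
      rcases v with i | j
      · by_cases hk : k.val = 0
        · by_cases hi : i = k
          · simp [act, root, hk, hi, two_mul]
          · simp [act, root, hk, hi]
        · simp only [act, root, hk, aeval_X, Sum.elim_inl, if_false, Equiv.swap_apply_def]
          split_ifs with h1 h2
          · rw [h1]
          · rw [h2, dvd_sub_comm]
          · simp
      · simp [act]
    have e : p * X v - act k (p * X v) =
        p * (X v - act k (X v)) + act k (X v) * (p - act k p) := by
      rw [map_mul]; ring
    rw [e]
    exact dvd_add (dvd_mul_of_dvd_right hv _) (dvd_mul_of_dvd_right hp _)

/-- The divided difference operator: the unique polynomial `∂_k f` with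
`f - s_k f = (denominator) * ∂_k f`. -/
noncomputable def divDiff {n : ℕ} (k : Fin n) (f : R n) : R n :=
  Classical.choose (root_dvd k f)

/-- The signed operators `∂'_0 = ∂_0` and `∂'_k = -∂_k` for `k ≥ 1`. -/
noncomputable def divDiff' {n : ℕ} (k : Fin n) (f : R n) : R n :=
  if k.val = 0 then divDiff k f else -divDiff k f

/-- `∂_w = ∂_{a₁} ∘ ⋯ ∘ ∂_{aᵣ}` for a reduced decomposition `w = s_{a₁} ⋯ s_{aᵣ}`. -/
noncomputable def divDiffW {n : ℕ} (w : W n) (f : R n) : R n :=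
  (reducedWord w).foldr divDiff f

/-- `∂'_w = ∂'_{a₁} ∘ ⋯ ∘ ∂'_{aᵣ}` for a reduced decomposition `w = s_{a₁} ⋯ s_{aᵣ}`. -/
noncomputable def divDiffW' {n : ℕ} (w : W n) (f : R n) : R n :=
  (reducedWord w).foldr divDiff' f

/-! ### Double Schubert polynomials of type A -/

/-- `Δ(X, Y) = ∏_{i + j ≤ n} (x_i - y_j)`. -/
noncomputable def Δ (n : ℕ) : R n :=
  ∏ p : Fin n × Fin n with (p.1.val + 1) + (p.2.val + 1) ≤ n, (x p.1 - y p.2)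

/-- The Lascoux–Schützenberger double Schubert polynomial `𝔖_ϖ(X, Y) = ∂_{ϖ⁻¹ϖ₀} Δ(X, Y)`. -/
noncomputable def schubertA {n : ℕ} (ϖ : Equiv.Perm (Fin n)) : R n :=
  divDiffW (ofPerm n (ϖ⁻¹ * ϖ₀ n)) (Δ n)

/-! ### `Q̃`-polynomials and double Schubert polynomials of type C -/

/-- The Pfaffian of the skew-symmetric array whose entry in row `i` and column `j`, for `i < j`, is
`A l_i l_j` (for a list `l`), by expansion along the first row:
`Pf = ∑_{j ≥ 2} (-1)^j A l_1 l_j Pf(rows and columns 1, j deleted)`. -/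
def pfaffian {S ι : Type*} [CommRing S] (A : ι → ι → S) : List ι → S
  | [] => 1
  | i :: l => ∑ j : Fin l.length, (-1) ^ j.val * A i (l.get j) * pfaffian A (l.eraseIdx j.val)
termination_by l => l.length
decreasing_by
  have := List.length_eraseIdx_le l j.val
  simp only [List.length_cons]
  omega

/-- `Q̃_{i,j}(X) = Q̃_i Q̃_j + 2 ∑_{k=1}^{j} (-1)^k Q̃_{i+k} Q̃_{j-k}`, where `Q̃_i = e_i(X)`. -/
noncomputable def Qpair (n i j : ℕ) : MvPolynomial (Fin n) ℤ :=
  esymm (Fin n) ℤ i * esymm (Fin n) ℤ j +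
    2 * ∑ k ∈ Finset.Icc 1 j,
      (-1) ^ k * esymm (Fin n) ℤ (i + k) * esymm (Fin n) ℤ (j - k)

/-- `Q̃_l(X) = Pfaffian [Q̃_{l_i,l_j}(X)]_{i<j}` for the partition with the weakly decreasing list
`l` of parts, which is first extended by a zero part if its length is odd. -/
noncomputable def Qlist (n : ℕ) (l : List ℕ) : MvPolynomial (Fin n) ℤ :=
  pfaffian (Qpair n) (if Even l.length then l else l ++ [0])

/-- `Q̃_λ(X)` for the strict partition `λ` whose set of parts is `t`. -/
noncomputable def Qtilde (n : ℕ) (t : Finset ℕ) : MvPolynomial (Fin n) ℤ :=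
  Qlist n (t.sort (· ≥ ·))

/-- The kernel `Q̃(X, Y) = ∑_λ Q̃_λ(X) Q̃_{λ'}(Y)`. The sum is over the strict partitions with parts
in `{1, …, n}`, given by their sets `t` of parts; the parts of `λ'` are the complement of `t`. -/
noncomputable def Qkernel (n : ℕ) : R n :=
  ∑ t ∈ (Finset.Icc 1 n).powerset,
    rename Sum.inl (Qtilde n t) * rename Sum.inr (Qtilde n (Finset.Icc 1 n \ t))

/-- The type C double Schubert polynomial
`ℭ_w(X, Y) = (-1)^{n(n-1)/2} ∂'_{w⁻¹w₀} (Δ(X, Y) Q̃(X, Y))`. -/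
noncomputable def schubertC {n : ℕ} (w : W n) : R n :=
  (-1) ^ (n * (n - 1) / 2) * divDiffW' (w⁻¹ * w₀ n) (Δ n * Qkernel n)

/-- The substitution `f(X, Y) ↦ f(ϖ₀ X, -Y)`: `x_i` becomes `x_{n+1-i}`, `y_j` becomes `-y_j`. -/
noncomputable def revNeg (n : ℕ) : R n →ₐ[ℤ] R n :=
  aeval (Sum.elim (fun i => x (ϖ₀ n i)) (fun j => -y j))

end TypeC

/-!
The identity of the two polynomials is reduced to the case `ϖ = ϖ₀`, and this case to the
computation of one operator on one polynomial.

*Reduction.* The divided differences satisfy the braid relations of `W_n`, so that `∂_w` may be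
computed from any reduced word (`divDiffW_eq`, by Matsumoto's argument `IsBraided.foldr_eq`).
The lengths add in `ϖ⁻¹ w₀ = (ϖ⁻¹ ϖ₀) (ϖ₀ w₀)`, and the substitution `X ↦ ϖ₀ X`, `Y ↦ -Y`
intertwines `∂'_k` with `∂_{n-k}` (`divDiff'_revNeg`). Hence everything follows from
`∂_{ϖ₀ w₀} (Δ(X, Y) Q̃(X, Y)) = Δ(ϖ₀ X, -Y)` (`schubertC_ofPerm_of_longest`).

*The case of `ϖ₀`.* The operator `F = ∂_{ϖ₀ w₀} ∘ Δ(X, Y)` is linear over the `W_n`-invariants and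
kills the polynomials of degree less than `n` in each `x_i` (`topOp_eq_zero`). Let `V_d` be the
span, over the invariants, of the polynomials of degree at most `d` in each `x_i`, so that `F` kills
`V_{n-1}`.
* `F` is computed on `∏_{i, j} (x_i + y_j)` by following the divided differences step by step
  (`foldr_barWord_deltaProd`).
* The coefficients of `∏ (1 + x_i t) (1 - x_i t)` are invariant. Hence a product of elementary
  symmetric polynomials with a repeated factor drops, under suitable assumptions on the other
  factors, to a lower step of the filtration (`prod_low_mul_mem`, `prod_high_mul_mem`).
* Replacing the factors `∏_i (x_i + y_j)` one after the other, one finds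
  `F(e_1 ⋯ e_n) = Δ(ϖ₀ X, -Y)` (`topOp_mixed`, `topOp_prod_elem`). Each step determines a polynomial
  in an auxiliary variable from its degree and its roots.
* For `λ ≠ (n, …, 1)` the polynomial `Q̃_λ(X)` has degree less than `n` in each `x_i` and is
  killed. For `λ = (n, …, 1)` the Pfaffian `Q̃_λ(X)` agrees with `e_1 ⋯ e_n` modulo `V_{n-1}`
  (`pfaffian_mul_prod_sub_mem`).

*Positivity.* The polynomials `𝔖_ϖ(X, Y)` are the coefficients of the Fomin–Stanley product
`∏_i ∏_{j ≤ n - i} (1 + (x_i - y_j) u_{i+j-1})`, with `i` decreasing, in the nilCoxeter algebra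
(`schubertA_eq_stanleyFun`): by the Yang–Baxter equation the divided differences act on the product
as multiplication by the generators (`divDiff_stanleyFun`), and its top coefficient is `Δ(X, Y)`
(`stanleyFun_longest`). So `𝔖_ϖ(X, Y)` is a sum of products of factors `x_i - y_j`, and these become
`x_{n+1-i} + y_j` under the substitution.
-/


namespace TypeC
open MvPolynomial

/-! ### Divided differences -/

theorem root_mul_divDiff {n : ℕ} (k : Fin n) (f : R n) : root k * divDiff k f = f - act k f :=
  (Classical.choose_spec (root_dvd k f)).symm

@[simp] theorem act_y {n : ℕ} (k j : Fin n) : act k (y j) = y j := by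
  simp [act]

theorem act_x_of_pos {n : ℕ} {k : Fin n} (hk : k.val ≠ 0) (i : Fin n) :
    act k (x i) = x (Equiv.swap (pred k) k i) := by
  simp [act, hk]

theorem act_x_self_of_zero {n : ℕ} {k : Fin n} (hk : k.val = 0) : act k (x k) = -x k := by
  simp [act, hk]

theorem act_x_of_zero_of_ne {n : ℕ} {k i : Fin n} (hk : k.val = 0) (hi : i ≠ k) :
    act k (x i) = x i := by
  simp [act, hk, hi]

theorem pred_ne {n : ℕ} {k : Fin n} (hk : k.val ≠ 0) : pred k ≠ k := by
  intro h
  have := congrArg Fin.val h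
  simp only [pred] at this
  omega

theorem root_ne_zero {n : ℕ} (k : Fin n) : root k ≠ 0 := by
  unfold root
  split_ifs with hk
  · exact mul_ne_zero two_ne_zero (X_ne_zero _)
  · rw [sub_ne_zero]
    intro h
    exact pred_ne hk (Sum.inl_injective (X_injective h))

theorem divDiff_eq_of_root_mul {n : ℕ} {k : Fin n} {f g : R n} (h : root k * g = f - act k f) :
    divDiff k f = g :=
  mul_left_cancel₀ (root_ne_zero k) ((root_mul_divDiff k f).trans h.symm)

theorem divDiff_add {n : ℕ} (k : Fin n) (f g : R n) :
    divDiff k (f + g) = divDiff k f + divDiff k g := by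
  apply divDiff_eq_of_root_mul
  rw [mul_add, root_mul_divDiff, root_mul_divDiff, map_add]
  ring

theorem divDiff_mul_of_act_eq {n : ℕ} {k : Fin n} {a : R n} (ha : act k a = a) (f : R n) :
    divDiff k (a * f) = a * divDiff k f := by
  apply divDiff_eq_of_root_mul
  rw [mul_left_comm, root_mul_divDiff, map_mul, ha]
  ring

theorem divDiff_neg {n : ℕ} (k : Fin n) (f : R n) : divDiff k (-f) = -divDiff k f := by
  have := divDiff_mul_of_act_eq (k := k) (a := -1) (by simp) f
  simpa using this

theorem divDiff_zero {n : ℕ} (k : Fin n) : divDiff k (0 : R n) = 0 :=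
  divDiff_eq_of_root_mul (by simp)

theorem act_act {n : ℕ} (k : Fin n) (f : R n) : act k (act k f) = f := by
  have : (act k).comp (act k) = AlgHom.id ℤ (R n) := by
    ext v : 1
    rcases v with i | j
    · by_cases hk : k.val = 0
      · by_cases hi : i = k
        · subst hi
          simp [act_x_self_of_zero hk]
        · simp [act_x_of_zero_of_ne hk hi]
      · simp [act_x_of_pos hk]
    · simp
  exact DFunLike.congr_fun this f

/-- Two generators that commute on the variables and fix each other's root give commuting
divided differences. -/
theorem divDiff_comm {n : ℕ} {i j : Fin n} (hij : i.val + 2 ≤ j.val) (f : R n) :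
    divDiff i (divDiff j f) = divDiff j (divDiff i f) := by
  have hj : j.val ≠ 0 := by omega
  have hpj : (pred j).val = j.val - 1 := rfl
  have hrj : act i (root j) = root j := by
    simp only [root, hj, if_false, map_sub]
    by_cases hi : i.val = 0
    · rw [act_x_of_zero_of_ne hi (by rw [Ne, Fin.ext_iff]; omega),
        act_x_of_zero_of_ne hi (by rw [Ne, Fin.ext_iff]; omega)]
    · have hpi : (pred i).val = i.val - 1 := rfl
      rw [act_x_of_pos hi, act_x_of_pos hi,
        Equiv.swap_apply_of_ne_of_ne (by rw [Ne, Fin.ext_iff]; omega)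
          (by rw [Ne, Fin.ext_iff]; omega),
        Equiv.swap_apply_of_ne_of_ne (by rw [Ne, Fin.ext_iff]; omega)
          (by rw [Ne, Fin.ext_iff]; omega)]
  have hri : act j (root i) = root i := by
    by_cases hi : i.val = 0
    · simp only [root, hi, if_true, map_mul, map_ofNat]
      rw [act_x_of_pos hj, Equiv.swap_apply_of_ne_of_ne (by rw [Ne, Fin.ext_iff]; omega)
          (by rw [Ne, Fin.ext_iff]; omega)]
    · have hpi : (pred i).val = i.val - 1 := rfl
      simp only [root, hi, if_false, map_sub]
      rw [act_x_of_pos hj, act_x_of_pos hj,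
        Equiv.swap_apply_of_ne_of_ne (by rw [Ne, Fin.ext_iff]; omega)
          (by rw [Ne, Fin.ext_iff]; omega),
        Equiv.swap_apply_of_ne_of_ne (by rw [Ne, Fin.ext_iff]; omega)
          (by rw [Ne, Fin.ext_iff]; omega)]
  have hact : ∀ g : R n, act i (act j g) = act j (act i g) := by
    intro g
    have : (act i).comp (act j) = (act j).comp (act i) := by
      ext v : 1
      rcases v with l | l
      · by_cases hi : i.val = 0
        · by_cases hl : l = i
          · subst hl
            simp only [AlgHom.comp_apply, act_x_self_of_zero hi, act_x_of_pos hj, map_neg]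
            rw [Equiv.swap_apply_of_ne_of_ne (by rw [Ne, Fin.ext_iff]; omega)
              (by rw [Ne, Fin.ext_iff]; omega), act_x_self_of_zero hi]
          · have : Equiv.swap (pred j) j l ≠ i := by
              rw [Equiv.swap_apply_def]
              split_ifs <;> (rw [Ne, Fin.ext_iff]; omega)
            simp only [AlgHom.comp_apply, act_x_of_zero_of_ne hi hl, act_x_of_pos hj,
              act_x_of_zero_of_ne hi this]
        · have hpi : (pred i).val = i.val - 1 := rfl
          simp only [AlgHom.comp_apply, act_x_of_pos hi, act_x_of_pos hj]
          refine congrArg x ?_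
          simp only [Equiv.swap_apply_def]
          split_ifs <;> first | rfl | (simp only [Fin.ext_iff] at *; omega)
      · simp
    exact DFunLike.congr_fun this g
  have h1 := root_mul_divDiff j f
  have h2 := root_mul_divDiff i f
  have h3 := root_mul_divDiff i (divDiff j f)
  have h4 := congrArg (act i) h1
  rw [map_mul, hrj, map_sub] at h4
  symm
  apply divDiff_eq_of_root_mul
  apply mul_left_cancel₀ (root_ne_zero i)
  have h5 := congrArg (act j) h2
  rw [map_mul, hri, map_sub, ← hact] at h5
  linear_combination root j * h3 + h1 - h4 - h2 + h5

/-- The braid relation of length three. It follows from the expansion of `∂_i ∂_j ∂_i f`, multiplied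
by the product of the three roots, into the alternating sum of the six images of `f`. -/
theorem divDiff_braid_three {n : ℕ} {i j : Fin n} (hi : i.val ≠ 0) (hij : j.val = i.val + 1)
    (f : R n) :
    divDiff i (divDiff j (divDiff i f)) = divDiff j (divDiff i (divDiff j f)) := by
  have hj : j.val ≠ 0 := by omega
  have hpi : (pred i).val = i.val - 1 := rfl
  have hpj : pred j = i := by ext; simp [pred, hij]
  have hne1 : pred i ≠ j := by rw [Ne, Fin.ext_iff]; omega
  have hne2 : j ≠ i := by rw [Ne, Fin.ext_iff]; omega
  have hact : ∀ g : R n, act i (act j (act i g)) = act j (act i (act j g)) := by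
    intro g
    have : (act i).comp ((act j).comp (act i)) = (act j).comp ((act i).comp (act j)) := by
      ext v : 1
      rcases v with l | l
      · simp only [AlgHom.comp_apply, act_x_of_pos hi, act_x_of_pos hj]
        refine congrArg x ?_
        by_cases h1 : l = pred i
        · subst h1
          simp [hpj, Equiv.swap_apply_of_ne_of_ne (pred_ne hi) hne1,
            Equiv.swap_apply_of_ne_of_ne hne1.symm hne2]
        · by_cases h2 : l = i
          · subst h2
            simp [hpj, Equiv.swap_apply_of_ne_of_ne (pred_ne hi) hne1,
              Equiv.swap_apply_of_ne_of_ne hne1.symm hne2]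
          · by_cases h3 : l = j
            · subst h3
              simp [hpj, Equiv.swap_apply_of_ne_of_ne hne1.symm hne2,
                Equiv.swap_apply_of_ne_of_ne (pred_ne hi) hne1]
            · simp [hpj, Equiv.swap_apply_of_ne_of_ne h1 h2, Equiv.swap_apply_of_ne_of_ne h2 h3]
      · simp
    exact DFunLike.congr_fun this g
  have hii : act i (root i) = -root i := by
    simp only [root, hi, if_false, map_sub, act_x_of_pos hi]
    simp
  have hjj : act j (root j) = -root j := by
    simp only [root, hj, if_false, map_sub, act_x_of_pos hj]
    simp
  have hij' : act i (root j) = root i + root j := by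
    simp only [root, hi, hj, if_false, map_sub, act_x_of_pos hi, hpj, Equiv.swap_apply_right,
      Equiv.swap_apply_of_ne_of_ne hne1.symm hne2]
    ring
  have hji' : act j (root i) = root i + root j := by
    simp only [root, hi, hj, if_false, map_sub, act_x_of_pos hj, hpj, Equiv.swap_apply_left,
      Equiv.swap_apply_of_ne_of_ne (pred_ne hi) hne1]
    ring
  have hsum : root i + root j ≠ 0 := by
    rw [← hij', Ne, map_eq_zero_iff (act i) (Function.LeftInverse.injective (act_act i))]
    exact root_ne_zero j
  -- the general expansion, used for both orders of the two generators
  have key : ∀ a b : Fin n, act a (root a) = -root a → act b (root b) = -root b →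
      act a (root b) = root a + root b → act b (root a) = root a + root b →
      root a * root b * (root a + root b) * divDiff a (divDiff b (divDiff a f)) =
        f - act a f - act b f + act b (act a f) + act a (act b f) - act a (act b (act a f)) := by
    intro a b haa hbb hab hba
    have h1 := root_mul_divDiff a f
    have h2 := root_mul_divDiff b (divDiff a f)
    have h3 := root_mul_divDiff a (divDiff b (divDiff a f))
    have h1b := congrArg (act b) h1
    simp only [map_mul, map_sub, hba] at h1b
    have h2' : root a * (root a + root b) * root b * divDiff b (divDiff a f) =
        (root a + root b) * (f - act a f) - root a * (act b f - act b (act a f)) := by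
      linear_combination root a * (root a + root b) * h2 + (root a + root b) * h1 - root a * h1b
    have h2a := congrArg (act a) h2'
    simp only [map_mul, map_sub, map_add, haa, hab, act_act] at h2a
    apply mul_left_cancel₀ (root_ne_zero a)
    linear_combination root a * root b * (root a + root b) * h3 + h2' + h2a
  apply mul_left_cancel₀ (mul_ne_zero (mul_ne_zero (root_ne_zero i) (root_ne_zero j)) hsum)
  rw [key i j hii hjj hij' hji']
  have := key j i hjj hii (by rw [hji', add_comm]) (by rw [hij', add_comm])
  rw [hact]
  linear_combination -this

/-- The braid relation of length four between `∂_0` and `∂_1`. -/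
theorem divDiff_braid_four {n : ℕ} {i j : Fin n} (hi : i.val = 0) (hj1 : j.val = 1) (f : R n) :
    divDiff i (divDiff j (divDiff i (divDiff j f))) =
      divDiff j (divDiff i (divDiff j (divDiff i f))) := by
  have hj : j.val ≠ 0 := by omega
  have hpj : pred j = i := by ext; simp [pred, hj1, hi]
  have hne : j ≠ i := by rw [Ne, Fin.ext_iff]; omega
  have sii : act i (x i) = -x i := act_x_self_of_zero hi
  have sij : act i (x j) = x j := act_x_of_zero_of_ne hi hne
  have tji : act j (x i) = x j := by rw [act_x_of_pos hj, hpj, Equiv.swap_apply_left]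
  have tjj : act j (x j) = x i := by rw [act_x_of_pos hj, hpj, Equiv.swap_apply_right]
  have hact : ∀ g : R n, act i (act j (act i (act j g))) = act j (act i (act j (act i g))) := by
    intro g
    have : (act i).comp ((act j).comp ((act i).comp (act j))) =
        (act j).comp ((act i).comp ((act j).comp (act i))) := by
      ext v : 1
      rcases v with l | l
      · simp only [AlgHom.comp_apply]
        by_cases hli : l = i
        · subst hli
          simp only [map_neg, sii, sij, tji, tjj]
        · by_cases hlj : l = j
          · subst hlj
            simp only [map_neg, sii, sij, tji, tjj]
          · have e1 : act i (x l) = x l := act_x_of_zero_of_ne hi hli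
            have e2 : act j (x l) = x l := by
              rw [act_x_of_pos hj, hpj, Equiv.swap_apply_of_ne_of_ne hli hlj]
            simp only [e1, e2]
      · simp
    exact DFunLike.congr_fun this g
  have ri : (root i : R n) = 2 * x i := by simp [root, hi]
  have rj : (root j : R n) = x i - x j := by simp [root, hj, hpj]
  have hi0 : (x i : R n) ≠ 0 := X_ne_zero _
  have hj0 : (x j : R n) ≠ 0 := X_ne_zero _
  have hji0 : (x i - x j : R n) ≠ 0 := rj ▸ root_ne_zero j
  have hs0 : (x i + x j : R n) ≠ 0 := by
    intro h
    apply hji0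
    have := congrArg (act i) h
    simp only [map_add, sii, sij, map_zero] at this
    linear_combination -this
  have D : ∀ g : R n, 2 * x i * divDiff i g = g - act i g := fun g => by
    rw [← ri]; exact root_mul_divDiff i g
  have E : ∀ g : R n, (x i - x j) * divDiff j g = g - act j g := fun g => by
    rw [← rj]; exact root_mul_divDiff j g
  have left : 4 * (x i * x j * (x i - x j) * (x i + x j)) *
      divDiff i (divDiff j (divDiff i (divDiff j f))) =
      -f + act j f + act i f - act i (act j f) - act j (act i f) + act j (act i (act j f))
        + act i (act j (act i f)) - act i (act j (act i (act j f))) := by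
    have h1 := E f
    have h1i := congrArg (act i) h1
    simp only [map_mul, map_sub, sii, sij] at h1i
    have h2 := D (divDiff j f)
    have h2' : 2 * x i * (x i - x j) * (x i + x j) * divDiff i (divDiff j f) =
        (x i + x j) * (f - act j f) + (x i - x j) * (act i f - act i (act j f)) := by
      linear_combination (x i - x j) * (x i + x j) * h2 + (x i + x j) * h1 + (x i - x j) * h1i
    have h2j := congrArg (act j) h2'
    simp only [map_mul, map_sub, map_add, tji, tjj, act_act, map_ofNat] at h2j
    have h3 := E (divDiff i (divDiff j f))
    have h3' : 2 * (x i * x j * (x i - x j) * (x i + x j)) * divDiff j (divDiff i (divDiff j f)) =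
        -(x i + x j) * (f - act j f) + x j * (act i f - act i (act j f))
          - x i * (act j (act i f) - act j (act i (act j f))) := by
      apply mul_left_cancel₀ hji0
      linear_combination 2 * (x i * x j * (x i - x j) * (x i + x j)) * h3 + x j * h2' + x i * h2j
    have h3i := congrArg (act i) h3'
    simp only [map_mul, map_sub, map_add, map_neg, sii, sij, act_act, map_ofNat] at h3i
    have h4 := D (divDiff j (divDiff i (divDiff j f)))
    apply mul_left_cancel₀ hi0
    linear_combination 2 * (x i * x j * (x i - x j) * (x i + x j)) * h4 + h3' + h3i
  have right : 4 * (x i * x j * (x i - x j) * (x i + x j)) *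
      divDiff j (divDiff i (divDiff j (divDiff i f))) =
      -f + act j f + act i f - act i (act j f) - act j (act i f) + act j (act i (act j f))
        + act i (act j (act i f)) - act j (act i (act j (act i f))) := by
    have h1 := D f
    have h1j := congrArg (act j) h1
    simp only [map_mul, map_sub, tji, map_ofNat] at h1j
    have h2 := E (divDiff i f)
    have h2' : 2 * x i * x j * (x i - x j) * divDiff j (divDiff i f) =
        x j * (f - act i f) - x i * (act j f - act j (act i f)) := by
      linear_combination 2 * x i * x j * h2 + x j * h1 - x i * h1j
    have h2i := congrArg (act i) h2'
    simp only [map_mul, map_sub, sii, sij, act_act, map_ofNat] at h2i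
    have h3 := D (divDiff j (divDiff i f))
    have h3' : 4 * (x i * x j * (x i - x j) * (x i + x j)) * divDiff i (divDiff j (divDiff i f)) =
        2 * x j * (f - act i f) - (x i + x j) * (act j f - act j (act i f))
          - (x i - x j) * (act i (act j f) - act i (act j (act i f))) := by
      apply mul_left_cancel₀ hi0
      linear_combination 2 * (x i * x j * (x i - x j) * (x i + x j)) * h3 + (x i + x j) * h2'
        - (x i - x j) * h2i
    have h3j := congrArg (act j) h3'
    simp only [map_mul, map_sub, map_add, tji, tjj, act_act, map_ofNat] at h3j
    have h4 := E (divDiff i (divDiff j (divDiff i f)))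
    apply mul_left_cancel₀ hji0
    linear_combination 4 * (x i * x j * (x i - x j) * (x i + x j)) * h4 + h3' + h3j
  have h4 : (4 : R n) ≠ 0 := by norm_num
  apply mul_left_cancel₀ (mul_ne_zero h4 (mul_ne_zero (mul_ne_zero (mul_ne_zero hi0 hj0) hji0) hs0))
  rw [left, right, hact]

/-! ### Length and reduced words in the hyperoctahedral group -/

/-- The `i`-th entry `w(i)` of the one-line notation of `w`, as a nonzero integer. -/
def entry {n : ℕ} (w : W n) (i : Fin n) : ℤ :=
  ((w.1 (i, 1)).2 : ℤ) * (((w.1 (i, 1)).1.val : ℤ) + 1)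

theorem units_mul_inj {a b : ℤˣ} {m k : ℕ} (h : (a : ℤ) * ((m : ℤ) + 1) = b * ((k : ℤ) + 1)) :
    a = b ∧ m = k := by
  obtain rfl | rfl := Int.units_eq_one_or a <;> obtain rfl | rfl := Int.units_eq_one_or b <;>
    simp only [Units.val_one, Units.val_neg, one_mul, neg_mul] at h <;>
    first | exact ⟨rfl, by omega⟩ | omega

theorem entry_injective {n : ℕ} : Function.Injective (entry (n := n)) := by
  intro v w h
  have h1 : ∀ i, v.1 (i, 1) = w.1 (i, 1) := by
    intro i
    obtain ⟨h2, h3⟩ := units_mul_inj (congrFun h i)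
    exact Prod.ext (Fin.ext h3) h2
  apply Subtype.ext
  ext ⟨i, ε⟩ : 1
  obtain rfl | rfl := Int.units_eq_one_or ε
  · exact h1 i
  · rw [W.map_neg, W.map_neg, h1]

theorem entry_inj {n : ℕ} (w : W n) {i j : Fin n} : entry w i = entry w j ↔ i = j := by
  refine ⟨fun h => ?_, fun h => h ▸ rfl⟩
  obtain ⟨h2, h3⟩ := units_mul_inj h
  exact (Prod.ext_iff.1 (w.1.injective (Prod.ext (Fin.ext h3) h2))).1

theorem entry_ne_zero {n : ℕ} (w : W n) (i : Fin n) : entry w i ≠ 0 := by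
  unfold entry
  exact mul_ne_zero (Units.ne_zero _) (by omega)

theorem entry_mul_ofPerm {n : ℕ} (w : W n) (σ : Equiv.Perm (Fin n)) (i : Fin n) :
    entry (w * ofPerm n σ) i = entry w (σ i) := rfl

theorem entry_mul_s_of_pos {n : ℕ} {k : Fin n} (hk : k.val ≠ 0) (w : W n) (i : Fin n) :
    entry (w * s k) i = entry w (Equiv.swap (pred k) k i) := by
  rw [s, if_neg hk, entry_mul_ofPerm]

theorem entry_mul_s_self_of_zero {n : ℕ} {k : Fin n} (hk : k.val = 0) (w : W n) :
    entry (w * s k) k = -entry w k := by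
  have : (w * s k).1 (k, 1) = w.1 (k, -1) := by simp [s, hk, signChange]
  rw [entry, entry, this, W.map_neg]
  simp

theorem entry_mul_s_of_zero_of_ne {n : ℕ} {k i : Fin n} (hk : k.val = 0) (hi : i ≠ k) (w : W n) :
    entry (w * s k) i = entry w i := by
  have : (w * s k).1 (i, 1) = w.1 (i, 1) := by
    simp [s, hk, signChange, Equiv.swap_apply_def, hi]
  rw [entry, entry, this]

theorem s_mul_s {n : ℕ} (k : Fin n) : s k * s k = 1 := by
  apply Subtype.ext
  by_cases hk : k.val = 0
  · simp [s, hk, signChange]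
  · simp only [s, hk, if_false]
    rw [← map_mul, Equiv.swap_mul_self, map_one]

theorem s_inv {n : ℕ} (k : Fin n) : (s k)⁻¹ = s k :=
  inv_eq_of_mul_eq_one_left (s_mul_s k)

theorem s_mul_cancel {n : ℕ} (k : Fin n) (w : W n) : s k * (s k * w) = w := by
  rw [← mul_assoc, s_mul_s, one_mul]

theorem s_comm {n : ℕ} {i j : Fin n} (hij : i.val + 2 ≤ j.val) : s i * s j = s j * s i := by
  apply entry_injective
  funext l
  have hj : j.val ≠ 0 := by omega
  have hpj : (pred j).val = j.val - 1 := rfl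
  rw [← one_mul (s i), ← one_mul (s j), ← mul_assoc, ← mul_assoc, mul_one, mul_one,
    entry_mul_s_of_pos hj]
  by_cases hi : i.val = 0
  · by_cases hl : l = i
    · subst hl
      rw [entry_mul_s_self_of_zero hi, entry_mul_s_of_pos hj,
        Equiv.swap_apply_of_ne_of_ne (by rw [Ne, Fin.ext_iff]; omega)
          (by rw [Ne, Fin.ext_iff]; omega), entry_mul_s_self_of_zero hi]
    · have : Equiv.swap (pred j) j l ≠ i := by
        rw [Equiv.swap_apply_def]
        split_ifs <;> (rw [Ne, Fin.ext_iff]; omega)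
      rw [entry_mul_s_of_zero_of_ne hi hl, entry_mul_s_of_zero_of_ne hi this,
        entry_mul_s_of_pos hj]
  · have hpi : (pred i).val = i.val - 1 := rfl
    rw [entry_mul_s_of_pos hi, entry_mul_s_of_pos hi, entry_mul_s_of_pos hj]
    refine congrArg (entry 1) ?_
    simp only [Equiv.swap_apply_def]
    split_ifs <;> first | rfl | (simp only [Fin.ext_iff] at *; omega)

theorem s_braid_three {n : ℕ} {i j : Fin n} (hi : i.val ≠ 0) (hij : j.val = i.val + 1) :
    s i * s j * s i = s j * s i * s j := by
  have hj : j.val ≠ 0 := by omega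
  have hpj : pred j = i := by ext; simp [pred, hij]
  have hne1 : pred i ≠ j := by rw [Ne, Fin.ext_iff]; simp only [pred]; omega
  have hne2 : j ≠ i := by rw [Ne, Fin.ext_iff]; omega
  simp only [s, hi, hj, if_false, ← map_mul]
  congr 1
  rw [hpj]
  have h1 := Equiv.swap_mul_swap_mul_swap (x := pred i) (y := i) (z := j) (pred_ne hi) hne1
  have h2 := Equiv.swap_mul_swap_mul_swap (x := j) (y := i) (z := pred i) hne2 hne1.symm
  rw [Equiv.swap_comm i j, Equiv.swap_comm (pred i) i]
  rw [Equiv.swap_comm j i, Equiv.swap_comm i (pred i), Equiv.swap_comm j] at *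
  first | exact h1.trans h2.symm | exact h2.trans h1.symm

theorem s_braid_four {n : ℕ} {i j : Fin n} (hi : i.val = 0) (hj1 : j.val = 1) :
    s i * s j * s i * s j = s j * s i * s j * s i := by
  have hj : j.val ≠ 0 := by omega
  have hpj : pred j = i := by ext; simp [pred, hj1, hi]
  have hne : j ≠ i := by rw [Ne, Fin.ext_iff]; omega
  have t1 : ∀ w : W n, entry (w * s j) i = entry w j := fun w => by
    rw [entry_mul_s_of_pos hj, hpj, Equiv.swap_apply_left]
  have t2 : ∀ w : W n, entry (w * s j) j = entry w i := fun w => by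
    rw [entry_mul_s_of_pos hj, hpj, Equiv.swap_apply_right]
  have t3 := fun w : W n => entry_mul_s_self_of_zero hi w
  have t4 := fun w : W n => entry_mul_s_of_zero_of_ne hi hne w
  apply entry_injective
  funext l
  rw [← one_mul (s i), ← mul_one (s j), ← one_mul (s j * 1)]
  simp only [← mul_assoc, mul_one]
  by_cases hli : l = i
  · subst hli
    simp only [t1, t2, t3, t4]
  · by_cases hlj : l = j
    · subst hlj
      simp only [t1, t2, t3, t4]
    · have t5 : ∀ w : W n, entry (w * s j) l = entry w l := fun w => by
        rw [entry_mul_s_of_pos hj, hpj, Equiv.swap_apply_of_ne_of_ne hli hlj]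
      have t6 := fun w : W n => entry_mul_s_of_zero_of_ne hi hli w
      simp only [t5, t6]

/-- The number of negative entries, of inversions, and of pairs with negative sum, of a sequence of
integers. For the one-line notation of a signed permutation it is the Coxeter length. -/
def inversions {n : ℕ} (p : Fin n → ℤ) : ℕ :=
  ∑ i, (if p i < 0 then 1 else 0) + ∑ q : Fin n × Fin n with q.1 < q.2,
    ((if p q.2 < p q.1 then 1 else 0) + (if p q.1 + p q.2 < 0 then 1 else 0))

theorem inversions_negate {n : ℕ} {k : Fin n} (hk : k.val = 0) {p p' : Fin n → ℤ}
    (h0 : p' k = -p k) (h : ∀ i ≠ k, p' i = p i) (hneg : p k < 0) :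
    inversions p' + 1 = inversions p := by
  unfold inversions
  have h1 : ∑ i, (if p' i < 0 then 1 else 0) + 1 = ∑ i, (if p i < 0 then 1 else 0) := by
    rw [← Finset.add_sum_erase _ _ (Finset.mem_univ k),
      ← Finset.add_sum_erase (a := k) _ (fun i => if p i < 0 then 1 else 0) (Finset.mem_univ k)]
    rw [Finset.sum_congr rfl fun i hi => by rw [h i (Finset.ne_of_mem_erase hi)]]
    rw [h0, if_neg (by omega), if_pos hneg]
    omega
  have h2 : ∑ q : Fin n × Fin n with q.1 < q.2,
      ((if p' q.2 < p' q.1 then 1 else 0) + (if p' q.1 + p' q.2 < 0 then 1 else 0)) =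
      ∑ q : Fin n × Fin n with q.1 < q.2,
      ((if p q.2 < p q.1 then 1 else 0) + (if p q.1 + p q.2 < 0 then 1 else 0)) := by
    refine Finset.sum_congr rfl fun q hq => ?_
    have hq' : q.1 < q.2 := by simpa using hq
    have hq2 : q.2 ≠ k := by rw [Ne, Fin.ext_iff]; have := Fin.lt_def.1 hq'; omega
    rw [h _ hq2]
    by_cases hq1 : q.1 = k
    · rw [hq1, h0]
      split_ifs <;> omega
    · rw [h _ hq1]
  omega

theorem inversions_swap {n : ℕ} {k : Fin n} (hk : k.val ≠ 0) {p p' : Fin n → ℤ}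
    (h : ∀ i, p' i = p (Equiv.swap (pred k) k i)) (hlt : p k < p (pred k)) :
    inversions p' + 1 = inversions p := by
  unfold inversions
  have hpk : (pred k).val = k.val - 1 := rfl
  have h1 : ∑ i, (if p' i < 0 then 1 else 0) = ∑ i, (if p i < 0 then 1 else 0) := by
    simp only [h]
    exact Equiv.sum_comp (Equiv.swap (pred k) k) fun i => if p i < 0 then 1 else 0
  have hmem : (pred k, k) ∈ Finset.univ.filter fun q : Fin n × Fin n => q.1 < q.2 := by
    simp only [Finset.mem_filter, Finset.mem_univ, true_and, Fin.lt_def]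
    omega
  have h2 : ∑ q ∈ (Finset.univ.filter fun q : Fin n × Fin n => q.1 < q.2).erase (pred k, k),
      ((if p' q.2 < p' q.1 then 1 else 0) + (if p' q.1 + p' q.2 < 0 then 1 else 0)) =
      ∑ q ∈ (Finset.univ.filter fun q : Fin n × Fin n => q.1 < q.2).erase (pred k, k),
      ((if p q.2 < p q.1 then 1 else 0) + (if p q.1 + p q.2 < 0 then 1 else 0)) := by
    have hmaps : ∀ q : Fin n × Fin n, q.1 < q.2 → q ≠ (pred k, k) →
        Equiv.swap (pred k) k q.1 < Equiv.swap (pred k) k q.2 ∧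
        (Equiv.swap (pred k) k q.1, Equiv.swap (pred k) k q.2) ≠ (pred k, k) := by
      rintro ⟨a, b⟩ hab hne
      simp only [Ne, Prod.mk.injEq, Fin.ext_iff, Fin.lt_def, Equiv.swap_apply_def] at *
      split_ifs <;> omega
    refine Finset.sum_nbij' (fun q => (Equiv.swap (pred k) k q.1, Equiv.swap (pred k) k q.2))
      (fun q => (Equiv.swap (pred k) k q.1, Equiv.swap (pred k) k q.2)) ?_ ?_ ?_ ?_ ?_
    · intro q hq
      simp only [Finset.mem_erase, Finset.mem_filter, Finset.mem_univ, true_and] at hq ⊢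
      exact (hmaps q hq.2 hq.1).symm
    · intro q hq
      simp only [Finset.mem_erase, Finset.mem_filter, Finset.mem_univ, true_and] at hq ⊢
      exact (hmaps q hq.2 hq.1).symm
    · intro q _
      simp
    · intro q _
      simp
    · intro q _
      simp only [h]
  rw [h1, ← Finset.add_sum_erase _ _ hmem, h2, ← Finset.add_sum_erase _ (fun q : Fin n × Fin n =>
    (if p q.2 < p q.1 then 1 else 0) + (if p q.1 + p q.2 < 0 then 1 else 0)) hmem]
  simp only [h, Equiv.swap_apply_left, Equiv.swap_apply_right]
  rw [if_neg (by omega : ¬ p (pred k) < p k), if_pos hlt, add_comm (p k)]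
  omega

/-- The Coxeter length of `w`, computed on the one-line notation of `w⁻¹`. -/
def len {n : ℕ} (w : W n) : ℕ := inversions (entry w⁻¹)

/-- `s_k` is a left descent of `w`. -/
def IsDescent {n : ℕ} (k : Fin n) (w : W n) : Prop :=
  if k.val = 0 then entry w⁻¹ k < 0 else entry w⁻¹ k < entry w⁻¹ (pred k)

theorem s_mul_inv {n : ℕ} (k : Fin n) (w : W n) : (s k * w)⁻¹ = w⁻¹ * s k := by
  rw [mul_inv_rev, s_inv]

theorem len_s_mul_of_isDescent {n : ℕ} {k : Fin n} {w : W n} (h : IsDescent k w) :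
    len (s k * w) + 1 = len w := by
  unfold IsDescent at h
  unfold len
  rw [s_mul_inv]
  split_ifs at h with hk
  · exact inversions_negate hk (entry_mul_s_self_of_zero hk _)
      (fun i hi => entry_mul_s_of_zero_of_ne hk hi _) h
  · exact inversions_swap hk (entry_mul_s_of_pos hk _) h

theorem isDescent_s_mul {n : ℕ} {k : Fin n} {w : W n} : IsDescent k (s k * w) ↔ ¬IsDescent k w := by
  unfold IsDescent
  rw [s_mul_inv]
  by_cases hk : k.val = 0
  · rw [if_pos hk, if_pos hk, entry_mul_s_self_of_zero hk]
    have := entry_ne_zero w⁻¹ k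
    omega
  · rw [if_neg hk, if_neg hk, entry_mul_s_of_pos hk, entry_mul_s_of_pos hk,
      Equiv.swap_apply_right, Equiv.swap_apply_left]
    have := (entry_inj w⁻¹).not.2 (pred_ne hk)
    omega

theorem len_s_mul_of_not_isDescent {n : ℕ} {k : Fin n} {w : W n} (h : ¬IsDescent k w) :
    len (s k * w) = len w + 1 := by
  have := len_s_mul_of_isDescent (isDescent_s_mul.2 h)
  rw [s_mul_cancel] at this
  exact this.symm

theorem isDescent_iff_len {n : ℕ} {k : Fin n} {w : W n} :
    IsDescent k w ↔ len (s k * w) + 1 = len w := by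
  refine ⟨len_s_mul_of_isDescent, fun h => ?_⟩
  by_contra hd
  have := len_s_mul_of_not_isDescent hd
  omega

theorem len_le_length {n : ℕ} (a : List (Fin n)) : len (a.map s).prod ≤ a.length := by
  induction a with
  | nil =>
    have h : ∀ i : Fin n, entry (1 : W n) i = i.val + 1 := fun i => by simp [entry]
    simp only [List.map_nil, List.prod_nil, List.length_nil, nonpos_iff_eq_zero, len, inv_one,
      inversions, h]
    rw [Finset.sum_eq_zero fun i _ => if_neg (by omega), zero_add]
    refine Finset.sum_eq_zero fun q hq => ?_
    have : q.1.val < q.2.val := by simpa using hq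
    rw [if_neg (by omega), if_neg (by omega), add_zero]
  | cons k a ih =>
    rw [List.map_cons, List.prod_cons, List.length_cons]
    by_cases h : IsDescent k (a.map s).prod
    · have := len_s_mul_of_isDescent h
      omega
    · have := len_s_mul_of_not_isDescent h
      omega

theorem len_one {n : ℕ} : len (1 : W n) = 0 := by
  simpa using len_le_length ([] : List (Fin n))

theorem eq_one_of_forall_not_isDescent {n : ℕ} {w : W n} (h : ∀ k, ¬IsDescent k w) : w = 1 := by
  have hlt : ∀ k : Fin n, k.val ≠ 0 → entry w⁻¹ (pred k) < entry w⁻¹ k := by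
    intro k hk
    have h1 := h k
    rw [IsDescent, if_neg hk] at h1
    have := (entry_inj w⁻¹).not.2 (pred_ne hk)
    omega
  -- an increasing sequence with a positive first entry satisfies `i + 1 ≤ w⁻¹(i)`
  have hge : ∀ m : ℕ, ∀ k : Fin n, k.val = m → (m : ℤ) + 1 ≤ entry w⁻¹ k := by
    intro m
    induction m with
    | zero =>
      intro k hk
      have h1 := h k
      rw [IsDescent, if_pos hk] at h1
      have := entry_ne_zero w⁻¹ k
      push_cast
      omega
    | succ m ih =>
      intro k hk
      have h1 := ih (pred k) (by simp only [pred]; omega)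
      have h2 := hlt k (by omega)
      push_cast
      omega
  have habs : ∀ k, entry w⁻¹ k = ((w⁻¹).1 (k, 1)).1.val + 1 := by
    intro k
    have h1 := hge _ k rfl
    unfold entry at h1 ⊢
    obtain h2 | h2 := Int.units_eq_one_or ((w⁻¹).1 (k, 1)).2
    · rw [h2]; simp
    · rw [h2] at h1
      simp only [Units.val_neg, Units.val_one] at h1
      omega
  have hle : ∀ m : ℕ, ∀ k : Fin n, k.val + m + 1 = n → entry w⁻¹ k ≤ k.val + 1 := by
    intro m
    induction m with
    | zero =>
      intro k hk
      have := ((w⁻¹).1 (k, 1)).1.isLt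
      rw [habs]
      omega
    | succ m ih =>
      intro k hk
      have h1 := ih ⟨k.val + 1, by omega⟩ (by simp only; omega)
      have h2 := hlt ⟨k.val + 1, by omega⟩ (by simp)
      have h3 : pred ⟨k.val + 1, by omega⟩ = k := by ext; simp [pred]
      rw [h3] at h2
      push_cast at h1
      omega
  have : w⁻¹ = 1 := by
    apply entry_injective
    funext k
    have h1 := hge _ k rfl
    have h2 := hle (n - 1 - k.val) k (by omega)
    have h3 : entry (1 : W n) k = k.val + 1 := by simp [entry]
    omega
  simpa using this

theorem exists_word_length_eq_len {n : ℕ} (w : W n) :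
    ∃ a : List (Fin n), (a.map s).prod = w ∧ a.length = len w := by
  induction hN : len w generalizing w with
  | zero =>
    refine ⟨[], ?_, rfl⟩
    symm
    apply eq_one_of_forall_not_isDescent
    intro k hk
    have := len_s_mul_of_isDescent hk
    omega
  | succ N ih =>
    by_cases h : ∃ k, IsDescent k w
    · obtain ⟨k, hk⟩ := h
      have h1 := len_s_mul_of_isDescent hk
      obtain ⟨a, ha, hl⟩ := ih (s k * w) (by omega)
      exact ⟨k :: a, by rw [List.map_cons, List.prod_cons, ha, s_mul_cancel], by simp [hl]⟩
    · push Not at h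
      rw [eq_one_of_forall_not_isDescent h, len_one] at hN
      omega

theorem isReducedWord_iff {n : ℕ} {a : List (Fin n)} {w : W n} :
    IsReducedWord a w ↔ (a.map s).prod = w ∧ a.length = len w := by
  constructor
  · rintro ⟨h1, h2⟩
    obtain ⟨b, hb, hl⟩ := exists_word_length_eq_len w
    have := h2 b hb
    have := len_le_length a
    rw [h1] at this
    exact ⟨h1, by omega⟩
  · rintro ⟨h1, h2⟩
    refine ⟨h1, fun b hb => ?_⟩
    rw [h2, ← hb]
    exact len_le_length b

/-- Operators indexed by the generators that satisfy the braid relations of type `C`. -/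
structure IsBraided {n : ℕ} {M : Type*} (D : Fin n → M → M) : Prop where
  comm : ∀ i j : Fin n, i.val + 2 ≤ j.val → ∀ f, D i (D j f) = D j (D i f)
  three : ∀ i j : Fin n, i.val ≠ 0 → j.val = i.val + 1 → ∀ f,
    D i (D j (D i f)) = D j (D i (D j f))
  four : ∀ i j : Fin n, i.val = 0 → j.val = 1 → ∀ f,
    D i (D j (D i (D j f))) = D j (D i (D j (D i f)))

/-- If `s_i` and `s_j` are descents of `w`, then the longest element of the dihedral group that they
generate is a prefix of `w`. -/
theorem IsBraided.exists_prefix_of_lt {n : ℕ} {M : Type*} {D : Fin n → M → M} (hD : IsBraided D)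
    {i j : Fin n} (hij : i < j) {w : W n} (hi : IsDescent i w) (hj : IsDescent j w) :
    ∃ (p q : List (Fin n)) (v : W n), p.length = q.length ∧
      s i * ((p.map s).prod * v) = w ∧ s j * ((q.map s).prod * v) = w ∧
      len v + p.length + 1 = len w ∧ ∀ f, D i (p.foldr D f) = D j (q.foldr D f) := by
  have hlt := Fin.lt_def.1 hij
  have hj0 : j.val ≠ 0 := by omega
  have hpj : (pred j).val = j.val - 1 := rfl
  have hpi : (pred i).val = i.val - 1 := rfl
  have hj' := hj
  rw [IsDescent, if_neg hj0] at hj'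
  by_cases h2 : i.val + 2 ≤ j.val
  · have h3 : IsDescent j (s i * w) := by
      rw [IsDescent, if_neg hj0, s_mul_inv]
      by_cases hi0 : i.val = 0
      · rwa [entry_mul_s_of_zero_of_ne hi0 (by rw [Ne, Fin.ext_iff]; omega),
          entry_mul_s_of_zero_of_ne hi0 (by rw [Ne, Fin.ext_iff]; omega)]
      · rwa [entry_mul_s_of_pos hi0, entry_mul_s_of_pos hi0,
          Equiv.swap_apply_of_ne_of_ne (by rw [Ne, Fin.ext_iff]; omega)
            (by rw [Ne, Fin.ext_iff]; omega),
          Equiv.swap_apply_of_ne_of_ne (by rw [Ne, Fin.ext_iff]; omega)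
            (by rw [Ne, Fin.ext_iff]; omega)]
    have l1 := len_s_mul_of_isDescent hi
    have l2 := len_s_mul_of_isDescent h3
    have e := s_comm h2
    refine ⟨[j], [i], s j * (s i * w), rfl, ?_, ?_, ?_, fun f => hD.comm i j h2 f⟩
    · simp [s_mul_cancel]
    · simp only [List.map_cons, List.map_nil, List.prod_cons, List.prod_nil, mul_one]
      rw [← mul_assoc, ← e, mul_assoc, s_mul_cancel, s_mul_cancel]
    · simp only [List.length_cons, List.length_nil]
      omega
  · have hji : j.val = i.val + 1 := by omega
    have hpj' : pred j = i := by ext; omega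
    have hne2 : j ≠ i := hij.ne'
    rw [hpj'] at hj'
    by_cases hi0 : i.val = 0
    · have hi' := hi
      rw [IsDescent, if_pos hi0] at hi'
      have t1 : ∀ w : W n, entry (w * s j) i = entry w j := fun w => by
        rw [entry_mul_s_of_pos hj0, hpj', Equiv.swap_apply_left]
      have t2 : ∀ w : W n, entry (w * s j) j = entry w i := fun w => by
        rw [entry_mul_s_of_pos hj0, hpj', Equiv.swap_apply_right]
      have t3 := fun w : W n => entry_mul_s_self_of_zero hi0 w
      have t4 := fun w : W n => entry_mul_s_of_zero_of_ne hi0 hne2 w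
      have h3 : IsDescent j (s i * w) := by
        simp only [IsDescent, if_neg hj0, s_mul_inv, hpj', t3, t4]
        omega
      have h4 : IsDescent i (s j * (s i * w)) := by
        simp only [IsDescent, if_pos hi0, s_mul_inv, t1, t4]
        omega
      have h5 : IsDescent j (s i * (s j * (s i * w))) := by
        simp only [IsDescent, if_neg hj0, s_mul_inv, hpj', t1, t2, t3, t4]
        omega
      have l1 := len_s_mul_of_isDescent hi
      have l2 := len_s_mul_of_isDescent h3
      have l3 := len_s_mul_of_isDescent h4
      have l4 := len_s_mul_of_isDescent h5
      have e := s_braid_four hi0 (by omega : j.val = 1)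
      have e' : ∀ v : W n, s j * (s i * (s j * (s i * v))) = s i * (s j * (s i * (s j * v))) := by
        intro v
        simp only [← mul_assoc]
        rw [e]
      refine ⟨[j, i, j], [i, j, i], s j * (s i * (s j * (s i * w))), rfl, ?_, ?_, ?_,
        fun f => hD.four i j hi0 (by omega) f⟩
      · simp [s_mul_cancel, mul_assoc]
      · simp only [List.map_cons, List.map_nil, List.prod_cons, List.prod_nil, mul_one, mul_assoc]
        rw [e']
        simp [s_mul_cancel]
      · simp only [List.length_cons, List.length_nil]
        omega
    · have hi' := hi
      rw [IsDescent, if_neg hi0] at hi'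
      have hne1 : pred i ≠ j := by rw [Ne, Fin.ext_iff]; omega
      have t1 : ∀ w : W n, entry (w * s j) i = entry w j := fun w => by
        rw [entry_mul_s_of_pos hj0, hpj', Equiv.swap_apply_left]
      have t2 : ∀ w : W n, entry (w * s j) j = entry w i := fun w => by
        rw [entry_mul_s_of_pos hj0, hpj', Equiv.swap_apply_right]
      have t3 : ∀ w : W n, entry (w * s j) (pred i) = entry w (pred i) := fun w => by
        rw [entry_mul_s_of_pos hj0, hpj', Equiv.swap_apply_of_ne_of_ne (pred_ne hi0) hne1]
      have t4 : ∀ w : W n, entry (w * s i) i = entry w (pred i) := fun w => by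
        rw [entry_mul_s_of_pos hi0, Equiv.swap_apply_right]
      have t5 : ∀ w : W n, entry (w * s i) (pred i) = entry w i := fun w => by
        rw [entry_mul_s_of_pos hi0, Equiv.swap_apply_left]
      have t6 : ∀ w : W n, entry (w * s i) j = entry w j := fun w => by
        rw [entry_mul_s_of_pos hi0, Equiv.swap_apply_of_ne_of_ne hne1.symm hne2]
      have h3 : IsDescent j (s i * w) := by
        simp only [IsDescent, if_neg hj0, s_mul_inv, hpj', t4, t6]
        omega
      have h4 : IsDescent i (s j * (s i * w)) := by
        simp only [IsDescent, if_neg hi0, s_mul_inv, t1, t3, t5, t6]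
        omega
      have l1 := len_s_mul_of_isDescent hi
      have l2 := len_s_mul_of_isDescent h3
      have l3 := len_s_mul_of_isDescent h4
      have e := s_braid_three hi0 hji
      have e' : ∀ v : W n, s j * (s i * (s j * v)) = s i * (s j * (s i * v)) := by
        intro v
        simp only [← mul_assoc]
        rw [e]
      refine ⟨[j, i], [i, j], s i * (s j * (s i * w)), rfl, ?_, ?_, ?_,
        fun f => hD.three i j hi0 hji f⟩
      · simp [s_mul_cancel, mul_assoc]
      · simp only [List.map_cons, List.map_nil, List.prod_cons, List.prod_nil, mul_one, mul_assoc]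
        rw [e']
        simp [s_mul_cancel]
      · simp only [List.length_cons, List.length_nil]
        omega

theorem IsBraided.exists_prefix {n : ℕ} {M : Type*} {D : Fin n → M → M} (hD : IsBraided D)
    {i j : Fin n} (hij : i ≠ j) {w : W n} (hi : IsDescent i w) (hj : IsDescent j w) :
    ∃ (p q : List (Fin n)) (v : W n), p.length = q.length ∧
      s i * ((p.map s).prod * v) = w ∧ s j * ((q.map s).prod * v) = w ∧
      len v + p.length + 1 = len w ∧ ∀ f, D i (p.foldr D f) = D j (q.foldr D f) := by
  obtain h | h := lt_or_gt_of_ne hij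
  · exact hD.exists_prefix_of_lt h hi hj
  · obtain ⟨p, q, v, h1, h2, h3, h4, h5⟩ := hD.exists_prefix_of_lt h hj hi
    exact ⟨q, p, v, h1.symm, h3, h2, by omega, fun f => (h5 f).symm⟩

/-- **Matsumoto's theorem** for the hyperoctahedral group: operators that satisfy the braid
relations compose to the same operator along any two reduced words of an element. -/
theorem IsBraided.foldr_eq {n : ℕ} {M : Type*} {D : Fin n → M → M} (hD : IsBraided D)
    {a b : List (Fin n)} (hab : (a.map s).prod = (b.map s).prod)
    (ha : a.length = len (a.map s).prod) (hb : b.length = len (b.map s).prod) (f : M) :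
    a.foldr D f = b.foldr D f := by
  induction hN : a.length generalizing a b with
  | zero =>
    have hb0 : b.length = 0 := by rw [hb, ← hab, ← ha, hN]
    rw [List.eq_nil_of_length_eq_zero hN, List.eq_nil_of_length_eq_zero hb0]
  | succ N ih =>
    have hbN : b.length = N + 1 := by rw [hb, ← hab, ← ha, hN]
    rcases a with _ | ⟨i, a⟩
    · simp at hN
    rcases b with _ | ⟨j, b⟩
    · simp at hbN
    simp only [List.length_cons, List.map_cons, List.prod_cons, List.foldr_cons] at *
    have tail : ∀ (k : Fin n) (c : List (Fin n)), c.length + 1 = len (s k * (c.map s).prod) →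
        c.length = len (c.map s).prod := by
      intro k c hc
      have := len_le_length c
      by_cases h : IsDescent k (c.map s).prod
      · have := len_s_mul_of_isDescent h
        omega
      · have := len_s_mul_of_not_isDescent h
        omega
    have ha' := tail i a ha
    have hb' := tail j b hb
    by_cases hij : i = j
    · subst hij
      rw [ih (mul_left_cancel hab) ha' hb' (by omega)]
    · have hi : IsDescent i (s i * (a.map s).prod) := by
        rw [isDescent_iff_len, s_mul_cancel]; omega
      have hj : IsDescent j (s i * (a.map s).prod) := by
        rw [hab, isDescent_iff_len, s_mul_cancel]; omega
      obtain ⟨p, q, v, h1, h2, h3, h4, h5⟩ := hD.exists_prefix hij hi hj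
      obtain ⟨c, hc, hcl⟩ := exists_word_length_eq_len v
      have e1 : (a.map s).prod = ((p ++ c).map s).prod := by
        rw [List.map_append, List.prod_append, hc]
        exact (mul_left_cancel h2).symm
      have e2 : (b.map s).prod = ((q ++ c).map s).prod := by
        rw [List.map_append, List.prod_append, hc]
        exact (mul_left_cancel (h3.trans hab)).symm
      rw [ih e1 ha' (by rw [← e1, ← ha', List.length_append]; omega) (by omega),
        ih e2 hb' (by rw [← e2, ← hb', List.length_append]; omega) (by omega),
        List.foldr_append, List.foldr_append, h5]

/-! ### Reduced words of `ϖ₀ w₀` and of elements of `S_n` -/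

theorem isBraided_divDiff (n : ℕ) : IsBraided (divDiff (n := n)) where
  comm _ _ := divDiff_comm
  three _ _ := divDiff_braid_three
  four _ _ := divDiff_braid_four

theorem divDiff'_of_zero {n : ℕ} {k : Fin n} (hk : k.val = 0) (f : R n) :
    divDiff' k f = divDiff k f := if_pos hk

theorem divDiff'_of_pos {n : ℕ} {k : Fin n} (hk : k.val ≠ 0) (f : R n) :
    divDiff' k f = -divDiff k f := if_neg hk

theorem isBraided_divDiff' (n : ℕ) : IsBraided (divDiff' (n := n)) where
  comm i j hij f := by
    rw [divDiff'_of_pos (k := j) (by omega), divDiff'_of_pos (k := j) (by omega)]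
    by_cases hi : i.val = 0
    · simp only [divDiff'_of_zero hi, divDiff_neg, divDiff_comm hij]
    · simp only [divDiff'_of_pos hi, divDiff_neg, divDiff_comm hij]
  three i j hi hij f := by
    have hj : j.val ≠ 0 := by omega
    simp only [divDiff'_of_pos hi, divDiff'_of_pos hj, divDiff_neg, divDiff_braid_three hi hij]
  four i j hi hj1 f := by
    have hj : j.val ≠ 0 := by omega
    simp only [divDiff'_of_zero hi, divDiff'_of_pos hj, divDiff_neg, divDiff_braid_four hi hj1]

theorem divDiffW_eq {n : ℕ} {a : List (Fin n)} {w : W n} (h : IsReducedWord a w) (f : R n) :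
    divDiffW w f = a.foldr divDiff f := by
  have h1 := isReducedWord_iff.1 h
  have h2 := isReducedWord_iff.1 (Classical.choose_spec (exists_isReducedWord w))
  exact (isBraided_divDiff n).foldr_eq (h2.1.trans h1.1.symm) (h2.2.trans (by rw [h2.1]))
    (h1.2.trans (by rw [h1.1])) f

theorem divDiffW'_eq {n : ℕ} {a : List (Fin n)} {w : W n} (h : IsReducedWord a w) (f : R n) :
    divDiffW' w f = a.foldr divDiff' f := by
  have h1 := isReducedWord_iff.1 h
  have h2 := isReducedWord_iff.1 (Classical.choose_spec (exists_isReducedWord w))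
  exact (isBraided_divDiff' n).foldr_eq (h2.1.trans h1.1.symm) (h2.2.trans (by rw [h2.1]))
    (h1.2.trans (by rw [h1.1])) f

/-- The word `s_{m-1} ⋯ s_1 s_0`. -/
def rowWord {n : ℕ} : ∀ m : ℕ, m ≤ n → List (Fin n)
  | 0, _ => []
  | m + 1, h => ⟨m, h⟩ :: rowWord m (Nat.le_of_succ_le h)

/-- The word `(s_0) (s_1 s_0) ⋯ (s_{m-1} ⋯ s_0)`, a reduced word of the signed permutation
`(-m, …, -1, m + 1, …, n)`. -/
def barWord {n : ℕ} : ∀ m : ℕ, m ≤ n → List (Fin n)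
  | 0, _ => []
  | m + 1, h => barWord m (Nat.le_of_succ_le h) ++ rowWord (m + 1) h

theorem entry_mul_rowWord {n : ℕ} (m : ℕ) (h : m + 1 ≤ n) (w : W n) (i : Fin n) :
    entry (w * ((rowWord (m + 1) h).map s).prod) i =
      if i.val ≤ m then (if i.val = 0 then -entry w ⟨m, h⟩ else entry w (pred i))
      else entry w i := by
  induction m generalizing w with
  | zero =>
    simp only [rowWord, List.map_cons, List.map_nil, List.prod_cons, List.prod_nil, mul_one]
    by_cases hi : i.val = 0
    · have : i = ⟨0, h⟩ := Fin.ext hi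
      subst this
      rw [entry_mul_s_self_of_zero rfl]
      simp
    · rw [entry_mul_s_of_zero_of_ne rfl (by rw [Ne, Fin.ext_iff]; exact hi), if_neg (by omega)]
  | succ m ih =>
    rw [rowWord, List.map_cons, List.prod_cons, ← mul_assoc, ih (by omega)]
    have hs : ∀ j, entry (w * s ⟨m + 1, h⟩) j =
        entry w (Equiv.swap ⟨m, by omega⟩ ⟨m + 1, h⟩ j) := fun j => by
      rw [entry_mul_s_of_pos (by simp)]
      rfl
    simp only [hs]
    by_cases hi : i.val = 0
    · rw [if_pos (by omega), if_pos hi, if_pos (by omega), if_pos hi, Equiv.swap_apply_left]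
    · by_cases him : i.val ≤ m
      · rw [if_pos him, if_neg hi, if_pos (by omega), if_neg hi, Equiv.swap_apply_of_ne_of_ne] <;>
        · rw [Ne, Fin.ext_iff]
          simp only [pred]
          omega
      · rw [if_neg him]
        by_cases him1 : i.val ≤ m + 1
        · have : i = ⟨m + 1, h⟩ := by ext; simp only; omega
          subst this
          rw [if_pos (by simp), if_neg (by simp), Equiv.swap_apply_right]
          rfl
        · rw [if_neg him1, Equiv.swap_apply_of_ne_of_ne] <;>
          · rw [Ne, Fin.ext_iff]
            simp only
            omega

theorem entry_barWord {n : ℕ} (m : ℕ) (h : m ≤ n) (i : Fin n) :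
    entry ((barWord m h).map s).prod i =
      if i.val < m then (i.val : ℤ) - m else i.val + 1 := by
  induction m generalizing i with
  | zero => simp [barWord, entry]
  | succ m ih =>
    rw [barWord, List.map_append, List.prod_append, entry_mul_rowWord]
    simp only [ih]
    have : (pred i).val = i.val - 1 := rfl
    split_ifs <;> push_cast <;> omega

theorem barWord_prod (n : ℕ) : ((barWord n le_rfl).map s).prod = ofPerm n (ϖ₀ n) * w₀ n := by
  apply entry_injective
  funext i
  rw [entry_barWord, if_pos i.isLt]
  have e : (ofPerm n (ϖ₀ n) * w₀ n).1 (i, 1) = (Fin.rev i, -1) := rfl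
  rw [entry, e]
  have := i.isLt
  simp only [Fin.val_rev, Units.val_neg, Units.val_one]
  omega

theorem length_rowWord {n : ℕ} (m : ℕ) (h : m ≤ n) : (rowWord m h).length = m := by
  induction m with
  | zero => rfl
  | succ m ih => rw [rowWord, List.length_cons, ih]

theorem length_barWord {n : ℕ} (m : ℕ) (h : m ≤ n) :
    (barWord m h).length = ∑ i ∈ Finset.range m, (i + 1) := by
  induction m with
  | zero => rfl
  | succ m ih => rw [barWord, List.length_append, ih, length_rowWord, Finset.sum_range_succ]

theorem barWord_prod_inv (n : ℕ) :
    (((barWord n le_rfl).map s).prod : W n)⁻¹ = ((barWord n le_rfl).map s).prod := by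
  rw [barWord_prod, mul_inv_rev, ← map_inv]
  have h1 : (ϖ₀ n)⁻¹ = ϖ₀ n := by ext; simp [Equiv.Perm.inv_def]
  have h2 : (w₀ n)⁻¹ = w₀ n := by
    rw [inv_eq_iff_mul_eq_one]
    exact Subtype.ext (Equiv.ext fun z => Prod.ext rfl (neg_neg z.2))
  rw [h1, h2]
  rfl

theorem len_barWord (n : ℕ) :
    len ((barWord n le_rfl).map s).prod = (barWord (n := n) n le_rfl).length := by
  rw [len, barWord_prod_inv, length_barWord, inversions]
  simp only [entry_barWord, Fin.is_lt, if_true]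
  have h1 : ∑ i : Fin n, (if (i.val : ℤ) - n < 0 then 1 else 0) = n := by
    rw [Finset.sum_congr rfl (g := fun _ => 1) fun i _ => if_pos (by have := i.isLt; omega)]
    simp
  have h2 : ∑ q : Fin n × Fin n with q.1 < q.2,
      ((if (q.2.val : ℤ) - n < (q.1.val : ℤ) - n then 1 else 0) +
        (if (q.1.val : ℤ) - n + ((q.2.val : ℤ) - n) < 0 then 1 else 0)) =
      ∑ i ∈ Finset.range n, i := by
    have h3 : ∀ q ∈ Finset.univ.filter (fun q : Fin n × Fin n => q.1 < q.2),
        ((if (q.2.val : ℤ) - n < (q.1.val : ℤ) - n then 1 else 0) +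
        (if (q.1.val : ℤ) - n + ((q.2.val : ℤ) - n) < 0 then 1 else 0)) = 1 := by
      intro q hq
      have : q.1.val < q.2.val := by simpa using hq
      rw [if_neg (by omega), if_pos (by omega)]
    rw [Finset.sum_congr rfl h3, Finset.sum_filter, Fintype.sum_prod_type_right,
      ← Fin.sum_univ_eq_sum_range fun i => i]
    refine Finset.sum_congr rfl fun b _ => ?_
    rw [← Fin.card_Iio b, Finset.card_eq_sum_ones, ← Finset.sum_filter]
    refine Finset.sum_congr ?_ fun _ _ => rfl
    ext a
    simp
  rw [h1, h2, Finset.sum_add_distrib, add_comm]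
  simp

theorem exists_pos_word {n : ℕ} (σ : Equiv.Perm (Fin n)) :
    ∃ b : List (Fin n), (b.map s).prod = ofPerm n σ ∧ b.length = len (ofPerm n σ) ∧
      ∀ k ∈ b, k.val ≠ 0 := by
  induction hN : len (ofPerm n σ) generalizing σ with
  | zero =>
    refine ⟨[], ?_, rfl, by simp⟩
    symm
    apply eq_one_of_forall_not_isDescent
    intro k hk
    have := len_s_mul_of_isDescent hk
    omega
  | succ N ih =>
    by_cases h : ∃ k, IsDescent k (ofPerm n σ)
    · obtain ⟨k, hk⟩ := h
      have hk0 : k.val ≠ 0 := by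
        intro hk0
        rw [IsDescent, if_pos hk0, ← map_inv] at hk
        simp only [entry, ofPerm, MonoidHom.coe_mk, OneHom.coe_mk, Equiv.prodCongr_apply,
          Prod.map_apply, Equiv.refl_apply, Units.val_one] at hk
        omega
      have h1 := len_s_mul_of_isDescent hk
      have h2 : s k * ofPerm n σ = ofPerm n (Equiv.swap (pred k) k * σ) := by
        rw [s, if_neg hk0, map_mul]
      obtain ⟨a, ha, hl, hpos⟩ := ih (Equiv.swap (pred k) k * σ) (by rw [← h2]; omega)
      refine ⟨k :: a, ?_, by simp [hl], ?_⟩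
      · rw [List.map_cons, List.prod_cons, ha, ← h2, s_mul_cancel]
      · intro l hl'
        rcases List.mem_cons.1 hl' with rfl | hl'
        · exact hk0
        · exact hpos l hl'
    · push Not at h
      rw [eq_one_of_forall_not_isDescent h, len_one] at hN
      omega

theorem exists_perm_of_pos {n : ℕ} {b : List (Fin n)} (hb : ∀ k ∈ b, k.val ≠ 0) :
    ∃ σ : Equiv.Perm (Fin n), (b.map s).prod = ofPerm n σ := by
  induction b with
  | nil => exact ⟨1, by simp⟩
  | cons k b ih =>
    obtain ⟨σ, hσ⟩ := ih fun l hl => hb l (List.mem_cons_of_mem _ hl)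
    refine ⟨Equiv.swap (pred k) k * σ, ?_⟩
    rw [List.map_cons, List.prod_cons, hσ, s, if_neg (hb k List.mem_cons_self), map_mul]

/-- Lengths add in the product of an element of `S_n` with `ϖ₀ w₀`, because `ϖ₀ w₀` is
increasing. -/
theorem length_append_barWord {n : ℕ} {b : List (Fin n)} (hb : ∀ k ∈ b, k.val ≠ 0)
    (hlen : b.length = len (b.map s).prod) :
    (b ++ barWord n le_rfl).length = len ((b ++ barWord n le_rfl).map s).prod := by
  induction b with
  | nil => exact (len_barWord n).symm
  | cons k b ih =>
    have hk := hb k List.mem_cons_self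
    have hb' : ∀ l ∈ b, l.val ≠ 0 := fun l hl => hb l (List.mem_cons_of_mem _ hl)
    rw [List.map_cons, List.prod_cons, List.length_cons] at hlen
    have hle := len_le_length b
    have hnd : ¬IsDescent k (b.map s).prod := by
      intro h
      have := len_s_mul_of_isDescent h
      omega
    have h1 := len_s_mul_of_not_isDescent hnd
    have h2 := ih hb' (by omega)
    obtain ⟨σ, hσ⟩ := exists_perm_of_pos hb'
    have hnd' : ¬IsDescent k ((b ++ barWord n le_rfl).map s).prod := by
      rw [hσ] at hnd
      rw [List.map_append, List.prod_append, hσ]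
      simp only [IsDescent, if_neg hk, mul_inv_rev, barWord_prod_inv, ← map_inv,
        entry_mul_ofPerm, entry_barWord, Fin.is_lt, if_true] at hnd ⊢
      simp only [entry, ofPerm, MonoidHom.coe_mk, OneHom.coe_mk, Equiv.prodCongr_apply,
        Prod.map_apply, Equiv.refl_apply, Units.val_one] at hnd
      omega
    rw [List.cons_append, List.map_cons, List.prod_cons, len_s_mul_of_not_isDescent hnd',
      List.length_cons, h2]

/-! ### Signs and the substitution `(X, Y) ↦ (ϖ₀ X, -Y)` -/

theorem foldr_divDiff_mul {n : ℕ} {a : R n} (ha : ∀ k, act k a = a) (b : List (Fin n)) (f : R n) :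
    b.foldr divDiff (a * f) = a * b.foldr divDiff f := by
  induction b with
  | nil => rfl
  | cons k b ih => rw [List.foldr_cons, ih, divDiff_mul_of_act_eq (ha k), List.foldr_cons]

theorem foldr_divDiff_add {n : ℕ} (b : List (Fin n)) (f g : R n) :
    b.foldr divDiff (f + g) = b.foldr divDiff f + b.foldr divDiff g := by
  induction b with
  | nil => rfl
  | cons k b ih => rw [List.foldr_cons, ih, divDiff_add, List.foldr_cons, List.foldr_cons]

theorem act_neg_one_pow {n : ℕ} (k : Fin n) (m : ℕ) : act k ((-1 : R n) ^ m) = (-1) ^ m := by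
  simp

theorem foldr_divDiff'_rowWord {n : ℕ} (m : ℕ) (h : m + 1 ≤ n) (f : R n) :
    (rowWord (m + 1) h).foldr divDiff' f = (-1) ^ m * (rowWord (m + 1) h).foldr divDiff f := by
  induction m with
  | zero => simp [rowWord, divDiff']
  | succ m ih =>
    rw [rowWord, List.foldr_cons, ih (by omega), divDiff'_of_pos (by simp),
      divDiff_mul_of_act_eq (act_neg_one_pow _ _), List.foldr_cons]
    ring

theorem foldr_divDiff'_barWord {n : ℕ} (m : ℕ) (h : m ≤ n) (f : R n) :
    (barWord m h).foldr divDiff' f =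
      (-1) ^ (m * (m - 1) / 2) * (barWord m h).foldr divDiff f := by
  induction m generalizing f with
  | zero => simp [barWord]
  | succ m ih =>
    rw [barWord, List.foldr_append, ih, foldr_divDiff'_rowWord, List.foldr_append,
      foldr_divDiff_mul (fun k => act_neg_one_pow k _), ← mul_assoc, ← pow_add,
      ← Finset.sum_range_id, ← Finset.sum_range_id, Finset.sum_range_succ]

/-- The index `n - k` for `1 ≤ k ≤ n - 1`: conjugation by `ϖ₀` sends `s_k` to `s_{n-k}`. -/
def mirror {n : ℕ} (k : Fin n) : Fin n := Fin.rev (pred k)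

theorem val_mirror {n : ℕ} {k : Fin n} (hk : k.val ≠ 0) : (mirror k).val = n - k.val := by
  simp only [mirror, pred, Fin.val_rev]
  omega

theorem mirror_ne_zero {n : ℕ} {k : Fin n} (hk : k.val ≠ 0) : (mirror k).val ≠ 0 := by
  rw [val_mirror hk]
  omega

theorem pred_mirror {n : ℕ} {k : Fin n} (hk : k.val ≠ 0) : pred (mirror k) = Fin.rev k := by
  ext
  simp only [pred, val_mirror hk, Fin.val_rev]
  omega

@[simp] theorem revNeg_x {n : ℕ} (i : Fin n) : revNeg n (x i) = x (Fin.rev i) := by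
  simp [revNeg]

@[simp] theorem revNeg_y {n : ℕ} (j : Fin n) : revNeg n (y j) = -y j := by
  simp [revNeg]

theorem act_revNeg {n : ℕ} {k : Fin n} (hk : k.val ≠ 0) (f : R n) :
    act k (revNeg n f) = revNeg n (act (mirror k) f) := by
  have : (act k).comp (revNeg n) = (revNeg n).comp (act (mirror k)) := by
    ext v : 1
    rcases v with i | j
    · simp only [AlgHom.comp_apply, revNeg_x, act_x_of_pos hk, act_x_of_pos (mirror_ne_zero hk),
        pred_mirror hk]
      refine congrArg x ?_
      rw [mirror, Equiv.swap_comm (Fin.rev k)]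
      have := Equiv.swap_apply_apply (Fin.revPerm (n := n)) (pred k) k
      simp only [Fin.revPerm_apply] at this
      rw [this]
      simp [Equiv.Perm.mul_apply, Equiv.Perm.inv_def]
    · simp
  exact DFunLike.congr_fun this f

theorem revNeg_root {n : ℕ} {k : Fin n} (hk : k.val ≠ 0) :
    revNeg n (root (mirror k)) = -root k := by
  rw [root, root, if_neg hk, if_neg (mirror_ne_zero hk), map_sub, revNeg_x, revNeg_x,
    pred_mirror hk, mirror, Fin.rev_rev, Fin.rev_rev]
  ring

theorem divDiff'_revNeg {n : ℕ} {k : Fin n} (hk : k.val ≠ 0) (f : R n) :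
    divDiff' k (revNeg n f) = revNeg n (divDiff (mirror k) f) := by
  rw [divDiff'_of_pos hk, ← divDiff_neg]
  apply divDiff_eq_of_root_mul
  have h := congrArg (revNeg n) (root_mul_divDiff (mirror k) f)
  rw [map_mul, revNeg_root hk, map_sub, ← act_revNeg hk] at h
  rw [map_neg]
  linear_combination -h

theorem foldr_divDiff'_revNeg {n : ℕ} {b : List (Fin n)} (hb : ∀ k ∈ b, k.val ≠ 0) (f : R n) :
    b.foldr divDiff' (revNeg n f) = revNeg n ((b.map mirror).foldr divDiff f) := by
  induction b with
  | nil => rfl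
  | cons k b ih =>
    rw [List.foldr_cons, ih fun l hl => hb l (List.mem_cons_of_mem _ hl),
      divDiff'_revNeg (hb k List.mem_cons_self), List.map_cons, List.foldr_cons]

theorem prod_map_mirror {n : ℕ} {b : List (Fin n)} (hb : ∀ k ∈ b, k.val ≠ 0)
    {σ : Equiv.Perm (Fin n)} (hσ : (b.map s).prod = ofPerm n σ) :
    ((b.map mirror).map s).prod = ofPerm n (ϖ₀ n * σ * ϖ₀ n) := by
  have hinv : (ofPerm n (ϖ₀ n) : W n) * ofPerm n (ϖ₀ n) = 1 := by
    rw [← map_mul]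
    have : ϖ₀ n * ϖ₀ n = 1 := by ext; simp
    rw [this, map_one]
  rw [map_mul, map_mul, ← hσ]
  clear hσ
  induction b with
  | nil => simp [hinv]
  | cons k b ih =>
    have hk := hb k List.mem_cons_self
    rw [List.map_cons, List.map_cons, List.prod_cons,
      ih fun l hl => hb l (List.mem_cons_of_mem _ hl),
      List.map_cons, List.prod_cons]
    have : (s (mirror k) : W n) = ofPerm n (ϖ₀ n) * s k * ofPerm n (ϖ₀ n) := by
      rw [s, s, if_neg hk, if_neg (mirror_ne_zero hk), ← map_mul, ← map_mul, pred_mirror hk, mirror,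
        Equiv.swap_comm]
      congr 1
      have := Equiv.swap_apply_apply (Fin.revPerm (n := n)) (pred k) k
      simp only [Fin.revPerm_apply] at this
      rw [this]
      rfl
    rw [this]
    simp only [mul_assoc]
    rw [← mul_assoc (ofPerm n (ϖ₀ n)) (ofPerm n (ϖ₀ n)), hinv, one_mul]

theorem len_conj_le {n : ℕ} (σ : Equiv.Perm (Fin n)) :
    len (ofPerm n (ϖ₀ n * σ * ϖ₀ n)) ≤ len (ofPerm n σ) := by
  obtain ⟨b, h1, h2, h3⟩ := exists_pos_word σ
  rw [← prod_map_mirror h3 h1, ← h2]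
  simpa using len_le_length (b.map mirror)

theorem rev_conj_conj {n : ℕ} (σ : Equiv.Perm (Fin n)) :
    ϖ₀ n * (ϖ₀ n * σ * ϖ₀ n) * ϖ₀ n = σ := by
  ext; simp

theorem len_conj {n : ℕ} (σ : Equiv.Perm (Fin n)) :
    len (ofPerm n (ϖ₀ n * σ * ϖ₀ n)) = len (ofPerm n σ) := by
  apply le_antisymm (len_conj_le σ)
  simpa only [rev_conj_conj] using len_conj_le (ϖ₀ n * σ * ϖ₀ n)

/-- The comparison of the two Schubert polynomials, granted the case `ϖ = ϖ₀`. -/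
theorem schubertC_ofPerm_of_longest {n : ℕ}
    (h : (barWord n le_rfl).foldr divDiff (Δ n * Qkernel n) = revNeg n (Δ n))
    (ϖ : Equiv.Perm (Fin n)) :
    schubertC (ofPerm n ϖ) = revNeg n (schubertA (ϖ₀ n * ϖ * ϖ₀ n)) := by
  obtain ⟨b, h1, h2, h3⟩ := exists_pos_word (ϖ⁻¹ * ϖ₀ n)
  have hrev : ϖ₀ n * ϖ₀ n = 1 := by ext; simp
  have hC : IsReducedWord (b ++ barWord n le_rfl) ((ofPerm n ϖ)⁻¹ * w₀ n) := by
    have hp : ((b ++ barWord n le_rfl).map s).prod = (ofPerm n ϖ)⁻¹ * w₀ n := by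
      rw [List.map_append, List.prod_append, h1, barWord_prod, ← mul_assoc, ← map_mul, mul_assoc,
        hrev, mul_one, map_inv]
    rw [isReducedWord_iff]
    exact ⟨hp, by rw [← hp]; exact length_append_barWord h3 (by rw [h1, h2])⟩
  have hA : IsReducedWord (b.map mirror) (ofPerm n ((ϖ₀ n * ϖ * ϖ₀ n)⁻¹ * ϖ₀ n)) := by
    have e : (ϖ₀ n * ϖ * ϖ₀ n)⁻¹ * ϖ₀ n = ϖ₀ n * (ϖ⁻¹ * ϖ₀ n) * ϖ₀ n := by
      have hinv : (ϖ₀ n)⁻¹ = ϖ₀ n := inv_eq_of_mul_eq_one_left hrev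
      rw [mul_inv_rev, mul_inv_rev, hinv, mul_assoc, mul_assoc]
    rw [isReducedWord_iff, e, len_conj, List.length_map]
    exact ⟨prod_map_mirror h3 h1, h2⟩
  rw [schubertC, schubertA, divDiffW'_eq hC, divDiffW_eq hA, List.foldr_append,
    foldr_divDiff'_barWord, h]
  have hlin : ∀ (c : List (Fin n)) (m : ℕ) (f : R n),
      c.foldr divDiff' ((-1) ^ m * f) = (-1) ^ m * c.foldr divDiff' f := by
    intro c m f
    induction c with
    | nil => rfl
    | cons k c ih =>
      rw [List.foldr_cons, ih, List.foldr_cons]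
      by_cases hk : k.val = 0
      · rw [divDiff'_of_zero hk, divDiff'_of_zero hk, divDiff_mul_of_act_eq (act_neg_one_pow _ _)]
      · rw [divDiff'_of_pos hk, divDiff'_of_pos hk, divDiff_mul_of_act_eq (act_neg_one_pow _ _)]
        ring
  rw [hlin, foldr_divDiff'_revNeg h3, ← mul_assoc, ← mul_pow]
  simp

/-! ### Divided differences and degrees -/

theorem degreeOf_aeval_le {σ τ : Type*} [DecidableEq σ] {g : σ → MvPolynomial τ ℤ} {i : τ} {j : σ}
    (h : ∀ v, degreeOf i (g v) ≤ if v = j then 1 else 0) (f : MvPolynomial σ ℤ) :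
    degreeOf i (aeval g f) ≤ degreeOf j f := by
  rw [aeval_def, eval₂_eq]
  refine (degreeOf_sum_le _ _ _).trans (Finset.sup_le fun m hm => ?_)
  refine (degreeOf_mul_le _ _ _).trans ?_
  have h1 : degreeOf i (algebraMap ℤ (MvPolynomial τ ℤ) (coeff m f)) = 0 := by
    rw [MvPolynomial.algebraMap_eq, degreeOf_C]
  rw [h1, zero_add]
  refine (degreeOf_prod_le _ _ _).trans ?_
  calc ∑ v ∈ m.support, degreeOf i (g v ^ m v)
      ≤ ∑ v ∈ m.support, if v = j then m v else 0 := by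
        refine Finset.sum_le_sum fun v _ => (degreeOf_pow_le _ _ _).trans ?_
        have := h v
        split_ifs at this ⊢
        · exact (Nat.mul_le_mul_left _ this).trans (by simp)
        · exact (Nat.mul_le_mul_left _ this).trans (by simp)
    _ ≤ m j := by
        rw [Finset.sum_ite_eq']
        split_ifs <;> simp
    _ ≤ degreeOf j f := monomial_le_degreeOf j hm

theorem degreeOf_act_of_zero {n : ℕ} {k : Fin n} (hk : k.val = 0) (i : Fin n) (f : R n) :
    degreeOf (Sum.inl i) (act k f) ≤ degreeOf (Sum.inl i) f := by
  refine degreeOf_aeval_le (fun v => ?_) f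
  rcases v with l | l
  · simp only [Sum.elim_inl, hk, if_true, Sum.inl.injEq]
    split_ifs <;> simp_all [degreeOf_neg, degreeOf_X, eq_comm]
  · simp [degreeOf_X]

theorem degreeOf_act_of_pos {n : ℕ} {k : Fin n} (hk : k.val ≠ 0) (i : Fin n) (f : R n) :
    degreeOf (Sum.inl i) (act k f) ≤ degreeOf (Sum.inl (Equiv.swap (pred k) k i)) f := by
  refine degreeOf_aeval_le (fun v => ?_) f
  rcases v with l | l
  · simp only [Sum.elim_inl, hk, if_false, Sum.inl.injEq, degreeOf_X]
    split_ifs with h1 h2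
    · exact le_rfl
    · exact absurd (by rw [h1, Equiv.swap_apply_self]) h2
    · exact Nat.zero_le _
    · exact le_rfl
  · simp [degreeOf_X]

theorem degreeOf_divDiff_le {n : ℕ} (k : Fin n) (v : Fin n ⊕ Fin n) (f : R n) :
    divDiff k f = 0 ∨ degreeOf v (root k) + degreeOf v (divDiff k f) ≤
      max (degreeOf v f) (degreeOf v (act k f)) := by
  by_cases h : divDiff k f = 0
  · exact Or.inl h
  · right
    rw [← degreeOf_mul_eq (root_ne_zero k) h, root_mul_divDiff]
    exact degreeOf_sub_le _ _ _

theorem one_le_degreeOf_root_self {n : ℕ} (k : Fin n) :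
    1 ≤ degreeOf (Sum.inl k) (root k) := by
  have h : Finsupp.single (Sum.inl k : Fin n ⊕ Fin n) 1 ∈ (root k : R n).support := by
    rw [mem_support_iff, root]
    split_ifs with hk
    · have : (2 * x k : R n) = C 2 * x k := by simp
      rw [this, coeff_C_mul]
      simp
    · have : pred k ≠ k := pred_ne hk
      simp [coeff_X, Finsupp.single_left_inj, this]
  simpa using monomial_le_degreeOf (Sum.inl k) h

theorem one_le_degreeOf_root_pred {n : ℕ} {k : Fin n} (hk : k.val ≠ 0) :
    1 ≤ degreeOf (Sum.inl (pred k)) (root k) := by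
  have h : Finsupp.single (Sum.inl (pred k) : Fin n ⊕ Fin n) 1 ∈ (root k : R n).support := by
    rw [mem_support_iff, root, if_neg hk]
    have : k ≠ pred k := (pred_ne hk).symm
    simp [coeff_X, Finsupp.single_left_inj, this]
  simpa using monomial_le_degreeOf (Sum.inl (pred k)) h

/-- How the operators `∂_0, …, ∂_k` change degrees in the single variables, for a polynomial whose
degrees are at most `2 m - 2, 2 m - 3, …`. -/
theorem degreeOf_foldr_rowWord {n m : ℕ} (hm : 2 ≤ m) {f : R n}
    (hf : ∀ i : Fin n, i.val < m → degreeOf (Sum.inl i) f + i.val + 2 ≤ 2 * m)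
    (k : ℕ) (hk : k + 1 ≤ n) (hkm : k < m) (i : Fin n) (him : i.val < m) :
    degreeOf (Sum.inl i) ((rowWord (k + 1) hk).foldr divDiff f) + i.val +
      (if i.val < k then 4 else if i.val = k then 3 else 2) ≤ 2 * m := by
  induction k generalizing i with
  | zero =>
    rw [rowWord, rowWord, List.foldr_cons, List.foldr_nil]
    rcases degreeOf_divDiff_le ⟨0, hk⟩ (Sum.inl i) f with h | h
    · rw [h, degreeOf_zero]
      split_ifs <;> omega
    · have h1 := degreeOf_act_of_zero (k := ⟨0, hk⟩) rfl i f
      have h2 := hf i him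
      rw [if_neg (by omega)]
      split_ifs with hi
      · have : i = ⟨0, hk⟩ := Fin.ext hi
        have h3 := one_le_degreeOf_root_self (⟨0, hk⟩ : Fin n)
        rw [← this] at h3 h h1 ⊢
        omega
      · omega
  | succ k ih =>
    rw [rowWord, List.foldr_cons]
    have ih' := ih (by omega) (by omega)
    set g := (rowWord (k + 1) (Nat.le_of_succ_le hk)).foldr divDiff f with hg
    rcases degreeOf_divDiff_le ⟨k + 1, hk⟩ (Sum.inl i) g with h | h
    · rw [h, degreeOf_zero]
      split_ifs <;> omega
    · have h1 := degreeOf_act_of_pos (k := ⟨k + 1, hk⟩) (by simp) i g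
      have hp : pred (⟨k + 1, hk⟩ : Fin n) = ⟨k, Nat.lt_of_succ_lt hk⟩ := rfl
      have ihk := ih' ⟨k, Nat.lt_of_succ_lt hk⟩ (by simp only; omega)
      have ihk1 := ih' ⟨k + 1, by omega⟩ (by simp only; omega)
      simp only [lt_irrefl, if_false, if_true, Nat.not_succ_lt_self,
        Nat.succ_ne_self] at ihk ihk1
      by_cases hi1 : i.val = k + 1
      · have : i = ⟨k + 1, hk⟩ := Fin.ext hi1
        have h3 := one_le_degreeOf_root_self (⟨k + 1, hk⟩ : Fin n)
        subst this
        rw [Equiv.swap_apply_right, hp] at h1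
        simp only [lt_irrefl, if_false, if_true]
        omega
      · by_cases hi0 : i.val = k
        · have : i = ⟨k, Nat.lt_of_succ_lt hk⟩ := Fin.ext hi0
          have h3 := one_le_degreeOf_root_pred (k := (⟨k + 1, hk⟩ : Fin n)) (by simp)
          subst this
          rw [← hp, Equiv.swap_apply_left] at h1
          rw [hp] at h1 h3
          simp only [Nat.lt_succ_self, if_true]
          omega
        · rw [Equiv.swap_apply_of_ne_of_ne (by rw [hp, Ne, Fin.ext_iff]; exact hi0)
            (by rw [Ne, Fin.ext_iff]; exact hi1)] at h1
          have ihi := ih' i him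
          split_ifs at ihi ⊢ <;> omega

/-- With `M = m + 1`, the divided difference of the signed permutation `(-M, …, -1, M + 1, …, n)`
kills every polynomial whose degree in `x_i` is at most `2 M - 1 - i` for all `i ≤ M`. -/
theorem foldr_barWord_eq_zero {n : ℕ} (m : ℕ) (h : m + 1 ≤ n) {f : R n}
    (hf : ∀ i : Fin n, i.val < m + 1 → degreeOf (Sum.inl i) f + i.val + 2 ≤ 2 * (m + 1)) :
    (barWord (m + 1) h).foldr divDiff f = 0 := by
  have hzero : ∀ b : List (Fin n), b.foldr divDiff (0 : R n) = 0 := by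
    intro b
    induction b with
    | nil => rfl
    | cons k b ih => rw [List.foldr_cons, ih, divDiff_zero]
  induction m generalizing f with
  | zero =>
    simp only [barWord, rowWord, List.nil_append, List.foldr_cons, List.foldr_nil]
    have h1 := hf ⟨0, h⟩ (by simp)
    have h2 := degreeOf_act_of_zero (k := ⟨0, h⟩) rfl ⟨0, h⟩ f
    have h3 := one_le_degreeOf_root_self (⟨0, h⟩ : Fin n)
    rcases degreeOf_divDiff_le ⟨0, h⟩ (Sum.inl ⟨0, h⟩) f with h4 | h4
    · exact h4
    · simp only at h1
      omega
  | succ m ih =>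
    rw [barWord, List.foldr_append]
    refine ih (by omega) fun i hi => ?_
    have := degreeOf_foldr_rowWord (by omega) hf (m + 1) h (by omega) i (by omega)
    rw [if_pos hi] at this
    omega

/-! ### The product `∏ (x_i + y_j)` -/

/-- The variable `x_{i+1}`, or `0` if there is none. -/
noncomputable def xv (n i : ℕ) : R n := if h : i < n then x ⟨i, h⟩ else 0

/-- The variable `y_{j+1}`, or `0` if there is none. -/
noncomputable def yv (n j : ℕ) : R n := if h : j < n then y ⟨j, h⟩ else 0

theorem act_yv {n : ℕ} (k : Fin n) (j : ℕ) : act k (yv n j) = yv n j := by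
  unfold yv
  split_ifs <;> simp

theorem act_xv_of_ne {n : ℕ} {k : Fin n} {i : ℕ} (h1 : i ≠ k.val) (h2 : i + 1 ≠ k.val) :
    act k (xv n i) = xv n i := by
  unfold xv
  split_ifs with h
  · by_cases hk : k.val = 0
    · exact act_x_of_zero_of_ne hk (by rw [Ne, Fin.ext_iff]; exact h1)
    · rw [act_x_of_pos hk, Equiv.swap_apply_of_ne_of_ne]
      · rw [Ne, Fin.ext_iff]
        simp only [pred]
        omega
      · rw [Ne, Fin.ext_iff]
        exact h1
  · simp

theorem act_xv_zero {n : ℕ} {k : Fin n} (hk : k.val = 0) : act k (xv n 0) = -xv n 0 := by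
  have h : 0 < n := by omega
  have : (⟨0, h⟩ : Fin n) = k := Fin.ext hk.symm
  rw [xv, dif_pos h, this, act_x_self_of_zero hk]

theorem act_xv_left {n k : ℕ} (hk : k + 1 < n) :
    act ⟨k + 1, hk⟩ (xv n k) = xv n (k + 1) := by
  rw [xv, dif_pos (by omega), xv, dif_pos hk, act_x_of_pos (by simp)]
  have : pred (⟨k + 1, hk⟩ : Fin n) = ⟨k, by omega⟩ := rfl
  rw [← this, Equiv.swap_apply_left]

theorem act_xv_right {n k : ℕ} (hk : k + 1 < n) :
    act ⟨k + 1, hk⟩ (xv n (k + 1)) = xv n k := by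
  rw [← act_xv_left hk, act_act]

theorem root_eq_xv {n k : ℕ} (hk : k + 1 < n) :
    root (⟨k + 1, hk⟩ : Fin n) = xv n k - xv n (k + 1) := by
  rw [root, if_neg (by simp), xv, dif_pos (by omega), xv, dif_pos hk]
  rfl

/-- The product `∏_{b ≤ d} (x_{i+1} - y_b)`. -/
noncomputable def diffProd (n i d : ℕ) : R n := ∏ b ∈ Finset.range d, (xv n i - yv n b)

/-- The product `∏_{b ≤ d} (x_{i+1} + y_b)`. -/
noncomputable def sumProd (n i d : ℕ) : R n := ∏ b ∈ Finset.range d, (xv n i + yv n b)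

/-- The product `Δ` of the first `m` variables. -/
noncomputable def deltaProd (n m : ℕ) : R n := ∏ i ∈ Finset.range m, diffProd n i (m - 1 - i)

/-- The result of applying `∂_k ∘ ⋯ ∘ ∂_0` to
`∏_{i + j ≤ m} (x_i - y_j) ∏_{i, j ≤ m} (x_i + y_j)`. -/
noncomputable def rowState (n m k : ℕ) : R n :=
  (∏ b ∈ Finset.Ico (m - 1 - k) (m - 1), (yv n (m - 1) + yv n b)) *
  (∏ i ∈ Finset.range m, sumProd n i (m - 1)) *
  (∏ i ∈ Finset.range k, diffProd n i (m - 2 - i)) * diffProd n k (m - 1 - k) *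
  ∏ i ∈ Finset.Ico (k + 1) m, ((xv n i + yv n (m - 1)) * diffProd n i (m - 1 - i))

theorem act_diffProd_of_ne {n : ℕ} {k : Fin n} {i : ℕ} (h1 : i ≠ k.val) (h2 : i + 1 ≠ k.val)
    (d : ℕ) : act k (diffProd n i d) = diffProd n i d := by
  simp only [diffProd, map_prod, map_sub, act_xv_of_ne h1 h2, act_yv]

theorem act_sumProd_of_ne {n : ℕ} {k : Fin n} {i : ℕ} (h1 : i ≠ k.val) (h2 : i + 1 ≠ k.val)
    (d : ℕ) : act k (sumProd n i d) = sumProd n i d := by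
  simp only [sumProd, map_prod, map_add, act_xv_of_ne h1 h2, act_yv]

theorem act_prod_sumProd {n k m : ℕ} (hk : k + 1 < n) (hm : k + 1 < m) (d : ℕ) :
    act ⟨k + 1, hk⟩ (∏ i ∈ Finset.range m, sumProd n i d) =
      ∏ i ∈ Finset.range m, sumProd n i d := by
  rw [map_prod]
  refine Finset.prod_equiv (Equiv.swap k (k + 1)) (fun i => ?_) (fun i _ => ?_)
  · simp only [Finset.mem_range, Equiv.swap_apply_def]
    split_ifs <;> omega
  · by_cases h1 : i = k
    · subst h1
      simp only [sumProd, map_prod, map_add, act_xv_left hk, act_yv, Equiv.swap_apply_left]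
    · by_cases h2 : i = k + 1
      · subst h2
        simp only [sumProd, map_prod, map_add, act_xv_right hk, act_yv, Equiv.swap_apply_right]
      · rw [Equiv.swap_apply_of_ne_of_ne h1 h2, act_sumProd_of_ne h2 (by simpa using h1)]

theorem divDiff_rowState_zero {n : ℕ} (m : ℕ) (h : 0 < n) :
    divDiff ⟨0, h⟩ (deltaProd n (m + 1) * ∏ i ∈ Finset.range (m + 1), sumProd n i (m + 1)) =
      rowState n (m + 1) 0 := by
  have hS : deltaProd n (m + 1) * ∏ i ∈ Finset.range (m + 1), sumProd n i (m + 1) =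
      rowState n (m + 1) 0 * (xv n 0 + yv n m) := by
    simp only [rowState, deltaProd, add_tsub_cancel_right, tsub_zero, Finset.Ico_self,
      Finset.prod_empty, Finset.range_zero, one_mul, zero_add, mul_one]
    simp only [fun i => show sumProd n i (m + 1) = sumProd n i m * (xv n i + yv n m) from
      Finset.prod_range_succ _ _]
    rw [Finset.prod_mul_distrib, Finset.prod_mul_distrib, Finset.prod_Ico_eq_prod_range,
      Finset.prod_Ico_eq_prod_range, add_tsub_cancel_right,
      Finset.prod_range_succ' (fun i => diffProd n i (m - i)),
      Finset.prod_range_succ' (fun i => xv n i + yv n m)]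
    simp only [add_comm 1, tsub_zero]
    ring
  have hinv : act ⟨0, h⟩ (rowState n (m + 1) 0) = rowState n (m + 1) 0 := by
    have h1 : act ⟨0, h⟩ (sumProd n 0 m * diffProd n 0 m) = sumProd n 0 m * diffProd n 0 m := by
      rw [sumProd, diffProd, ← Finset.prod_mul_distrib, map_prod]
      refine Finset.prod_congr rfl fun b _ => ?_
      rw [map_mul, map_add, map_sub, act_xv_zero rfl, act_yv]
      ring
    simp only [rowState, add_tsub_cancel_right, tsub_zero, Finset.Ico_self,
      Finset.prod_empty, Finset.range_zero, one_mul, zero_add, mul_one]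
    rw [Finset.prod_range_succ', mul_assoc (∏ i ∈ _, _), map_mul, map_mul, h1, map_prod, map_prod]
    congr 1
    · congr 1
      exact Finset.prod_congr rfl fun i _ => act_sumProd_of_ne (by simp) (by simp) _
    · refine Finset.prod_congr rfl fun i hi => ?_
      have := (Finset.mem_Ico.1 hi).1
      rw [map_mul, map_add, act_xv_of_ne (by simp only; omega) (by simp), act_yv,
        act_diffProd_of_ne (by simp only; omega) (by simp)]
  rw [hS, divDiff_mul_of_act_eq hinv]
  have : divDiff ⟨0, h⟩ (xv n 0 + yv n m) = 1 := by
    apply divDiff_eq_of_root_mul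
    rw [map_add, act_xv_zero rfl, act_yv, root, if_pos rfl, xv, dif_pos h]
    ring
  rw [this, mul_one]

theorem divDiff_rowState_succ {n k r : ℕ} (hk : k + 1 < n) :
    divDiff ⟨k + 1, hk⟩ (rowState n (k + 2 + r) k) = rowState n (k + 2 + r) (k + 1) := by
  set inv : R n :=
    (∏ b ∈ Finset.Ico (r + 1) (k + 1 + r), (yv n (k + 1 + r) + yv n b)) *
    (∏ i ∈ Finset.range (k + 2 + r), sumProd n i (k + 1 + r)) *
    (∏ i ∈ Finset.range k, diffProd n i (k + r - i)) * (diffProd n k r * diffProd n (k + 1) r) *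
    ∏ i ∈ Finset.Ico (k + 2) (k + 2 + r),
      ((xv n i + yv n (k + 1 + r)) * diffProd n i (k + 1 + r - i)) with hinv_def
  have e1 : k + 2 + r - 1 = k + 1 + r := by omega
  have e2 : k + 1 + r - k = r + 1 := by omega
  have e3 : k + 2 + r - 2 = k + r := by omega
  have e4 : k + 1 + r - (k + 1) = r := by omega
  have e5 : k + r - k = r := by omega
  have hS : rowState n (k + 2 + r) k =
      inv * ((xv n k - yv n r) * (xv n (k + 1) + yv n (k + 1 + r))) := by
    rw [hinv_def, rowState, e1, e2, e3,
      Finset.prod_eq_prod_Ico_succ_bot (by omega : k + 1 < k + 2 + r),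
      e4, show diffProd n k (r + 1) = diffProd n k r * (xv n k - yv n r) from
        Finset.prod_range_succ _ _]
    ring
  have hS' : rowState n (k + 2 + r) (k + 1) = inv * (yv n (k + 1 + r) + yv n r) := by
    rw [hinv_def, rowState, e1, e3, e4, Finset.prod_eq_prod_Ico_succ_bot (by omega : r < k + 1 + r),
      Finset.prod_range_succ, e5]
    ring
  have hinv : act ⟨k + 1, hk⟩ inv = inv := by
    have h1 : act ⟨k + 1, hk⟩ (diffProd n k r * diffProd n (k + 1) r) =
        diffProd n k r * diffProd n (k + 1) r := by
      simp only [diffProd, map_mul, map_prod, map_sub, act_xv_left, act_xv_right, act_yv]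
      ring
    have h2 : act ⟨k + 1, hk⟩ (∏ b ∈ Finset.Ico (r + 1) (k + 1 + r),
        (yv n (k + 1 + r) + yv n b)) =
        ∏ b ∈ Finset.Ico (r + 1) (k + 1 + r), (yv n (k + 1 + r) + yv n b) := by
      simp only [map_prod, map_add, act_yv]
    have h3 : act ⟨k + 1, hk⟩ (∏ i ∈ Finset.range k, diffProd n i (k + r - i)) =
        ∏ i ∈ Finset.range k, diffProd n i (k + r - i) := by
      rw [map_prod]
      refine Finset.prod_congr rfl fun i hi => ?_
      have := Finset.mem_range.1 hi
      exact act_diffProd_of_ne (by simp only; omega) (by simp only; omega) _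
    have h4 : act ⟨k + 1, hk⟩ (∏ i ∈ Finset.Ico (k + 2) (k + 2 + r),
        ((xv n i + yv n (k + 1 + r)) * diffProd n i (k + 1 + r - i))) =
        ∏ i ∈ Finset.Ico (k + 2) (k + 2 + r),
          ((xv n i + yv n (k + 1 + r)) * diffProd n i (k + 1 + r - i)) := by
      rw [map_prod]
      refine Finset.prod_congr rfl fun i hi => ?_
      have := (Finset.mem_Ico.1 hi).1
      rw [map_mul, map_add, act_yv, act_xv_of_ne (by simp only; omega) (by simp only; omega),
        act_diffProd_of_ne (by simp only; omega) (by simp only; omega)]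
    rw [hinv_def, map_mul, map_mul, map_mul, map_mul, h1, h2, h3, h4,
      act_prod_sumProd hk (by omega)]
  rw [hS, hS', divDiff_mul_of_act_eq hinv]
  congr 1
  apply divDiff_eq_of_root_mul
  rw [root_eq_xv, map_mul, map_sub, map_add, act_xv_left, act_xv_right, act_yv, act_yv]
  ring

theorem foldr_rowWord_deltaProd {n m : ℕ} (k : ℕ) (hk : k + 1 ≤ n) (hkm : k < m) (hm : m ≤ n) :
    (rowWord (k + 1) hk).foldr divDiff (deltaProd n m * ∏ i ∈ Finset.range m, sumProd n i m) =
      rowState n m k := by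
  induction k with
  | zero =>
    obtain ⟨m, rfl⟩ : ∃ l, m = l + 1 := ⟨m - 1, by omega⟩
    exact divDiff_rowState_zero m _
  | succ k ih =>
    obtain ⟨r, rfl⟩ : ∃ r, m = k + 2 + r := ⟨m - (k + 2), by omega⟩
    rw [rowWord, List.foldr_cons, ih _ (by omega), divDiff_rowState_succ]

theorem rowState_last (n m : ℕ) : rowState n (m + 1) m =
    ((∏ b ∈ Finset.range m, (yv n m + yv n b)) * sumProd n m m) *
      (deltaProd n m * ∏ i ∈ Finset.range m, sumProd n i m) := by
  have e : ∀ i, m + 1 - 2 - i = m - 1 - i := fun i => by omega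
  have e0 : diffProd n m 0 = 1 := rfl
  rw [rowState, deltaProd, add_tsub_cancel_right, tsub_self, Finset.Ico_self, Finset.prod_empty,
    Finset.prod_range_succ, ← Finset.range_eq_Ico, e0]
  simp only [e]
  ring

theorem foldr_divDiff_mul_of_mem {n : ℕ} {a : R n} {b : List (Fin n)}
    (ha : ∀ k ∈ b, act k a = a) (f : R n) :
    b.foldr divDiff (a * f) = a * b.foldr divDiff f := by
  induction b with
  | nil => rfl
  | cons k b ih =>
    rw [List.foldr_cons, ih fun l hl => ha l (List.mem_cons_of_mem _ hl),
      divDiff_mul_of_act_eq (ha k List.mem_cons_self), List.foldr_cons]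

theorem lt_of_mem_rowWord {n m : ℕ} (h : m ≤ n) {k : Fin n} (hk : k ∈ rowWord m h) : k.val < m := by
  induction m with
  | zero => simp [rowWord] at hk
  | succ m ih =>
    rw [rowWord, List.mem_cons] at hk
    rcases hk with rfl | hk
    · simp
    · have := ih _ hk
      omega

theorem lt_of_mem_barWord {n m : ℕ} (h : m ≤ n) {k : Fin n} (hk : k ∈ barWord m h) : k.val < m := by
  induction m with
  | zero => simp [barWord] at hk
  | succ m ih =>
    rw [barWord, List.mem_append] at hk
    rcases hk with hk | hk
    · have := ih _ hk
      omega
    · exact lt_of_mem_rowWord _ hk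

/-- The image of `Δ(X, Y) ∏_{i, j} (x_i + y_j)` under `∂_{ϖ₀ w₀}`. -/
theorem foldr_barWord_deltaProd {n : ℕ} (m : ℕ) (hm : m ≤ n) :
    (barWord m hm).foldr divDiff (deltaProd n m * ∏ i ∈ Finset.range m, sumProd n i m) =
      (∏ c ∈ Finset.range m, ∏ b ∈ Finset.range c, (yv n c + yv n b)) *
        ∏ c ∈ Finset.range m, sumProd n c c := by
  induction m with
  | zero => simp [barWord, deltaProd]
  | succ m ih =>
    rw [barWord, List.foldr_append, foldr_rowWord_deltaProd m hm (by omega) hm, rowState_last,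
      foldr_divDiff_mul_of_mem, ih, Finset.prod_range_succ, Finset.prod_range_succ]
    · ring
    · intro k hk
      have := lt_of_mem_barWord _ hk
      rw [map_mul, act_sumProd_of_ne (by omega) (by omega), map_prod]
      simp only [map_add, act_yv]

theorem prod_range_eq_prod_fin {n : ℕ} {M : Type*} [CommMonoid M] (d : ℕ) (hd : d ≤ n)
    (g : ℕ → M) : ∏ b ∈ Finset.range d, g b = ∏ j : Fin n with j.val < d, g j.val := by
  refine (Finset.prod_bij (fun j _ => j.val) (fun j hj => ?_) (fun i _ j _ h => Fin.ext h)
    (fun b hb => ?_) (fun _ _ => rfl)).symm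
  · simpa using hj
  · have hb' := Finset.mem_range.1 hb
    exact ⟨⟨b, by omega⟩, by simpa using hb', rfl⟩

theorem Δ_eq_deltaProd (n : ℕ) : Δ n = deltaProd n n := by
  rw [Δ, Finset.prod_filter, Fintype.prod_prod_type, deltaProd, ← Fin.prod_univ_eq_prod_range
    (fun i => diffProd n i (n - 1 - i))]
  refine Finset.prod_congr rfl fun i _ => ?_
  rw [diffProd, prod_range_eq_prod_fin (n := n) _ (by omega), Finset.prod_filter]
  refine Finset.prod_congr rfl fun j _ => ?_
  have hi := i.isLt
  simp only [xv, yv, Fin.is_lt, dif_pos]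
  congr 1
  simp only [eq_iff_iff]
  omega

theorem revNeg_Δ (n : ℕ) : revNeg n (Δ n) = ∏ c ∈ Finset.range n, sumProd n c c := by
  rw [Δ_eq_deltaProd, deltaProd, map_prod, ← Finset.prod_range_reflect]
  refine Finset.prod_congr rfl fun i hi => ?_
  have hi' := Finset.mem_range.1 hi
  rw [diffProd, sumProd, map_prod]
  have e : n - 1 - (n - 1 - i) = i := by omega
  rw [e]
  refine Finset.prod_congr rfl fun b hb => ?_
  have hb' := Finset.mem_range.1 hb
  rw [xv, dif_pos (by omega), yv, dif_pos (by omega), xv, dif_pos hi', map_sub, revNeg_x, revNeg_y,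
    sub_neg_eq_add]
  have : Fin.rev (⟨n - 1 - i, by omega⟩ : Fin n) = ⟨i, hi'⟩ := by
    ext
    simp only [Fin.val_rev]
    omega
  rw [this]

/-! ### The degree filtration over the invariants of `W_n` -/

/-- The polynomials that are invariant under the action of `W_n` on the variables `X`. -/
noncomputable def invariants (n : ℕ) : Subalgebra ℤ (R n) :=
  ⨅ k : Fin n, AlgHom.equalizer (act k) (AlgHom.id ℤ (R n))

theorem mem_invariants {n : ℕ} {a : R n} : a ∈ invariants n ↔ ∀ k, act k a = a := by
  simp [invariants, Algebra.mem_iInf]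

/-- The span, over the invariants of `W_n`, of the polynomials of degree at most `d` in each of the
variables `X`. -/
noncomputable def degreeFiltration (n d : ℕ) : Submodule (invariants n) (R n) :=
  Submodule.span (invariants n) {f | ∀ i : Fin n, degreeOf (Sum.inl i) f ≤ d}

theorem mem_degreeFiltration_of_degreeOf_le {n d : ℕ} {f : R n}
    (h : ∀ i : Fin n, degreeOf (Sum.inl i) f ≤ d) : f ∈ degreeFiltration n d :=
  Submodule.subset_span h

theorem degreeFiltration_mono {n d d' : ℕ} (h : d ≤ d') :
    degreeFiltration n d ≤ degreeFiltration n d' :=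
  Submodule.span_mono fun _ hf i => (hf i).trans h

theorem mul_mem_degreeFiltration {n d d' : ℕ} {f g : R n} (hf : f ∈ degreeFiltration n d)
    (hg : g ∈ degreeFiltration n d') : f * g ∈ degreeFiltration n (d + d') := by
  have h := Submodule.mul_mem_mul hf hg
  rw [degreeFiltration, degreeFiltration, Submodule.span_mul_span] at h
  refine Submodule.span_mono ?_ h
  rintro _ ⟨p, hp, q, hq, rfl⟩ i
  exact (degreeOf_mul_le _ _ _).trans (add_le_add (hp i) (hq i))

theorem invariant_mul_mem_degreeFiltration {n d : ℕ} {a f : R n} (ha : a ∈ invariants n)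
    (hf : f ∈ degreeFiltration n d) : a * f ∈ degreeFiltration n d :=
  Submodule.smul_mem _ (⟨a, ha⟩ : invariants n) hf

theorem prod_mem_degreeFiltration {n : ℕ} {ι : Type*} (S : Finset ι) {g : ι → R n}
    (hg : ∀ p ∈ S, g p ∈ degreeFiltration n 1) : ∏ p ∈ S, g p ∈ degreeFiltration n S.card := by
  classical
  induction S using Finset.induction_on with
  | empty => exact mem_degreeFiltration_of_degreeOf_le fun i => by simp
  | insert a S ha ih =>
    rw [Finset.prod_insert ha, Finset.card_insert_of_notMem ha, add_comm]
    exact mul_mem_degreeFiltration (hg a (Finset.mem_insert_self _ _))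
      (ih fun p hp => hg p (Finset.mem_insert_of_mem hp))

/-- The composite of multiplication by `Δ(X, Y)` and `∂_{ϖ₀ w₀}`. -/
noncomputable def topOp (n : ℕ) (g : R n) : R n := (barWord n le_rfl).foldr divDiff (Δ n * g)

theorem topOp_add {n : ℕ} (f g : R n) : topOp n (f + g) = topOp n f + topOp n g := by
  rw [topOp, mul_add, foldr_divDiff_add]
  rfl

theorem topOp_invariant_mul {n : ℕ} {a : R n} (ha : a ∈ invariants n) (f : R n) :
    topOp n (a * f) = a * topOp n f := by
  rw [topOp, mul_left_comm, foldr_divDiff_mul (mem_invariants.1 ha)]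
  rfl

theorem topOp_zero (n : ℕ) : topOp n 0 = 0 := by
  simpa using topOp_invariant_mul (zero_mem (invariants n)) (0 : R n)

theorem topOp_sum {n : ℕ} {ι : Type*} (S : Finset ι) (g : ι → R n) :
    topOp n (∑ p ∈ S, g p) = ∑ p ∈ S, topOp n (g p) :=
  map_sum (⟨⟨topOp n, topOp_zero n⟩, topOp_add⟩ : R n →+ R n) g S

theorem xv_of_fin {n : ℕ} (i : Fin n) : xv n i.val = x i := by
  rw [xv, dif_pos i.isLt]

theorem degreeOf_deltaProd_le {n : ℕ} (i : Fin n) :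
    degreeOf (Sum.inl i) (deltaProd n n) ≤ n - 1 - i.val := by
  have hx : ∀ l, l < n → degreeOf (Sum.inl i) (xv n l) ≤ if l = i.val then 1 else 0 := by
    intro l hl
    rw [xv, dif_pos hl, degreeOf_X]
    simp only [Sum.inl.injEq, Fin.ext_iff]
    split_ifs <;> omega
  have hy : ∀ b, degreeOf (Sum.inl i) (yv n b) = 0 := by
    intro b
    unfold yv
    split_ifs <;> simp [degreeOf_X]
  refine (degreeOf_prod_le _ _ _).trans ?_
  calc ∑ l ∈ Finset.range n, degreeOf (Sum.inl i) (diffProd n l (n - 1 - l))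
      ≤ ∑ l ∈ Finset.range n, if l = i.val then n - 1 - l else 0 := by
        refine Finset.sum_le_sum fun l hl => (degreeOf_prod_le _ _ _).trans ?_
        have h1 : ∀ b ∈ Finset.range (n - 1 - l),
            degreeOf (Sum.inl i) (xv n l - yv n b) ≤ if l = i.val then 1 else 0 := fun b _ =>
          (degreeOf_sub_le _ _ _).trans (max_le (hx l (Finset.mem_range.1 hl)) (by simp [hy]))
        refine (Finset.sum_le_sum h1).trans ?_
        split_ifs <;> simp
    _ ≤ n - 1 - i.val := by
        rw [Finset.sum_ite_eq']
        split_ifs <;> simp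

/-- The operator `∂_{ϖ₀ w₀} ∘ Δ` kills the polynomials of degree less than `n` in each `x_i`. -/
theorem topOp_eq_zero {n : ℕ} (hn : 0 < n) {f : R n} (hf : f ∈ degreeFiltration n (n - 1)) :
    topOp n f = 0 := by
  induction hf using Submodule.span_induction with
  | mem f hf =>
    obtain ⟨m, rfl⟩ : ∃ m, n = m + 1 := ⟨n - 1, by omega⟩
    rw [topOp, Δ_eq_deltaProd]
    refine foldr_barWord_eq_zero m le_rfl fun i _ => ?_
    have h1 := degreeOf_mul_le (Sum.inl i) (deltaProd (m + 1) (m + 1)) f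
    have h2 := degreeOf_deltaProd_le i
    have h3 := hf i
    have := i.isLt
    omega
  | zero => exact topOp_zero n
  | add f g _ _ hf hg => rw [topOp_add, hf, hg, add_zero]
  | smul a f _ hf =>
    rw [Subalgebra.smul_def, smul_eq_mul, topOp_invariant_mul a.2, hf, mul_zero]

/-! ### Elementary symmetric polynomials modulo the filtration -/

/-- The elementary symmetric polynomial `e_p(X)`. -/
noncomputable def elem (n p : ℕ) : R n := rename Sum.inl (esymm (Fin n) ℤ p)

theorem elem_zero (n : ℕ) : elem n 0 = 1 := by simp [elem]

theorem elem_of_gt {n p : ℕ} (h : n < p) : elem n p = 0 := by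
  rw [elem, esymm, Finset.powersetCard_eq_empty.2 (by simpa using h), Finset.sum_empty, map_zero]

theorem degreeOf_esymm_le {n : ℕ} (p : ℕ) (i : Fin n) : degreeOf i (esymm (Fin n) ℤ p) ≤ 1 := by
  refine (degreeOf_sum_le _ _ _).trans (Finset.sup_le fun t _ => (degreeOf_prod_le _ _ _).trans ?_)
  simp only [degreeOf_X]
  rw [Finset.sum_ite_eq]
  split_ifs <;> simp

theorem elem_mem (n p : ℕ) : elem n p ∈ degreeFiltration n 1 :=
  mem_degreeFiltration_of_degreeOf_le fun i => by
    rw [elem, degreeOf_rename_of_injective Sum.inl_injective]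
    exact degreeOf_esymm_le p i

theorem prod_act_sq {n : ℕ} {M : Type*} [CommMonoid M] (g : R n → M) (k : Fin n) :
    ∏ i : Fin n, g (act k (x i) ^ 2) = ∏ i : Fin n, g (x i ^ 2) := by
  by_cases hk : k.val = 0
  · refine Finset.prod_congr rfl fun i _ => ?_
    by_cases hi : i = k
    · rw [hi, act_x_self_of_zero hk, neg_sq]
    · rw [act_x_of_zero_of_ne hk hi]
  · simp only [act_x_of_pos hk]
    exact Equiv.prod_comp (Equiv.swap (pred k) k) fun i => g (x i ^ 2)

theorem coeff_prod_one_add (n p : ℕ) :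
    (∏ i : Fin n, (1 + Polynomial.C (x i : R n) * Polynomial.X)).coeff p = elem n p := by
  rw [Finset.prod_one_add, Polynomial.finsetSum_coeff, elem, esymm, map_sum,
    Finset.powersetCard_eq_filter, Finset.sum_filter]
  refine Finset.sum_congr rfl fun t _ => ?_
  rw [Finset.prod_mul_distrib, Finset.prod_const, ← map_prod, Polynomial.coeff_C_mul,
    Polynomial.coeff_X_pow, map_prod]
  simp only [rename_X, mul_ite, mul_one, mul_zero, eq_comm]

/-- The coefficients of `∏ (1 + x_i t)(1 - x_i t)` are invariant under `W_n`. -/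
theorem sum_antidiagonal_mem_invariants (n q : ℕ) :
    ∑ p ∈ Finset.HasAntidiagonal.antidiagonal q, elem n p.1 * ((-1) ^ p.2 * elem n p.2) ∈
      invariants n := by
  have h : ∑ p ∈ Finset.HasAntidiagonal.antidiagonal q, elem n p.1 * ((-1) ^ p.2 * elem n p.2) =
      (∏ i : Fin n, (1 - Polynomial.C (x i ^ 2 : R n) * Polynomial.X ^ 2)).coeff q := by
    have h1 : ∏ i : Fin n, (1 - Polynomial.C (x i ^ 2 : R n) * Polynomial.X ^ 2) =
        (∏ i : Fin n, (1 + Polynomial.C (x i : R n) * Polynomial.X)) *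
        (∏ i : Fin n, (1 + Polynomial.C (x i : R n) * Polynomial.X)).comp
          (Polynomial.C (-1) * Polynomial.X) := by
      rw [Polynomial.prod_comp, ← Finset.prod_mul_distrib]
      refine Finset.prod_congr rfl fun i _ => ?_
      simp
      ring
    rw [h1, Polynomial.coeff_mul]
    refine Finset.sum_congr rfl fun p _ => ?_
    rw [Polynomial.comp_C_mul_X_coeff, coeff_prod_one_add, coeff_prod_one_add]
    ring
  rw [h, mem_invariants]
  intro k
  have h2 := Polynomial.coeff_map (act k : R n →+* R n)
    (p := ∏ i : Fin n, (1 - Polynomial.C (x i ^ 2 : R n) * Polynomial.X ^ 2)) q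
  refine Eq.trans h2.symm ?_
  congr 1
  rw [Polynomial.map_prod]
  have h3 := prod_act_sq
    (fun z : R n => (1 - Polynomial.C z * Polynomial.X ^ 2 : Polynomial (R n))) k
  rw [← h3]
  refine Finset.prod_congr rfl fun i _ => ?_
  simp

/-- Up to an invariant, `e_q ^ 2` is a combination of the products `e_a e_b` with `a + b = 2 q` and
`a < b`. -/
theorem elem_sq_mul_mem {n d q : ℕ} {Z : R n} (hZ : Z ∈ degreeFiltration n d)
    (h : ∀ a b, a + b = 2 * q → a < b → elem n a * elem n b * Z ∈ degreeFiltration n d) :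
    elem n q * elem n q * Z ∈ degreeFiltration n d := by
  have hsum := sum_antidiagonal_mem_invariants n (2 * q)
  have hq : (q, q) ∈ Finset.HasAntidiagonal.antidiagonal (2 * q) := by
    rw [Finset.HasAntidiagonal.mem_antidiagonal]
    omega
  rw [← Finset.add_sum_erase _ _ hq] at hsum
  have h1 := invariant_mul_mem_degreeFiltration hsum hZ
  have h2 : (∑ p ∈ (Finset.HasAntidiagonal.antidiagonal (2 * q)).erase (q, q),
      elem n p.1 * ((-1) ^ p.2 * elem n p.2)) * Z ∈ degreeFiltration n d := by
    rw [Finset.sum_mul]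
    refine Submodule.sum_mem _ fun p hp => ?_
    obtain ⟨hne, hp⟩ := Finset.mem_erase.1 hp
    rw [Finset.HasAntidiagonal.mem_antidiagonal] at hp
    have h3 : elem n p.1 * elem n p.2 * Z ∈ degreeFiltration n d := by
      rcases lt_trichotomy p.1 p.2 with hlt | heq | hgt
      · exact h _ _ hp hlt
      · exact absurd (Prod.ext (by simp only; omega) (by simp only; omega)) hne
      · rw [mul_comm (elem n p.1)]
        exact h _ _ (by omega) hgt
    have h4 : elem n p.1 * ((-1) ^ p.2 * elem n p.2) * Z =
        (-1) ^ p.2 * (elem n p.1 * elem n p.2 * Z) := by ring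
    rw [h4]
    exact invariant_mul_mem_degreeFiltration (pow_mem (neg_mem (one_mem _)) _) h3
  rw [add_mul] at h1
  have h5 := (Submodule.add_mem_iff_left _ h2).1 h1
  have h6 : elem n q * elem n q * Z = (-1) ^ q * (elem n q * ((-1) ^ q * elem n q) * Z) := by
    have : ((-1 : R n) ^ q) * (-1) ^ q = 1 := by rw [← mul_pow]; simp
    linear_combination (-(elem n q * elem n q * Z)) * this
  simp only at h5
  rw [h6]
  exact invariant_mul_mem_degreeFiltration (pow_mem (neg_mem (one_mem _)) _) h5

/-- For `q ≤ k` the product `e_1 ⋯ e_k e_q` of `k + 1` factors lies already in the step `k` of the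
filtration: the repeated factor `e_q ^ 2` is replaced by products `e_a e_b` with `a < q`. -/
theorem prod_low_mul_mem {n : ℕ} (q : ℕ) : ∀ k, q ≤ k →
    (∏ p ∈ Finset.Ioc 0 k, elem n p) * elem n q ∈ degreeFiltration n k := by
  induction q using Nat.strong_induction_on with
  | _ q ih =>
    intro k hqk
    rcases Nat.eq_zero_or_pos q with rfl | hq
    · rw [elem_zero, mul_one]
      simpa using prod_mem_degreeFiltration (Finset.Ioc 0 k) fun p _ => elem_mem n p
    · set L := ∏ p ∈ Finset.Ioc 0 (q - 1), elem n p with hL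
      set H := ∏ p ∈ Finset.Ioc q k, elem n p with hH
      have hLm : L ∈ degreeFiltration n (q - 1) := by
        simpa using prod_mem_degreeFiltration (Finset.Ioc 0 (q - 1)) fun p _ => elem_mem n p
      have hHm : H ∈ degreeFiltration n (k - q) := by
        simpa using prod_mem_degreeFiltration (Finset.Ioc q k) fun p _ => elem_mem n p
      have hsplit : ∏ p ∈ Finset.Ioc 0 k, elem n p = L * elem n q * H := by
        rw [← Finset.prod_Ioc_consecutive _ (Nat.zero_le q) hqk]
        obtain ⟨r, rfl⟩ : ∃ r, q = r + 1 := ⟨q - 1, by omega⟩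
        rw [Finset.prod_Ioc_succ_top (Nat.zero_le r)]
        rfl
      have e : (∏ p ∈ Finset.Ioc 0 k, elem n p) * elem n q = elem n q * elem n q * (L * H) := by
        rw [hsplit]; ring
      rw [e]
      refine elem_sq_mul_mem
        (degreeFiltration_mono (by omega) (mul_mem_degreeFiltration hLm hHm)) fun a b hab hlt => ?_
      have h1 := ih a (by omega) (q - 1) (by omega)
      have h2 := mul_mem_degreeFiltration h1 (mul_mem_degreeFiltration (elem_mem n b) hHm)
      have e2 : elem n a * elem n b * (L * H) = L * elem n a * (elem n b * H) := by ring
      rw [e2]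
      exact degreeFiltration_mono (by omega) h2

/-- For `i < q` the product `e_{i+1} ⋯ e_n e_q` of `n - i + 1` factors lies already in the step
`n - i` of the filtration: the repeated factor `e_q ^ 2` is replaced by products `e_a e_b` with
`q < b`, and `e_b` vanishes for `n < b`. -/
theorem prod_high_mul_mem {n : ℕ} (r : ℕ) : ∀ q i, n ≤ q + r → i < q → i ≤ n →
    (∏ p ∈ Finset.Ioc i n, elem n p) * elem n q ∈ degreeFiltration n (n - i) := by
  induction r using Nat.strong_induction_on with
  | _ r ih =>
    intro q i hqr hiq hin
    by_cases hqn : n < q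
    · rw [elem_of_gt hqn, mul_zero]
      exact zero_mem _
    · set L := ∏ p ∈ Finset.Ioc i (q - 1), elem n p with hL
      set H := ∏ p ∈ Finset.Ioc q n, elem n p with hH
      have hLm : L ∈ degreeFiltration n (q - 1 - i) := by
        simpa using prod_mem_degreeFiltration (Finset.Ioc i (q - 1)) fun p _ => elem_mem n p
      have hHm : H ∈ degreeFiltration n (n - q) := by
        simpa using prod_mem_degreeFiltration (Finset.Ioc q n) fun p _ => elem_mem n p
      have hsplit : ∏ p ∈ Finset.Ioc i n, elem n p = L * elem n q * H := by
        rw [← Finset.prod_Ioc_consecutive _ hiq.le (by omega : q ≤ n)]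
        obtain ⟨t, rfl⟩ : ∃ t, q = t + 1 := ⟨q - 1, by omega⟩
        rw [Finset.prod_Ioc_succ_top (by omega : i ≤ t)]
        rfl
      have e : (∏ p ∈ Finset.Ioc i n, elem n p) * elem n q = elem n q * elem n q * (L * H) := by
        rw [hsplit]; ring
      rw [e]
      refine elem_sq_mul_mem
        (degreeFiltration_mono (by omega) (mul_mem_degreeFiltration hLm hHm)) fun a b hab hlt => ?_
      have h1 : H * elem n b ∈ degreeFiltration n (n - q) := by
        by_cases hbn : n < b
        · rw [elem_of_gt hbn, mul_zero]
          exact zero_mem _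
        · exact ih (n - b) (by omega) b q (by omega) (by omega) (by omega)
      have h2 := mul_mem_degreeFiltration h1 (mul_mem_degreeFiltration (elem_mem n a) hLm)
      have e2 : elem n a * elem n b * (L * H) = H * elem n b * (elem n a * L) := by ring
      rw [e2]
      exact degreeFiltration_mono (by omega) h2

/-! ### The value of `∂_{ϖ₀ w₀} ∘ Δ` on `e_1 ⋯ e_n` -/

/-- The product `∏ (z + x_i)`. -/
noncomputable def charProd (n : ℕ) (z : R n) : R n := ∏ i : Fin n, (z + x i)

theorem charProd_eq_sum (n : ℕ) (z : R n) :
    charProd n z = ∑ p ∈ Finset.range (n + 1), elem n p * z ^ (n - p) := by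
  have h := congrArg (fun P => Polynomial.eval z (Polynomial.map
    (rename Sum.inl : MvPolynomial (Fin n) ℤ →ₐ[ℤ] R n).toRingHom P))
    (MvPolynomial.prod_C_add_X_eq_sum_esymm (σ := Fin n) (R := ℤ))
  simp only [Polynomial.map_prod, Polynomial.map_sum, Polynomial.eval_prod,
    Polynomial.eval_finsetSum, Fintype.card_fin] at h
  simpa [charProd, elem] using h

theorem charProd_mem {n : ℕ} {z : R n} (hz : z ∈ invariants n) :
    charProd n z ∈ degreeFiltration n 1 := by
  rw [charProd_eq_sum]
  refine Submodule.sum_mem _ fun p _ => ?_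
  rw [mul_comm]
  exact invariant_mul_mem_degreeFiltration (pow_mem hz _) (elem_mem n p)

theorem charProd_mul_charProd_neg_mem {n : ℕ} {z : R n} (hz : z ∈ invariants n) :
    charProd n z * charProd n (-z) ∈ invariants n := by
  have h : charProd n z * charProd n (-z) = ∏ i : Fin n, (x i ^ 2 - z ^ 2) := by
    rw [charProd, charProd, ← Finset.prod_mul_distrib]
    exact Finset.prod_congr rfl fun i _ => by ring
  rw [h, mem_invariants]
  intro k
  rw [map_prod]
  refine Eq.trans ?_ (prod_act_sq (fun u => u - z ^ 2) k)
  exact Finset.prod_congr rfl fun i _ => by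
    rw [map_sub, map_pow, map_pow, mem_invariants.1 hz k]

theorem yv_mem_invariants (n j : ℕ) : yv n j ∈ invariants n :=
  mem_invariants.2 fun k => act_yv k j

theorem yv_add_yv_ne_zero {n a b : ℕ} (ha : a < n) (hb : b < n) (hab : a ≠ b) :
    yv n a + yv n b ≠ 0 := by
  intro h
  have h1 := congrArg (coeff (Finsupp.single (Sum.inr ⟨a, ha⟩ : Fin n ⊕ Fin n) 1)) h
  rw [yv, dif_pos ha, yv, dif_pos hb] at h1
  simp [coeff_X, Finsupp.single_left_inj, Ne.symm hab] at h1

theorem yv_injOn (n : ℕ) : Set.InjOn (yv n) (Set.Iio n) := by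
  intro a ha b hb h
  rw [yv, dif_pos (Set.mem_Iio.1 ha), yv, dif_pos (Set.mem_Iio.1 hb)] at h
  simpa using Sum.inr_injective (X_injective h)

theorem eq_C_mul_prod_of_roots {S : Type*} [CommRing S] [IsDomain S] {r : ℕ} {v : ℕ → S}
    (hv : Set.InjOn v (Finset.range r)) {f : Polynomial S} (hdeg : ∀ m, r < m → f.coeff m = 0)
    (hroot : ∀ a < r, f.eval (v a) = 0) :
    f = Polynomial.C (f.coeff r) * ∏ a ∈ Finset.range r, (Polynomial.X - Polynomial.C (v a)) := by
  set P : Polynomial S := ∏ a ∈ Finset.range r, (Polynomial.X - Polynomial.C (v a)) with hP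
  have hmonic : P.Monic := Polynomial.monic_prod_of_monic _ _ fun a _ => Polynomial.monic_X_sub_C _
  have hnat : P.natDegree = r := by
    rw [hP, Polynomial.natDegree_prod_of_monic _ _ fun a _ => Polynomial.monic_X_sub_C _]
    simp
  rw [← sub_eq_zero]
  apply Polynomial.eq_zero_of_degree_lt_of_eval_index_eq_zero (Finset.range r) hv
  · rw [Finset.card_range, Polynomial.degree_lt_iff_coeff_zero]
    intro m hm
    rw [Polynomial.coeff_sub, Polynomial.coeff_C_mul]
    rcases hm.eq_or_lt with rfl | hlt
    · have : P.coeff r = 1 := by rw [← hnat]; exact hmonic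
      rw [this, mul_one, sub_self]
    · have : P.coeff m = 0 := Polynomial.coeff_eq_zero_of_natDegree_lt (by omega)
      rw [hdeg m hlt, this, mul_zero, sub_self]
  · intro a ha
    rw [Polynomial.eval_sub, hroot a (Finset.mem_range.1 ha), Polynomial.eval_mul, hP,
      Polynomial.eval_prod, Finset.prod_eq_zero ha (by simp), mul_zero, sub_self]

/-- The factors `∏ (y_a + x_i)` are replaced one after the other by elementary symmetric
polynomials. With one factor `∏ (z + x_i)` more, the value is a polynomial in `z` of degree at most
`r`: the coefficients of higher powers of `z` belong to products `e_1 ⋯ e_k e_q` with `q ≤ k`.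
It vanishes at `z = -y_a`, because `∏ (y_a + x_i) (-y_a + x_i)` is invariant. -/
theorem topOp_mixed {n : ℕ} (k : ℕ) : ∀ r, r + k = n →
    topOp n ((∏ a ∈ Finset.range r, charProd n (yv n a)) * ∏ p ∈ Finset.Ioc 0 k, elem n p) =
      (∏ c ∈ Finset.range r, ∏ b ∈ Finset.range c, (yv n c + yv n b)) *
        ∏ c ∈ Finset.range n, sumProd n c c := by
  induction k with
  | zero =>
    intro r hr
    obtain rfl : r = n := by omega
    rw [Finset.Ioc_self, Finset.prod_empty, mul_one, ← foldr_barWord_deltaProd _ le_rfl, topOp,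
      Δ_eq_deltaProd]
    congr 2
    simp only [charProd, sumProd]
    rw [Finset.prod_comm, ← Fin.prod_univ_eq_prod_range
      (fun i => ∏ b ∈ Finset.range r, (xv r i + yv r b))]
    refine Finset.prod_congr rfl fun i _ => Finset.prod_congr rfl fun b _ => ?_
    rw [xv_of_fin, add_comm]
  | succ k ih =>
    intro r hr
    have hn : 0 < n := by omega
    set B : R n := (∏ a ∈ Finset.range r, charProd n (yv n a)) * ∏ p ∈ Finset.Ioc 0 k, elem n p
      with hB
    set f : Polynomial (R n) := ∑ p ∈ Finset.range (n + 1),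
      Polynomial.C (topOp n (elem n p * B)) * Polynomial.X ^ (n - p) with hf
    have hcoeff : ∀ p ≤ n, f.coeff (n - p) = topOp n (elem n p * B) := by
      intro p hp
      rw [hf, Polynomial.finsetSum_coeff, Finset.sum_eq_single p]
      · simp
      · intro q hq hqp
        have := Finset.mem_range.1 hq
        rw [Polynomial.coeff_C_mul, Polynomial.coeff_X_pow, if_neg (by omega), mul_zero]
      · intro h
        exact absurd (Finset.mem_range.2 (by omega)) h
    have heval : ∀ z ∈ invariants n, f.eval z = topOp n (charProd n z * B) := by
      intro z hz
      rw [charProd_eq_sum, Finset.sum_mul, topOp_sum, hf, Polynomial.eval_finsetSum]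
      refine Finset.sum_congr rfl fun p _ => ?_
      have e : elem n p * z ^ (n - p) * B = z ^ (n - p) * (elem n p * B) := by ring
      rw [e, topOp_invariant_mul (pow_mem hz _)]
      rw [Polynomial.eval_mul, Polynomial.eval_C, Polynomial.eval_pow, Polynomial.eval_X, mul_comm]
    have hY : ∀ S : Finset ℕ, ∏ a ∈ S, charProd n (yv n a) ∈ degreeFiltration n S.card := fun S =>
      prod_mem_degreeFiltration S fun a _ => charProd_mem (yv_mem_invariants n a)
    have hdeg : ∀ m, r < m → f.coeff m = 0 := by
      intro m hm
      by_cases hmn : m ≤ n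
      · have h1 := hcoeff (n - m) (by omega)
        rw [show n - (n - m) = m by omega] at h1
        rw [h1]
        apply topOp_eq_zero hn
        have h2 := mul_mem_degreeFiltration (hY (Finset.range r))
          (prod_low_mul_mem (n := n) (n - m) k (by omega))
        have e : elem n (n - m) * B = (∏ a ∈ Finset.range r, charProd n (yv n a)) *
            ((∏ p ∈ Finset.Ioc 0 k, elem n p) * elem n (n - m)) := by rw [hB]; ring
        rw [e]
        refine degreeFiltration_mono ?_ h2
        rw [Finset.card_range]
        omega
      · rw [hf, Polynomial.finsetSum_coeff]
        refine Finset.sum_eq_zero fun p _ => ?_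
        rw [Polynomial.coeff_C_mul, Polynomial.coeff_X_pow, if_neg (by omega), mul_zero]
    have hroot : ∀ a < r, f.eval (-yv n a) = 0 := by
      intro a ha
      rw [heval _ (neg_mem (yv_mem_invariants n a)), hB,
        ← Finset.mul_prod_erase _ _ (Finset.mem_range.2 ha)]
      have e : ∀ p q : R n, charProd n (-yv n a) * (charProd n (yv n a) * p * q) =
          (charProd n (yv n a) * charProd n (-yv n a)) * (p * q) := fun p q => by ring
      rw [e, topOp_invariant_mul (charProd_mul_charProd_neg_mem (yv_mem_invariants n a)),
        topOp_eq_zero hn, mul_zero]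
      have h1 := mul_mem_degreeFiltration (hY ((Finset.range r).erase a))
        (prod_mem_degreeFiltration (Finset.Ioc 0 k) fun p _ => elem_mem n p)
      refine degreeFiltration_mono ?_ h1
      rw [Finset.card_erase_of_mem (Finset.mem_range.2 ha), Finset.card_range, Nat.card_Ioc]
      omega
    have hinj : Set.InjOn (fun a => -yv n a) (Finset.range r) := by
      intro a ha b hb hab
      have ha' := Finset.mem_range.1 ha
      have hb' := Finset.mem_range.1 hb
      exact yv_injOn n (Set.mem_Iio.2 (by omega)) (Set.mem_Iio.2 (by omega)) (neg_injective hab)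
    have hfac := congrArg (Polynomial.eval (yv n r)) (eq_C_mul_prod_of_roots hinj hdeg hroot)
    have hc := hcoeff (k + 1) (by omega)
    rw [show n - (k + 1) = r by omega] at hc
    have h1 : charProd n (yv n r) * B = (∏ a ∈ Finset.range (r + 1), charProd n (yv n a)) *
        ∏ p ∈ Finset.Ioc 0 k, elem n p := by
      rw [hB, Finset.prod_range_succ]; ring
    have h2 : elem n (k + 1) * B = (∏ a ∈ Finset.range r, charProd n (yv n a)) *
        ∏ p ∈ Finset.Ioc 0 (k + 1), elem n p := by
      rw [hB, Finset.prod_Ioc_succ_top (Nat.zero_le k)]; ring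
    rw [heval _ (yv_mem_invariants n r), h1, ih (r + 1) (by omega), hc, h2] at hfac
    simp only [Polynomial.eval_mul, Polynomial.eval_C, Polynomial.eval_prod, Polynomial.eval_sub,
      Polynomial.eval_X, sub_neg_eq_add] at hfac
    rw [Finset.prod_range_succ] at hfac
    have hne : ∏ b ∈ Finset.range r, (yv n r + yv n b) ≠ 0 := by
      rw [Finset.prod_ne_zero_iff]
      intro b hb
      have := Finset.mem_range.1 hb
      exact yv_add_yv_ne_zero (by omega) (by omega) (by omega)
    apply mul_right_cancel₀ hne
    rw [← hfac]
    ring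

/-- The operator `∂_{ϖ₀ w₀} ∘ Δ` sends `e_1 ⋯ e_n` to `Δ(ϖ₀ X, -Y)`. -/
theorem topOp_prod_elem (n : ℕ) :
    topOp n (∏ p ∈ Finset.Ioc 0 n, elem n p) = revNeg n (Δ n) := by
  have h := topOp_mixed (n := n) n 0 (zero_add n)
  simpa [revNeg_Δ] using h

/-! ### Pfaffians modulo the filtration -/

theorem degreeOf_Qpair_le {n : ℕ} (i j : ℕ) (v : Fin n) :
    degreeOf v (Qpair n i j) ≤ 1 + if 0 < j then 1 else 0 := by
  unfold Qpair
  split_ifs with hj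
  · have h2 : ∀ a b : ℕ, degreeOf v (esymm (Fin n) ℤ a * esymm (Fin n) ℤ b) ≤ 2 := fun a b =>
      (degreeOf_mul_le _ _ _).trans
        (add_le_add (degreeOf_esymm_le a v) (degreeOf_esymm_le b v))
    refine (degreeOf_add_le _ _ _).trans (max_le (h2 _ _) ?_)
    have e : (2 : MvPolynomial (Fin n) ℤ) = C 2 := by simp
    rw [e]
    refine (degreeOf_C_mul_le _ _ _).trans ((degreeOf_sum_le _ _ _).trans
      (Finset.sup_le fun k _ => ?_))
    have e' : ((-1) ^ k * esymm (Fin n) ℤ (i + k) * esymm (Fin n) ℤ (j - k) :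
        MvPolynomial (Fin n) ℤ) = C ((-1) ^ k) *
          (esymm (Fin n) ℤ (i + k) * esymm (Fin n) ℤ (j - k)) := by
      simp [mul_assoc]
    rw [e']
    exact (degreeOf_C_mul_le _ _ _).trans (h2 _ _)
  · obtain rfl : j = 0 := by omega
    simpa using degreeOf_esymm_le i v

theorem pfaffian_nil {S ι : Type*} [CommRing S] (A : ι → ι → S) : pfaffian A [] = 1 := by
  rw [pfaffian]

theorem pfaffian_cons {S ι : Type*} [CommRing S] (A : ι → ι → S) (i : ι) (l : List ι) :
    pfaffian A (i :: l) = ∑ j : Fin l.length,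
      (-1) ^ j.val * A i (l.get j) * pfaffian A (l.eraseIdx j.val) := by
  rw [pfaffian]

theorem countP_eraseIdx {l : List ℕ} (j : Fin l.length) :
    l.countP (0 < ·) = (l.eraseIdx j.val).countP (0 < ·) + if 0 < l.get j then 1 else 0 := by
  have h := (List.getElem_cons_eraseIdx_perm j.isLt).countP_eq (fun a : ℕ => decide (0 < a))
  rw [List.countP_cons] at h
  simpa using h.symm

/-- The Pfaffian of a strictly decreasing sequence has, in each variable, at most the degree given
by the number of nonzero entries. -/
theorem degreeOf_pfaffian_le {n : ℕ} (l : List ℕ) (hl : l.Pairwise (· > ·)) (v : Fin n) :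
    degreeOf v (pfaffian (Qpair n) l) ≤ l.countP (0 < ·) := by
  induction hN : l.length using Nat.strong_induction_on generalizing l with
  | _ N ih =>
    rcases l with _ | ⟨i, l⟩
    · rw [pfaffian_nil]
      simp
    · obtain ⟨h1, h2⟩ := List.pairwise_cons.1 hl
      rw [pfaffian_cons]
      refine (degreeOf_sum_le _ _ _).trans (Finset.sup_le fun j _ => ?_)
      have hi : 0 < i := (Nat.zero_le _).trans_lt (h1 _ (List.get_mem l j))
      have h3 := ih (l.eraseIdx j.val).length
        (by rw [← hN, List.length_eraseIdx_of_lt j.isLt, List.length_cons]; omega)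
        (l.eraseIdx j.val) (h2.sublist (List.eraseIdx_sublist _ _)) rfl
      have h4 := degreeOf_Qpair_le i (l.get j) v
      have e : ((-1) ^ j.val * Qpair n i (l.get j) * pfaffian (Qpair n) (l.eraseIdx j.val)) =
          C ((-1) ^ j.val) * (Qpair n i (l.get j) * pfaffian (Qpair n) (l.eraseIdx j.val)) := by
        simp [mul_assoc]
      rw [e]
      refine (degreeOf_C_mul_le _ _ _).trans ((degreeOf_mul_le _ _ _).trans ?_)
      rw [List.countP_cons_of_pos (by simpa using hi), countP_eraseIdx j]
      omega

theorem countP_pos_eq_card {l : List ℕ} (hl : l.Nodup) :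
    l.countP (0 < ·) = (l.toFinset.erase 0).card := by
  rw [List.countP_eq_length_filter, ← List.toFinset_card_of_nodup (hl.filter _)]
  congr 1
  ext a
  simp [Nat.pos_iff_ne_zero, and_comm]

theorem prod_elem_mem (n : ℕ) (S : Finset ℕ) :
    ∏ p ∈ S, elem n p ∈ degreeFiltration n (S.erase 0).card := by
  rw [← Finset.prod_erase S (elem_zero n)]
  exact prod_mem_degreeFiltration _ fun p _ => elem_mem n p

theorem sum_neg_one_pow_of_odd {S : Type*} [CommRing S] {m : ℕ} (hm : Odd m) :
    ∑ j : Fin m, (-1 : S) ^ j.val = 1 := by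
  rw [Fin.sum_univ_eq_sum_range fun j => (-1 : S) ^ j]
  obtain ⟨r, rfl⟩ := hm
  induction r with
  | zero => simp
  | succ r ih =>
    rw [show 2 * (r + 1) + 1 = (2 * r + 1) + 1 + 1 by ring, Finset.sum_range_succ,
      Finset.sum_range_succ, ih]
    ring

theorem sum_neg_one_pow_mul_sub {S : Type*} [CommRing S] {m : ℕ} (hm : Odd m) (g : Fin m → S)
    (P T : S) : (∑ j, (-1) ^ j.val * g j) * P - T = ∑ j, (-1) ^ j.val * (g j * P - T) := by
  simp only [mul_sub, Finset.sum_sub_distrib]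
  rw [← Finset.sum_mul, sum_neg_one_pow_of_odd hm, one_mul, Finset.sum_mul]
  simp only [mul_assoc]

theorem rename_pfaffian_cons {n : ℕ} (i : ℕ) (l : List ℕ) :
    (rename Sum.inl (pfaffian (Qpair n) (i :: l)) : R n) = ∑ j : Fin l.length, (-1) ^ j.val *
      (rename Sum.inl (Qpair n i (l.get j)) *
        rename Sum.inl (pfaffian (Qpair n) (l.eraseIdx j.val))) := by
  rw [pfaffian_cons, map_sum]
  refine Finset.sum_congr rfl fun j _ => ?_
  rw [map_mul, map_mul, map_pow, map_neg, map_one, mul_assoc]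

/-- The terms of `Q̃_{i,m}` other than the leading one contain a factor `e_{i+k}` whose index
exceeds the largest part `i`, so it repeats a factor `e_p` of the product or vanishes. -/
theorem pfaffian_error_term_mem {n i : ℕ} {l : List ℕ} (h1 : ∀ a ∈ l, a < i)
    (h2 : l.Pairwise (· > ·)) (hin : i ≤ n) (j : Fin l.length) {k : ℕ} (hk1 : 1 ≤ k)
    (hkm : k ≤ l.get j) :
    (-1) ^ k * elem n (i + k) * elem n (l.get j - k) *
      rename Sum.inl (pfaffian (Qpair n) (l.eraseIdx j.val)) *
      ∏ p ∈ Finset.range (n + 1) \ (i :: l).toFinset, elem n p ∈ degreeFiltration n (n - 1) := by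
  have hnodup : l.Nodup := h2.imp fun h => h.ne'
  have hmi : l.get j < i := h1 _ (List.get_mem l j)
  have hi : 0 < i := by omega
  generalize hP : ∏ p ∈ Finset.range (n + 1) \ (i :: l).toFinset, elem n p = P
  generalize hF : (rename Sum.inl (pfaffian (Qpair n) (l.eraseIdx j.val)) : R n) = F
  have hsplit : P = (∏ p ∈ Finset.Ioc i n, elem n p) *
      ∏ p ∈ Finset.range i \ l.toFinset, elem n p := by
    rw [← hP, ← Finset.prod_union]
    · congr 1
      ext a
      simp only [Finset.mem_sdiff, Finset.mem_range, List.mem_toFinset, Finset.mem_union,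
        List.mem_cons, Finset.mem_Ioc]
      constructor
      · rintro ⟨ha, hae⟩
        by_cases hai : i < a
        · exact Or.inl ⟨hai, by omega⟩
        · exact Or.inr ⟨by omega, by tauto⟩
      · rintro (⟨ha, hae⟩ | ⟨ha, hae⟩)
        · refine ⟨by omega, ?_⟩
          rintro (rfl | h)
          · exact lt_irrefl _ ha
          · have := h1 _ h
            omega
        · refine ⟨by omega, ?_⟩
          rintro (rfl | h)
          · exact lt_irrefl _ ha
          · exact hae h
    · rw [Finset.disjoint_left]
      intro a ha hb
      have h3 := (Finset.mem_Ioc.1 ha).1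
      have h4 := Finset.mem_range.1 (Finset.mem_sdiff.1 hb).1
      omega
  have hFm : F ∈ degreeFiltration n ((l.eraseIdx j.val).countP (0 < ·)) :=
    mem_degreeFiltration_of_degreeOf_le fun v => by
      rw [← hF, degreeOf_rename_of_injective Sum.inl_injective]
      exact degreeOf_pfaffian_le _ (h2.sublist (List.eraseIdx_sublist _ _)) v
  have hup := prod_high_mul_mem (n := n) n (i + k) i (by omega) (by omega) hin
  have hrest := prod_elem_mem n (Finset.range i \ l.toFinset)
  have h5 := mul_mem_degreeFiltration hup (mul_mem_degreeFiltration (elem_mem n (l.get j - k))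
    (mul_mem_degreeFiltration hFm hrest))
  have h6 : l.countP (0 < ·) + ((Finset.range i \ l.toFinset).erase 0).card = i - 1 := by
    rw [countP_pos_eq_card hnodup, ← Finset.card_union_of_disjoint]
    · have : l.toFinset.erase 0 ∪ (Finset.range i \ l.toFinset).erase 0 =
          (Finset.range i).erase 0 := by
        ext a
        simp only [Finset.mem_union, Finset.mem_erase, Finset.mem_sdiff, Finset.mem_range,
          List.mem_toFinset]
        constructor
        · rintro (⟨ha, hb⟩ | ⟨ha, hb, _⟩)
          · exact ⟨ha, h1 _ hb⟩
          · exact ⟨ha, hb⟩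
        · rintro ⟨ha, hb⟩
          by_cases hal : a ∈ l
          · exact Or.inl ⟨ha, hal⟩
          · exact Or.inr ⟨ha, hb, hal⟩
      rw [this, Finset.card_erase_of_mem (Finset.mem_range.2 hi), Finset.card_range]
    · rw [Finset.disjoint_left]
      intro a ha hb
      exact (Finset.mem_sdiff.1 (Finset.mem_of_mem_erase hb)).2 (Finset.mem_of_mem_erase ha)
  have h7 := countP_eraseIdx j
  rw [if_pos (by omega)] at h7
  have e : (-1) ^ k * elem n (i + k) * elem n (l.get j - k) * F * P =
      (-1) ^ k * ((∏ p ∈ Finset.Ioc i n, elem n p) * elem n (i + k) *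
        (elem n (l.get j - k) * (F * ∏ p ∈ Finset.range i \ l.toFinset, elem n p))) := by
    rw [hsplit]; ring
  rw [e]
  refine invariant_mul_mem_degreeFiltration (pow_mem (neg_mem (one_mem _)) _)
    (degreeFiltration_mono ?_ h5)
  omega

/-- Modulo the filtration only the leading terms `e_i e_m` of the entries `Q̃_{i,m}` contribute,
since the other terms repeat one of the large indices; the signs in the expansion along the first
row add up to `1`. -/
theorem pfaffian_mul_prod_sub_mem {n : ℕ} (l : List ℕ) (hl : l.Pairwise (· > ·))
    (heven : Even l.length) (hn : ∀ p ∈ l, p ≤ n) :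
    rename Sum.inl (pfaffian (Qpair n) l) * ∏ p ∈ Finset.range (n + 1) \ l.toFinset, elem n p -
      ∏ p ∈ Finset.range (n + 1), elem n p ∈ degreeFiltration n (n - 1) := by
  induction hN : l.length using Nat.strong_induction_on generalizing l with
  | _ N ih =>
    rcases l with _ | ⟨i, l⟩
    · rw [pfaffian_nil]
      simp
    · obtain ⟨h1, h2⟩ := List.pairwise_cons.1 hl
      have hin : i ≤ n := hn i List.mem_cons_self
      have hodd : Odd l.length := by
        rw [List.length_cons, Nat.even_add_one, Nat.not_even_iff_odd] at heven
        exact heven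
      have hnodup : l.Nodup := h2.imp fun h => h.ne'
      set P : R n := ∏ p ∈ Finset.range (n + 1) \ (i :: l).toFinset, elem n p with hP
      set T : R n := ∏ p ∈ Finset.range (n + 1), elem n p with hT
      have hil : i ∉ l := fun h => lt_irrefl _ (h1 i h)
      have key : ∀ j : Fin l.length, rename Sum.inl (Qpair n i (l.get j)) *
          rename Sum.inl (pfaffian (Qpair n) (l.eraseIdx j.val)) * P - T ∈
            degreeFiltration n (n - 1) := by
        intro j
        set m := l.get j with hm
        set F : R n := rename Sum.inl (pfaffian (Qpair n) (l.eraseIdx j.val)) with hF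
        have hml : m ∈ l := List.get_mem l j
        have hmi : m < i := h1 m hml
        have hi : 0 < i := by omega
        have hperm : (m :: l.eraseIdx j.val).Perm l := List.getElem_cons_eraseIdx_perm j.isLt
        have hme : m ∉ l.eraseIdx j.val := (List.nodup_cons.1 (hperm.nodup_iff.2 hnodup)).1
        have hie : i ∉ l.eraseIdx j.val := fun h => hil (hperm.subset (List.mem_cons_of_mem _ h))
        have hset : ∀ a, a ∈ l ↔ a = m ∨ a ∈ l.eraseIdx j.val := fun a => by
          rw [← hperm.mem_iff, List.mem_cons]
        have hlead : elem n i * elem n m * F * P - T ∈ degreeFiltration n (n - 1) := by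
          have h3 := ih (l.eraseIdx j.val).length
            (by rw [← hN, List.length_eraseIdx_of_lt j.isLt, List.length_cons]; omega)
            (l.eraseIdx j.val) (h2.sublist (List.eraseIdx_sublist _ _))
            (by rw [List.length_eraseIdx_of_lt j.isLt]; exact Nat.Odd.sub_odd hodd odd_one)
            (fun p hp =>
              hn p (List.mem_cons_of_mem _ (hperm.subset (List.mem_cons_of_mem _ hp)))) rfl
          have h4 : Finset.range (n + 1) \ (l.eraseIdx j.val).toFinset =
              insert i (insert m (Finset.range (n + 1) \ (i :: l).toFinset)) := by
            ext a
            simp only [Finset.mem_sdiff, Finset.mem_range, List.mem_toFinset, Finset.mem_insert,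
              List.mem_cons, hset]
            constructor
            · rintro ⟨ha, hae⟩
              by_cases hai : a = i
              · exact Or.inl hai
              · by_cases ham : a = m
                · exact Or.inr (Or.inl ham)
                · exact Or.inr (Or.inr ⟨ha, by tauto⟩)
            · rintro (rfl | rfl | ⟨ha, hae⟩)
              · exact ⟨by omega, hie⟩
              · exact ⟨by omega, hme⟩
              · exact ⟨ha, by tauto⟩
          rw [h4, Finset.prod_insert, Finset.prod_insert, ← hP] at h3
          · convert h3 using 2
            ring
          · simp [hml]
          · simp only [Finset.mem_insert, Finset.mem_sdiff, List.mem_toFinset, List.mem_cons]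
            push Not
            exact ⟨hmi.ne', by tauto⟩
        have herr : ∀ k ∈ Finset.Icc 1 m,
            (-1) ^ k * elem n (i + k) * elem n (m - k) * F * P ∈ degreeFiltration n (n - 1) :=
          fun k hk => pfaffian_error_term_mem h1 h2 hin j (Finset.mem_Icc.1 hk).1
            (Finset.mem_Icc.1 hk).2
        have hQ : rename Sum.inl (Qpair n i m) * F * P - T =
            (elem n i * elem n m * F * P - T) + 2 * ∑ k ∈ Finset.Icc 1 m,
              (-1) ^ k * elem n (i + k) * elem n (m - k) * F * P := by
          have h3 : (rename Sum.inl (Qpair n i m) : R n) = elem n i * elem n m +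
              2 * ∑ k ∈ Finset.Icc 1 m, (-1) ^ k * elem n (i + k) * elem n (m - k) := by
            simp only [Qpair, elem, map_add, map_mul, map_sum, map_pow, map_neg, map_one, map_ofNat]
          rw [h3, ← Finset.sum_mul, ← Finset.sum_mul]
          ring
        rw [hQ]
        refine add_mem hlead (invariant_mul_mem_degreeFiltration ?_ (Submodule.sum_mem _ herr))
        exact ofNat_mem (invariants n) 2
      rw [rename_pfaffian_cons, sum_neg_one_pow_mul_sub hodd]
      exact Submodule.sum_mem _ fun j _ =>
        invariant_mul_mem_degreeFiltration (pow_mem (neg_mem (one_mem _)) _) (key j)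

/-- The case `ϖ = ϖ₀` of the comparison: in the sum defining `Q̃(X, Y)` only the term of
`λ = (n, …, 1)` survives. -/
theorem foldr_barWord_Δ_mul_Qkernel (n : ℕ) :
    (barWord n le_rfl).foldr divDiff (Δ n * Qkernel n) = revNeg n (Δ n) := by
  change topOp n (Qkernel n) = _
  rw [Qkernel, topOp_sum]
  have hinr : ∀ g : MvPolynomial (Fin n) ℤ, (rename Sum.inr g : R n) ∈ invariants n := by
    intro g
    rw [mem_invariants]
    intro k
    have : (act k).comp (rename Sum.inr) = (rename Sum.inr : MvPolynomial (Fin n) ℤ →ₐ[ℤ] R n) := by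
      ext j : 1
      simp
    exact DFunLike.congr_fun this g
  have hterm : ∀ t : Finset ℕ, topOp n (rename Sum.inl (Qtilde n t) *
      rename Sum.inr (Qtilde n (Finset.Icc 1 n \ t))) =
        rename Sum.inr (Qtilde n (Finset.Icc 1 n \ t)) * topOp n (rename Sum.inl (Qtilde n t)) :=
    fun t => by rw [mul_comm, topOp_invariant_mul (hinr _)]
  -- the list of parts of `t`, extended by a zero part if necessary
  have hlist : ∀ t ⊆ Finset.Icc 1 n, ∃ l : List ℕ, l.Pairwise (· > ·) ∧ Even l.length ∧
      (∀ p ∈ l, p ≤ n) ∧ Qtilde n t = pfaffian (Qpair n) l ∧ l.toFinset.erase 0 = t := by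
    intro t ht
    have hs := (t.sortedGT_sort).pairwise
    have hpos : ∀ p ∈ t, 1 ≤ p ∧ p ≤ n := fun p hp => Finset.mem_Icc.1 (ht hp)
    have h0 : 0 ∉ t := fun h => by have := (hpos 0 h).1; omega
    by_cases he : Even (t.sort (· ≥ ·)).length
    · refine ⟨t.sort (· ≥ ·), hs, he, fun p hp => (hpos p ((Finset.mem_sort _).1 hp)).2, ?_, ?_⟩
      · rw [Qtilde, Qlist, if_pos he]
      · rw [Finset.sort_toFinset, Finset.erase_eq_of_notMem h0]
    · refine ⟨t.sort (· ≥ ·) ++ [0], ?_, ?_, ?_, ?_, ?_⟩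
      · rw [List.pairwise_append]
        refine ⟨hs, List.pairwise_singleton _ _, fun p hp q hq => ?_⟩
        rw [List.mem_singleton.1 hq]
        exact (hpos p ((Finset.mem_sort _).1 hp)).1
      · rw [List.length_append, List.length_singleton, Nat.even_add_one]
        exact he
      · intro p hp
        rcases List.mem_append.1 hp with hp | hp
        · exact (hpos p ((Finset.mem_sort _).1 hp)).2
        · rw [List.mem_singleton.1 hp]
          exact Nat.zero_le n
      · rw [Qtilde, Qlist, if_neg he]
      · rw [List.toFinset_append, Finset.sort_toFinset]
        ext a
        simp only [Finset.mem_erase, Finset.mem_union, List.mem_toFinset, List.mem_singleton]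
        constructor
        · rintro ⟨h1, h2 | h2⟩
          · exact h2
          · exact absurd h2 h1
        · intro ha
          exact ⟨fun h => h0 (h ▸ ha), Or.inl ha⟩
  rw [Finset.sum_eq_single (Finset.Icc 1 n)]
  · obtain ⟨l, h1, h2, h3, h4, h5⟩ := hlist _ subset_rfl
    rw [hterm, Finset.sdiff_self]
    have hQ0 : Qtilde n ∅ = 1 := by
      rw [Qtilde, Qlist, Finset.sort_empty, if_pos (by simp), pfaffian_nil]
    rw [hQ0, map_one, one_mul, h4]
    rcases Nat.eq_zero_or_pos n with rfl | hn
    · have hl : l.length = 0 := by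
        have hle : ∀ p ∈ l, p = 0 := fun p hp => Nat.le_zero.1 (h3 p hp)
        have hnd : l.Nodup := h1.imp fun h => h.ne'
        have hlen : l.length ≤ 1 := by
          rw [← List.toFinset_card_of_nodup hnd]
          refine (Finset.card_le_card (t := {0}) fun a ha => ?_).trans (by simp)
          simpa using hle a (List.mem_toFinset.1 ha)
        obtain ⟨r, hr⟩ := h2
        omega
      rw [List.eq_nil_of_length_eq_zero hl, pfaffian_nil, map_one, ← topOp_prod_elem]
      simp
    · have h6 := topOp_eq_zero hn (pfaffian_mul_prod_sub_mem l h1 h2 h3)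
      have h7 : ∏ p ∈ Finset.range (n + 1) \ l.toFinset, elem n p = 1 := by
        refine Finset.prod_eq_one fun p hp => ?_
        obtain ⟨hp1, hp2⟩ := Finset.mem_sdiff.1 hp
        have hp0 : p = 0 := by
          by_contra hne
          have : p ∈ l.toFinset.erase 0 := by
            rw [h5, Finset.mem_Icc]
            have := Finset.mem_range.1 hp1
            omega
          exact hp2 (Finset.mem_of_mem_erase this)
        rw [hp0, elem_zero]
      have h8 : ∏ p ∈ Finset.range (n + 1), elem n p = ∏ p ∈ Finset.Ioc 0 n, elem n p := by
        rw [← Finset.prod_erase _ (elem_zero n)]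
        congr 1
        ext a
        simp only [Finset.mem_erase, Finset.mem_range, Finset.mem_Ioc]
        omega
      rw [h7, mul_one, h8, sub_eq_add_neg, topOp_add, ← neg_one_mul,
        topOp_invariant_mul (neg_mem (one_mem _)), topOp_prod_elem] at h6
      linear_combination h6
  · intro t ht hne
    have ht' := Finset.mem_powerset.1 ht
    obtain ⟨l, h1, h2, h3, h4, h5⟩ := hlist t ht'
    have hcard : t.card < n := by
      have := Finset.card_lt_card (Finset.ssubset_iff_subset_ne.2 ⟨ht', hne⟩)
      simpa using this
    rw [hterm, topOp_eq_zero (by omega), mul_zero]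
    refine mem_degreeFiltration_of_degreeOf_le fun i => ?_
    rw [degreeOf_rename_of_injective Sum.inl_injective, h4]
    have h6 := degreeOf_pfaffian_le l h1 i
    rw [countP_pos_eq_card (h1.imp fun h => h.ne'), h5] at h6
    omega
  · intro h
    exact absurd (Finset.mem_powerset_self _) h

/-! ### Products over the nilCoxeter algebra -/

/-- The relations of the nilCoxeter algebra of the symmetric group, for generators `u_0, u_1, …`. -/
structure IsNilCoxeter {A : Type*} [Ring A] (u : ℕ → A) : Prop where
  sq : ∀ c, u c * u c = 0
  comm : ∀ c d, c + 2 ≤ d → u c * u d = u d * u c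
  braid : ∀ c, u c * u (c + 1) * u c = u (c + 1) * u c * u (c + 1)

section NilCoxeter

variable {S A : Type*} [CommRing S] [Ring A] [Algebra S A]

/-- The element `1 + t u_c`. -/
def expGen (u : ℕ → A) (c : ℕ) (t : S) : A := 1 + t • u c

/-- The product `(1 + (a - z_0) u_c) (1 + (a - z_1) u_{c+1}) ⋯ (1 + (a - z_{m-1}) u_{c+m-1})`. -/
def rowProd (u : ℕ → A) : ℕ → ℕ → S → (ℕ → S) → A
  | _, 0, _, _ => 1
  | c, m + 1, a, z => expGen u c (a - z 0) * rowProd u (c + 1) m a fun b => z (b + 1)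

variable {u : ℕ → A}

theorem IsNilCoxeter.expGen_mul (hu : IsNilCoxeter u) (c : ℕ) (a b : S) :
    expGen u c a * expGen u c b = expGen u c (a + b) := by
  simp only [expGen, add_mul, mul_add, one_mul, mul_one, smul_mul_assoc, mul_smul_comm, hu.sq,
    smul_zero, add_smul, add_zero]
  abel

/-- The Yang–Baxter equation. -/
theorem IsNilCoxeter.yangBaxter (hu : IsNilCoxeter u) (c : ℕ) (a b : S) :
    expGen u c a * expGen u (c + 1) (a + b) * expGen u c b =
      expGen u (c + 1) b * expGen u c (a + b) * expGen u (c + 1) a := by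
  simp only [expGen, add_mul, mul_add, one_mul, mul_one, smul_mul_assoc, mul_smul_comm, hu.sq,
    hu.braid, smul_zero, smul_smul, add_smul, add_zero, smul_add]
  module

theorem IsNilCoxeter.expGen_comm (hu : IsNilCoxeter u) {c d : ℕ} (h : c + 2 ≤ d) (a b : S) :
    expGen u c a * expGen u d b = expGen u d b * expGen u c a := by
  simp only [expGen, add_mul, mul_add, one_mul, mul_one, smul_mul_assoc, mul_smul_comm,
    hu.comm c d h]
  module

theorem IsNilCoxeter.expGen_mul_rowProd_comm (hu : IsNilCoxeter u) {c : ℕ} (t a : S) (m : ℕ) :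
    ∀ (d : ℕ) (z : ℕ → S), c + 2 ≤ d →
      expGen u c t * rowProd u d m a z = rowProd u d m a z * expGen u c t := by
  induction m with
  | zero => intro d z _; simp [rowProd]
  | succ m ih =>
    intro d z h
    rw [rowProd, ← mul_assoc, hu.expGen_comm h, mul_assoc, ih _ _ (by omega), mul_assoc]

/-- Two consecutive rows exchange their parameters, up to a factor in the generator between them. -/
theorem IsNilCoxeter.rowProd_exchange (hu : IsNilCoxeter u) (a b : S) (m : ℕ) :
    ∀ (c : ℕ) (z : ℕ → S),
      expGen u c (b - a) * (rowProd u (c + 1) m b z * rowProd u c (m + 1) a z) =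
        rowProd u (c + 1) m a z * rowProd u c (m + 1) b z := by
  induction m with
  | zero =>
    intro c z
    simp only [rowProd, mul_one, one_mul]
    rw [hu.expGen_mul]
    congr 1
    ring
  | succ m ih =>
    intro c z
    have hyb := hu.yangBaxter c (b - a) (a - z 0)
    rw [sub_add_sub_cancel] at hyb
    have hih := ih (c + 1) fun i => z (i + 1)
    have hb := hu.expGen_mul_rowProd_comm (c := c) (a - z 0) b m (c + 1 + 1) (fun i => z (i + 1))
      (by omega)
    have ha := hu.expGen_mul_rowProd_comm (c := c) (b - z 0) a m (c + 1 + 1) (fun i => z (i + 1))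
      (by omega)
    have e : ∀ t : S, rowProd u c (m + 1 + 1) t z =
        expGen u c (t - z 0) * rowProd u (c + 1) (m + 1) t fun i => z (i + 1) := fun _ => rfl
    have e' : ∀ t : S, rowProd u (c + 1) (m + 1) t z =
        expGen u (c + 1) (t - z 0) * rowProd u (c + 1 + 1) m t fun i => z (i + 1) := fun _ => rfl
    rw [e, e, e', e']
    set ra := rowProd u (c + 1 + 1) m a fun i => z (i + 1)
    set rb := rowProd u (c + 1 + 1) m b fun i => z (i + 1)
    set ra' := rowProd u (c + 1) (m + 1) a fun i => z (i + 1)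
    set rb' := rowProd u (c + 1) (m + 1) b fun i => z (i + 1)
    calc expGen u c (b - a) * (expGen u (c + 1) (b - z 0) * rb * (expGen u c (a - z 0) * ra'))
        = expGen u c (b - a) * expGen u (c + 1) (b - z 0) * (rb * expGen u c (a - z 0)) * ra' := by
          simp only [mul_assoc]
      _ = (expGen u c (b - a) * expGen u (c + 1) (b - z 0) * expGen u c (a - z 0)) *
            (rb * ra') := by
          rw [← hb]; simp only [mul_assoc]
      _ = expGen u (c + 1) (a - z 0) * expGen u c (b - z 0) *
            (expGen u (c + 1) (b - a) * (rb * ra')) := by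
          rw [hyb]; simp only [mul_assoc]
      _ = expGen u (c + 1) (a - z 0) * (expGen u c (b - z 0) * ra) * rb' := by
          rw [hih]; simp only [mul_assoc]
      _ = expGen u (c + 1) (a - z 0) * ra * (expGen u c (b - z 0) * rb') := by
          rw [ha]; simp only [mul_assoc]

end NilCoxeter

/-! ### The nilCoxeter algebra acting on functions on `W_n` -/

/-- The operator on functions on `W_n` with `(u_c Φ)(w) = Φ(s_{c+1} w)` if `s_{c+1}` is a left
descent of `w`, and `(u_c Φ)(w) = 0` otherwise. It is zero if there is no generator `s_{c+1}`. -/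
noncomputable def descentOp (n c : ℕ) : Module.End (R n) (W n → R n) where
  toFun Φ w := open Classical in
    if h : c + 1 < n then (if IsDescent ⟨c + 1, h⟩ w then Φ (s ⟨c + 1, h⟩ * w) else 0) else 0
  map_add' Φ Φ' := by
    funext w
    simp only [Pi.add_apply]
    split_ifs <;> simp
  map_smul' a Φ := by
    funext w
    simp only [Pi.smul_apply, RingHom.id_apply]
    split_ifs <;> simp

theorem descentOp_of_le {n c : ℕ} (h : n ≤ c + 1) : descentOp n c = 0 := by
  refine LinearMap.ext fun Φ => funext fun w => ?_
  exact dif_neg (by omega)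

theorem descentOp_of_isDescent {n c : ℕ} {h : c + 1 < n} {w : W n} (hw : IsDescent ⟨c + 1, h⟩ w)
    (Φ : W n → R n) : descentOp n c Φ w = Φ (s ⟨c + 1, h⟩ * w) :=
  (dif_pos h).trans (if_pos hw)

theorem descentOp_of_not_isDescent {n c : ℕ} {h : c + 1 < n} {w : W n}
    (hw : ¬IsDescent ⟨c + 1, h⟩ w) (Φ : W n → R n) : descentOp n c Φ w = 0 :=
  (dif_pos h).trans (if_neg hw)

theorem isDescent_succ_iff {n c : ℕ} {h : c + 1 < n} {w : W n} :
    IsDescent ⟨c + 1, h⟩ w ↔ entry w⁻¹ ⟨c + 1, h⟩ < entry w⁻¹ ⟨c, by omega⟩ := by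
  rw [IsDescent, if_neg (by simp)]
  rfl

theorem entry_s_mul_inv {n c : ℕ} (h : c + 1 < n) (w : W n) (i : Fin n) :
    entry (s ⟨c + 1, h⟩ * w)⁻¹ i =
      entry w⁻¹ (Equiv.swap (⟨c, by omega⟩ : Fin n) ⟨c + 1, h⟩ i) := by
  rw [s_mul_inv, entry_mul_s_of_pos (by simp)]
  rfl

theorem isNilCoxeter_descentOp (n : ℕ) : IsNilCoxeter (descentOp n) where
  sq c := by
    rcases le_or_gt n (c + 1) with hn | hn
    · rw [descentOp_of_le hn, mul_zero]
    · refine LinearMap.ext fun Φ => funext fun w => ?_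
      rw [Module.End.mul_apply]
      by_cases hw : IsDescent ⟨c + 1, hn⟩ w
      · rw [descentOp_of_isDescent hw,
          descentOp_of_not_isDescent (h := hn) (fun h => isDescent_s_mul.1 h hw)]
        rfl
      · rw [descentOp_of_not_isDescent hw]
        rfl
  comm c d hcd := by
    rcases le_or_gt n (d + 1) with hn | hn
    · rw [descentOp_of_le hn, mul_zero, zero_mul]
    · have hc : c + 1 < n := by omega
      have h1 : ∀ w : W n, IsDescent ⟨d + 1, hn⟩ (s ⟨c + 1, hc⟩ * w) ↔ IsDescent ⟨d + 1, hn⟩ w := by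
        intro w
        rw [isDescent_succ_iff, isDescent_succ_iff, entry_s_mul_inv, entry_s_mul_inv,
          Equiv.swap_apply_of_ne_of_ne, Equiv.swap_apply_of_ne_of_ne] <;>
          simp only [Ne, Fin.mk.injEq] <;> omega
      have h2 : ∀ w : W n, IsDescent ⟨c + 1, hc⟩ (s ⟨d + 1, hn⟩ * w) ↔ IsDescent ⟨c + 1, hc⟩ w := by
        intro w
        rw [isDescent_succ_iff, isDescent_succ_iff, entry_s_mul_inv, entry_s_mul_inv,
          Equiv.swap_apply_of_ne_of_ne, Equiv.swap_apply_of_ne_of_ne] <;>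
          simp only [Ne, Fin.mk.injEq] <;> omega
      refine LinearMap.ext fun Φ => funext fun w => ?_
      rw [Module.End.mul_apply, Module.End.mul_apply]
      by_cases hwc : IsDescent ⟨c + 1, hc⟩ w <;> by_cases hwd : IsDescent ⟨d + 1, hn⟩ w
      · rw [descentOp_of_isDescent hwc, descentOp_of_isDescent hwd,
          descentOp_of_isDescent ((h1 w).2 hwd), descentOp_of_isDescent ((h2 w).2 hwc), ← mul_assoc,
          ← mul_assoc,
          s_comm (i := (⟨c + 1, hc⟩ : Fin n)) (j := ⟨d + 1, hn⟩) (by simp only; omega)]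
      · rw [descentOp_of_isDescent hwc, descentOp_of_not_isDescent hwd,
          descentOp_of_not_isDescent (mt (h1 w).1 hwd)]
      · rw [descentOp_of_not_isDescent hwc, descentOp_of_isDescent hwd,
          descentOp_of_not_isDescent (mt (h2 w).1 hwc)]
      · rw [descentOp_of_not_isDescent hwc, descentOp_of_not_isDescent hwd]
  braid c := by
    rcases le_or_gt n (c + 1 + 1) with hn | hn
    · rw [descentOp_of_le hn, mul_zero, zero_mul, mul_zero]
    · have hc : c + 1 < n := by omega
      refine LinearMap.ext fun Φ => funext fun w => ?_
      simp only [Module.End.mul_apply]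
      have e0 : ∀ w : W n, entry (s ⟨c + 1, hc⟩ * w)⁻¹ ⟨c, by omega⟩ = entry w⁻¹ ⟨c + 1, hc⟩ := by
        intro w; rw [entry_s_mul_inv, Equiv.swap_apply_left]
      have e1 : ∀ w : W n, entry (s ⟨c + 1, hc⟩ * w)⁻¹ ⟨c + 1, hc⟩ = entry w⁻¹ ⟨c, by omega⟩ := by
        intro w; rw [entry_s_mul_inv, Equiv.swap_apply_right]
      have e2 : ∀ w : W n, entry (s ⟨c + 1, hc⟩ * w)⁻¹ ⟨c + 1 + 1, hn⟩ =
          entry w⁻¹ ⟨c + 1 + 1, hn⟩ := by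
        intro w
        rw [entry_s_mul_inv, Equiv.swap_apply_of_ne_of_ne] <;> simp only [Ne, Fin.mk.injEq] <;>
          omega
      have f0 : ∀ w : W n, entry (s ⟨c + 1 + 1, hn⟩ * w)⁻¹ ⟨c, by omega⟩ =
          entry w⁻¹ ⟨c, by omega⟩ := by
        intro w
        rw [entry_s_mul_inv, Equiv.swap_apply_of_ne_of_ne] <;> simp only [Ne, Fin.mk.injEq] <;>
          omega
      have f1 : ∀ w : W n, entry (s ⟨c + 1 + 1, hn⟩ * w)⁻¹ ⟨c + 1, hc⟩ =
          entry w⁻¹ ⟨c + 1 + 1, hn⟩ := by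
        intro w; rw [entry_s_mul_inv, Equiv.swap_apply_left]
      have f2 : ∀ w : W n, entry (s ⟨c + 1 + 1, hn⟩ * w)⁻¹ ⟨c + 1 + 1, hn⟩ =
          entry w⁻¹ ⟨c + 1, hc⟩ := by
        intro w; rw [entry_s_mul_inv, Equiv.swap_apply_right]
      have hs : s ⟨c + 1, hc⟩ * (s ⟨c + 1 + 1, hn⟩ * (s ⟨c + 1, hc⟩ * w)) =
          s ⟨c + 1 + 1, hn⟩ * (s ⟨c + 1, hc⟩ * (s ⟨c + 1 + 1, hn⟩ * w)) := by
        have := s_braid_three (i := (⟨c + 1, hc⟩ : Fin n)) (j := ⟨c + 1 + 1, hn⟩) (by simp) rfl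
        simp only [← mul_assoc, this]
      have key : ∀ (c : ℕ) (h : c + 1 < n) (Φ : W n → R n) (v : W n), descentOp n c Φ v =
          open Classical in if entry v⁻¹ ⟨c + 1, h⟩ < entry v⁻¹ ⟨c, by omega⟩ then
            Φ (s ⟨c + 1, h⟩ * v) else 0 := by
        intro c h Φ v
        split_ifs with hv
        · exact descentOp_of_isDescent (isDescent_succ_iff.2 hv) Φ
        · exact descentOp_of_not_isDescent (mt isDescent_succ_iff.1 hv) Φ
      simp only [key _ hc, key _ hn, e0, e1, e2, f0, f1, f2, hs]
      split_ifs <;> rfl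

theorem expGen_descentOp_apply {n c : ℕ} (t : R n) (Φ : W n → R n) (w : W n) :
    expGen (descentOp n) c t Φ w = Φ w + t * descentOp n c Φ w := rfl

theorem act_descentOp {n : ℕ} (k : Fin n) (c : ℕ) (Φ : W n → R n) :
    (fun w => act k (descentOp n c Φ w)) = descentOp n c fun w => act k (Φ w) := by
  funext w
  rcases le_or_gt n (c + 1) with hn | hn
  · rw [descentOp_of_le hn]
    exact map_zero _
  · by_cases hw : IsDescent ⟨c + 1, hn⟩ w
    · rw [descentOp_of_isDescent hw, descentOp_of_isDescent hw]
    · rw [descentOp_of_not_isDescent hw, descentOp_of_not_isDescent hw, map_zero]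

theorem act_expGen {n : ℕ} (k : Fin n) (c : ℕ) (t : R n) (Φ : W n → R n) :
    (fun w => act k (expGen (descentOp n) c t Φ w)) =
      expGen (descentOp n) c (act k t) fun w => act k (Φ w) := by
  funext w
  rw [expGen_descentOp_apply, expGen_descentOp_apply, map_add, map_mul, ← act_descentOp]

theorem act_rowProd {n : ℕ} (k : Fin n) (a : R n) (Φ : W n → R n) (m : ℕ) :
    ∀ (c : ℕ) (z : ℕ → R n), (∀ b, act k (z b) = z b) →
      (fun w => act k (rowProd (descentOp n) c m a z Φ w)) =
        rowProd (descentOp n) c m (act k a) z fun w => act k (Φ w) := by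
  induction m with
  | zero => intro c z _; rfl
  | succ m ih =>
    intro c z hz
    simp only [rowProd, Module.End.mul_apply]
    rw [act_expGen, ih _ _ fun b => hz (b + 1), map_sub, hz]

/-- The function on `W_n` obtained from the indicator function of `1` by the first `j` rows of the
Fomin–Stanley product. Its value at `ϖ⁻¹`, for `j = n`, is the double Schubert polynomial of `ϖ`. -/
noncomputable def stanleyFun (n : ℕ) : ℕ → W n → R n
  | 0 => open Classical in Pi.single 1 1
  | j + 1 => rowProd (descentOp n) j (n - 1 - j) (xv n j) (yv n) (stanleyFun n j)

theorem act_stanleyFun_of_le {n : ℕ} (k : Fin n) {j : ℕ} (h : j + 1 ≤ k.val) :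
    (fun w => act k (stanleyFun n j w)) = stanleyFun n j := by
  induction j with
  | zero =>
    funext w
    classical
    by_cases hw : w = 1
    · simp [stanleyFun, hw]
    · simp [stanleyFun, hw]
  | succ j ih =>
    simp only [stanleyFun]
    rw [act_rowProd _ _ _ _ _ _ (act_yv k), ih (by omega), act_xv_of_ne (by omega) (by omega)]

theorem act_stanleyFun_of_ge {n c : ℕ} (hc : c + 1 < n) {j : ℕ} (h : c + 2 ≤ j) :
    (fun w => act ⟨c + 1, hc⟩ (stanleyFun n j w)) =
      expGen (descentOp n) c (xv n (c + 1) - xv n c) (stanleyFun n j) := by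
  induction j, h using Nat.le_induction with
  | base =>
    simp only [stanleyFun]
    rw [act_rowProd _ _ _ _ _ _ (act_yv _), act_rowProd _ _ _ _ _ _ (act_yv _),
      act_stanleyFun_of_le _ (by simp), act_xv_left, act_xv_right]
    obtain ⟨m, hm⟩ : ∃ m, n - 1 - c = m + 1 := ⟨n - 2 - c, by omega⟩
    have hm' : n - 1 - (c + 1) = m := by omega
    rw [hm, hm']
    exact (DFunLike.congr_fun ((isNilCoxeter_descentOp n).rowProd_exchange (xv n c) (xv n (c + 1)) m
      c (yv n)) (stanleyFun n c)).symm
  | succ j hj ih =>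
    simp only [stanleyFun]
    rw [act_rowProd _ _ _ _ _ _ (act_yv _), ih, act_xv_of_ne (by simp only; omega)
      (by simp only; omega)]
    exact (DFunLike.congr_fun ((isNilCoxeter_descentOp n).expGen_mul_rowProd_comm
      (xv n (c + 1) - xv n c) (xv n j) (n - 1 - j) j (yv n) hj) (stanleyFun n j)).symm

/-- On the values of the Fomin–Stanley function, the divided differences act through `W_n`. -/
theorem divDiff_stanleyFun {n c : ℕ} (hc : c + 1 < n) (w : W n) :
    divDiff ⟨c + 1, hc⟩ (stanleyFun n n w) = descentOp n c (stanleyFun n n) w := by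
  apply divDiff_eq_of_root_mul
  have h := congrFun (act_stanleyFun_of_ge hc (j := n) (by omega)) w
  rw [expGen_descentOp_apply] at h
  rw [h, root_eq_xv]
  ring

/-! ### The value of the Fomin–Stanley function at the longest element -/

theorem rowProd_eq_zero_of_len {n N : ℕ} (a : R n) {Φ : W n → R n}
    (hΦ : ∀ w, N < len w → Φ w = 0) (m : ℕ) : ∀ (c : ℕ) (z : ℕ → R n) (w : W n), N + m < len w →
      rowProd (descentOp n) c m a z Φ w = 0 := by
  induction m with
  | zero => intro c z w hw; exact hΦ w hw
  | succ m ih =>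
    intro c z w hw
    rw [rowProd, Module.End.mul_apply, expGen_descentOp_apply, ih _ _ w (by omega), zero_add]
    rcases le_or_gt n (c + 1) with hn | hn
    · rw [descentOp_of_le hn]
      exact mul_zero _
    · by_cases hd : IsDescent ⟨c + 1, hn⟩ w
      · have := len_s_mul_of_isDescent hd
        rw [descentOp_of_isDescent hd, ih _ _ _ (by omega), mul_zero]
      · rw [descentOp_of_not_isDescent hd, mul_zero]

/-- If the entry of `v⁻¹` at position `c` exceeds the `m` entries following it, then in the value at
`v` of a row of length `m` the term of highest degree moves this entry behind those `m` entries. -/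
theorem exists_rowProd_apply {n : ℕ} (m : ℕ) : ∀ (c : ℕ) (v : W n) (P : ℕ → ℤ), c + m < n →
    (∀ p : Fin n, entry v⁻¹ p = P p.val) → (∀ l, c < l → l ≤ c + m → P l < P c) →
    ∃ v' : W n, (∀ p : Fin n, entry v'⁻¹ p =
        if p.val < c ∨ c + m < p.val then P p.val else if p.val = c + m then P c
          else P (p.val + 1)) ∧ len v' + m = len v ∧
      ∀ (a : R n) (z : ℕ → R n) (Φ : W n → R n), (∀ w, len v' < len w → Φ w = 0) →
        rowProd (descentOp n) c m a z Φ v = (∏ b ∈ Finset.range m, (a - z b)) * Φ v' := by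
  induction m with
  | zero =>
    intro c v P _ hv _
    refine ⟨v, fun p => ?_, rfl, fun a z Φ _ => ?_⟩
    · rw [hv]
      split_ifs with h1 h2
      · rfl
      · rw [h2]; rfl
      · omega
    · rw [Finset.prod_range_zero, one_mul]
      rfl
  | succ m ih =>
    intro c v P hcm hv hP
    have hc : c + 1 < n := by omega
    have hd : IsDescent ⟨c + 1, hc⟩ v := by
      rw [isDescent_succ_iff, hv, hv]
      exact hP (c + 1) (by omega) (by omega)
    have hlen := len_s_mul_of_isDescent hd
    obtain ⟨v', h1, h2, h3⟩ := ih (c + 1) (s ⟨c + 1, hc⟩ * v)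
      (fun p => P (Equiv.swap c (c + 1) p)) (by omega) (fun p => by
        rw [entry_s_mul_inv, hv]
        congr 1
        simp only [Equiv.swap_apply_def, Fin.ext_iff]
        split_ifs <;> rfl)
      (fun l hl1 hl2 => by
        rw [Equiv.swap_apply_right, Equiv.swap_apply_of_ne_of_ne (by omega) (by omega)]
        exact hP l (by omega) (by omega))
    refine ⟨v', fun p => ?_, by omega, fun a z Φ hΦ => ?_⟩
    · rw [h1]
      simp only [Equiv.swap_apply_def]
      split_ifs <;> first | rfl | omega | (congr 1; omega)
    · rw [rowProd, Module.End.mul_apply, expGen_descentOp_apply, descentOp_of_isDescent hd,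
        h3 a _ Φ hΦ, rowProd_eq_zero_of_len a hΦ m _ _ v (by omega), zero_add,
        Finset.prod_range_succ']
      ring

/-- The element `v` in the statement is the inverse of `(n, …, n + 1 - j, 1, …, n - j)`. -/
theorem stanleyFun_apply_of_entry {n : ℕ} (j : ℕ) : j ≤ n → ∀ v : W n,
    (∀ p : Fin n, entry v⁻¹ p = if p.val < j then (n : ℤ) - p.val else p.val + 1 - j) →
      (∀ w, len v < len w → stanleyFun n j w = 0) ∧
        stanleyFun n j v = ∏ i ∈ Finset.range j, diffProd n i (n - 1 - i) := by
  induction j with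
  | zero =>
    intro _ v hv
    have : v = 1 := by
      rw [← inv_eq_one]
      apply entry_injective
      funext p
      rw [hv]
      simp [entry]
    subst this
    classical
    refine ⟨fun w hw => ?_, by simp [stanleyFun]⟩
    rw [stanleyFun, Pi.single_eq_of_ne]
    rintro rfl
    exact lt_irrefl _ hw
  | succ j ih =>
    intro hj v hv
    obtain ⟨v', h1, h2, h3⟩ := exists_rowProd_apply (n - 1 - j) j v
      (fun p => if p < j + 1 then (n : ℤ) - p else p + 1 - (j + 1 : ℕ)) (by omega) hv
      (fun l hl1 hl2 => by
        rw [if_neg (by omega), if_pos (by omega)]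
        omega)
    obtain ⟨h4, h5⟩ := ih (by omega) v' (fun p => by
      rw [h1]
      have := p.isLt
      split_ifs <;> push_cast <;> omega)
    constructor
    · intro w hw
      exact rowProd_eq_zero_of_len _ h4 _ _ _ w (by omega)
    · rw [stanleyFun, h3 _ _ _ h4, h5, Finset.prod_range_succ, mul_comm]
      rfl

theorem stanleyFun_longest (n : ℕ) : stanleyFun n n (ofPerm n (ϖ₀ n)) = Δ n := by
  rw [Δ_eq_deltaProd]
  refine (stanleyFun_apply_of_entry n le_rfl _ fun p => ?_).2
  rw [← map_inv, if_pos p.isLt]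
  have := p.isLt
  simp [entry, ofPerm, Fin.val_rev]
  omega

/-- The double Schubert polynomials are the values of the Fomin–Stanley function. -/
theorem schubertA_eq_stanleyFun {n : ℕ} (ϖ : Equiv.Perm (Fin n)) :
    schubertA ϖ = stanleyFun n n (ofPerm n ϖ⁻¹) := by
  have hrev : ϖ₀ n * ϖ₀ n = 1 := by ext; simp
  have key : ∀ b : List (Fin n), (∀ k ∈ b, k.val ≠ 0) → b.length = len (b.map s).prod →
      b.foldr divDiff (Δ n) = stanleyFun n n ((b.map s).prod * ofPerm n (ϖ₀ n)) := by
    intro b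
    induction b with
    | nil =>
      intro _ _
      simp [stanleyFun_longest]
    | cons k b ih =>
      intro hb hlen
      have hk : k.val ≠ 0 := hb k List.mem_cons_self
      have hb' : ∀ l ∈ b, l.val ≠ 0 := fun l hl => hb l (List.mem_cons_of_mem _ hl)
      have hle := len_le_length b
      rw [List.map_cons, List.prod_cons, List.length_cons] at hlen
      have hnd : ¬IsDescent k (b.map s).prod := fun hd => by
        have := len_s_mul_of_isDescent hd
        omega
      have hlen' := len_s_mul_of_not_isDescent hnd
      rw [List.foldr_cons, ih hb' (by omega), List.map_cons, List.prod_cons]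
      obtain ⟨σ, hσ⟩ := exists_perm_of_pos hb'
      obtain ⟨c, hc, rfl⟩ : ∃ (c : ℕ) (hc : c + 1 < n), k = ⟨c + 1, hc⟩ :=
        ⟨k.val - 1, by omega, Fin.ext (by simp only; omega)⟩
      rw [divDiff_stanleyFun, descentOp_of_isDescent (h := hc), mul_assoc]
      rw [hσ] at hnd ⊢
      rw [isDescent_succ_iff] at hnd ⊢
      have hne := (entry_inj (ofPerm n σ)⁻¹).not.2
        (show (⟨c + 1, hc⟩ : Fin n) ≠ ⟨c, by omega⟩ by simp)
      rw [← map_inv] at hnd hne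
      rw [← map_mul, ← map_inv]
      simp [entry, ofPerm, Fin.val_rev] at hnd hne ⊢
      exact lt_of_le_of_ne hnd fun h => hne (congrArg Fin.val h.symm)
  obtain ⟨b, h1, h2, h3⟩ := exists_pos_word (ϖ⁻¹ * ϖ₀ n)
  rw [schubertA, divDiffW_eq (isReducedWord_iff.2 ⟨h1, h2⟩), key b h3 (by rw [h1, h2]), h1,
    ← map_mul, mul_assoc, hrev, mul_one]

/-! ### Positivity -/

/-- The polynomials `f` such that `f(ϖ₀ X, -Y)` has nonnegative coefficients. -/
noncomputable def positiveCone (n : ℕ) : Subsemiring (R n) where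
  carrier := {f | ∀ m, 0 ≤ coeff m (revNeg n f)}
  mul_mem' {f g} hf hg m := by
    rw [map_mul, coeff_mul]
    exact Finset.sum_nonneg fun p _ => mul_nonneg (hf _) (hg _)
  one_mem' m := by
    rw [map_one, coeff_one]
    split_ifs <;> simp
  add_mem' {f g} hf hg m := by
    rw [map_add, coeff_add]
    exact add_nonneg (hf m) (hg m)
  zero_mem' m := by simp

theorem xv_sub_yv_mem_positiveCone {n i j : ℕ} (hi : i < n) (hj : j < n) :
    xv n i - yv n j ∈ positiveCone n := by
  intro m
  rw [xv, dif_pos hi, yv, dif_pos hj, map_sub, revNeg_x, revNeg_y, sub_neg_eq_add, coeff_add,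
    coeff_X, coeff_X]
  split_ifs <;> simp

theorem rowProd_mem_positiveCone {n : ℕ} {a : R n} {Φ : W n → R n} (hΦ : ∀ w, Φ w ∈ positiveCone n)
    (m : ℕ) : ∀ (c : ℕ) (z : ℕ → R n), (∀ b < m, a - z b ∈ positiveCone n) →
      ∀ w, rowProd (descentOp n) c m a z Φ w ∈ positiveCone n := by
  induction m with
  | zero => intro c z _ w; exact hΦ w
  | succ m ih =>
    intro c z hz w
    have h := ih (c + 1) (fun b => z (b + 1)) fun b hb => hz (b + 1) (by omega)
    rw [rowProd, Module.End.mul_apply, expGen_descentOp_apply]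
    refine add_mem (h w) (mul_mem (hz 0 (by omega)) ?_)
    rcases le_or_gt n (c + 1) with hn | hn
    · rw [descentOp_of_le hn]
      exact zero_mem _
    · by_cases hd : IsDescent ⟨c + 1, hn⟩ w
      · rw [descentOp_of_isDescent hd]
        exact h _
      · rw [descentOp_of_not_isDescent hd]
        exact zero_mem _

theorem stanleyFun_mem_positiveCone {n j : ℕ} (hj : j ≤ n) (w : W n) :
    stanleyFun n j w ∈ positiveCone n := by
  induction j generalizing w with
  | zero =>
    classical
    rw [stanleyFun, Pi.single_apply]
    split_ifs
    · exact one_mem _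
    · exact zero_mem _
  | succ j ih =>
    exact rowProd_mem_positiveCone (ih (by omega)) _ _ _
      (fun b hb => xv_sub_yv_mem_positiveCone (by omega) (by omega)) w

theorem coeff_revNeg_schubertA_nonneg {n : ℕ} (ϖ : Equiv.Perm (Fin n)) (m : Fin n ⊕ Fin n →₀ ℕ) :
    0 ≤ coeff m (revNeg n (schubertA ϖ)) := by
  rw [schubertA_eq_stanleyFun]
  exact stanleyFun_mem_positiveCone le_rfl _ m

end TypeC


theorem theorem1p2 (n : ℕ) (ϖ : Equiv.Perm (Fin n)) :
    TypeC.schubertC (TypeC.ofPerm n ϖ) =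
        TypeC.revNeg n (TypeC.schubertA (TypeC.ϖ₀ n * ϖ * TypeC.ϖ₀ n)) ∧
      ∀ m : Fin n ⊕ Fin n →₀ ℕ, 0 ≤ (TypeC.schubertC (TypeC.ofPerm n ϖ)).coeff m := by
  have h := TypeC.schubertC_ofPerm_of_longest (TypeC.foldr_barWord_Δ_mul_Qkernel n) ϖ
  refine ⟨h, fun m => ?_⟩
  rw [h]
  exact TypeC.coeff_revNeg_schubertA_nonneg _ m
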